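/- Let $k\ge 1$, ${\bf n}=(n_1,\dots,n_k)$, ${\bf m}=(m_1,\dots,m_k)$ with $n_i,m_i\ge 1$, and let $\mathcal K$ be a complex Hilbert space. **Domain.** For a tuple ${\bf X}=(X_{i,j})_{1\le i\le k,\,1\le j\le n_i}$ of bounded operators on a Hilbert space $\mathcal E$ put $\Phi_{X_i}(Y)=\sum_j X_{i,j}YX_{i,j}^*$ and ${\bf\Delta}^{\bf p}_{\bf X}=(id-\Phi_{X_1})^{p_1}\circ\cdots\circ(id-\Phi_{X_k})^{p_k}$. The poly-hyperball ${\bf D_n^m}(\mathcal E)$ is the set of all ${\bf X}$ such that $X_{p,i}$ commutes with $X_{q,j}$ whenever $p\ne q$, and ${\bf\Delta}^{\bf p}_{\bf X}(I)\ge 0$ for all ${\bf 0}\le{\bf p}\le{\bf m}$. Its radial part is ${\bf D}^{\bf m}_{{\bf n},rad}(\mathcal E)=\bigcup_{0\le r<1}r{\bf D_n^m}(\mathcal E)$. **Universal model.** Let $\mathbb F_d^+$ be the free unital semigroup on $d$ generators $g_1,\dots,g_d$, let ${\bf F}^+_{\bf n}=\mathbb F^+_{n_1}\times\cdots\times\mathbb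 F^+_{n_k}$, and let $\mathcal F=\bigotimes_{i=1}^k F^2(H_{n_i})$ be the tensor product of the full Fock spaces, with orthonormal basis $e_{\boldsymbol\alpha}=e^1_{\alpha_1}\otimes\cdots\otimes e^k_{\alpha_k}$, $\boldsymbol\alpha\in{\bf F}_{\bf n}^+$. For $\alpha\in\mathbb F_{n_i}^+$ let $b_{i,\alpha}=\binom{|\alpha|+m_i-1}{m_i-1}$, and let ${\bf W}=({\bf W}_{i,j})$, where ${\bf W}_{i,j}$ acts in the $i$-th tensor factor by $e^i_\alpha\mapsto\sqrt{b_{i,\alpha}/b_{i,g_j\alpha}}\,e^i_{g_j\alpha}$ and as the identity in the others. Write $X_{i,\alpha}=X_{i,j_1}\cdots X_{i,j_p}$ for $\alpha=g_{j_1}\cdots g_{j_p}$. **Free pluriharmonic functions.** Let $B(\mathcal K)\otimes_{min}B(\mathcal E)\subset B(\mathcal K\otimes\mathcal E)$ be the spatial tensor product. A free $k$-pluriharmonic function on the radial poly-hyperball with coefficients in $B(\mathcal K)$ is a family of maps ${\bf D}^{\bf m}_{{\bf n},rad}(\mathcal E)\to B(\mathcal K)\otimes_{min}B(\mathcal E)$,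 one for each Hilbert space $\mathcal E$ (its representation on $\mathcal E$), such that for some operators $A_{(\boldsymbol\alpha,\boldsymbol\beta)}\in B(\mathcal K)$, for all $\mathcal E$ and all ${\bf X}\in{\bf D}^{\bf m}_{{\bf n},rad}(\mathcal E)$, $$F({\bf X})=\sum_{s_1\in\mathbb Z}\cdots\sum_{s_k\in\mathbb Z}\ \sum_{|\alpha_i|=s_i^+,\ |\beta_i|=s_i^-}A_{(\boldsymbol\alpha,\boldsymbol\beta)}\otimes X_{1,\alpha_1}\cdots X_{k,\alpha_k}X_{1,\beta_1}^*\cdots X_{k,\beta_k}^*$$ with convergence in the operator norm. It is bounded if $\sup\|F({\bf X})\|<\infty$, the supremum being over all ${\bf X}\in{\bf D}^{\bf m}_{{\bf n},rad}(\mathcal E)$ and all Hilbert spaces $\mathcal E$. The vector space ${\bf PH}^\infty_{\mathcal K}$ of bounded free $k$-pluriharmonic functions carries the matrix norms $\|[F_{ij}]_q\|=\sup\|[F_{ij}({\bf X})]_q\|$, with the same range of the supremum. **Weighted multi-Toeplitz operators.** Call $\boldsymbol\omega,\boldsymbol\gamma\in{\bf F}^+_{\bf n}$ comparable if for each $i$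 there is $\sigma_i$ with $\omega_i=\sigma_i\gamma_i$ or there is $\beta_i$ with $\gamma_i=\beta_i\omega_i$; then put ${\bf s}(\boldsymbol\omega,\boldsymbol\gamma)=(\boldsymbol\sigma,\boldsymbol\beta)$, where $\sigma_i$ (resp. $\beta_i$) is the identity if it is not defined by such a relation, and $\tau_{(\boldsymbol\omega,\boldsymbol\gamma)}=\prod_i\sqrt{b_{i,\min}/b_{i,\max}}$, where $\min$ and $\max$ denote the shorter and the longer of $\omega_i,\gamma_i$. An operator $T\in B(\mathcal K\otimes\mathcal F)$ is weighted multi-Toeplitz if there are operators $A_{(\boldsymbol\sigma,\boldsymbol\beta)}\in B(\mathcal K)$ such that $\langle T(x\otimes e_{\boldsymbol\gamma}),y\otimes e_{\boldsymbol\omega}\rangle$ equals $\tau_{(\boldsymbol\omega,\boldsymbol\gamma)}\langle A_{{\bf s}(\boldsymbol\omega,\boldsymbol\gamma)}x,y\rangle$ if $\boldsymbol\omega,\boldsymbol\gamma$ are comparable and $0$ otherwise, for all $\boldsymbol\omega,\boldsymbol\gamma\in{\bf F}^+_{\bf n}$ and $x,y\in\mathcal K$. Let $\boldsymbol{\mathcal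 T}\subset B(\mathcal K\otimes\mathcal F)$ be the space of these operators. **Berezin transform.** For ${\bf X}\in{\bf D}^{\bf m}_{{\bf n},rad}(\mathcal E)$ let ${\bf K_X}:\mathcal E\to\mathcal F\otimes\mathcal E$ be the bounded operator ${\bf K_X}h=\sum_{\boldsymbol\beta}\sqrt{b_{1,\beta_1}\cdots b_{k,\beta_k}}\;e_{\boldsymbol\beta}\otimes{\bf\Delta^m_X}(I)^{1/2}X_{1,\beta_1}^*\cdots X_{k,\beta_k}^*h$, and let $\widetilde{\bf B}_{\bf X}[g]=(I_{\mathcal K}\otimes{\bf K_X^*})(g\otimes I_{\mathcal E})(I_{\mathcal K}\otimes{\bf K_X})$ for $g\in B(\mathcal K\otimes\mathcal F)$. **Theorem.** Let $\mathcal H$ be a separable infinite dimensional Hilbert space and let $F:{\bf D}^{\bf m}_{{\bf n},rad}(\mathcal H)\to B(\mathcal K)\otimes_{min}B(\mathcal H)$. The following are equivalent: (i) $F$ is (the representation on $\mathcal H$ of) a bounded free $k$-pluriharmonic function; (ii) there is $T\in\boldsymbol{\mathcal T}$ such that $F({\bf X})=\widetilde{\bf B}_{\bf X}[T]$ for all ${\bf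 X}\in{\bf D}^{\bf m}_{{\bf n},rad}(\mathcal H)$. In this case $T=\text{SOT-}\lim_{r\to1}F(r{\bf W})$, where $F(r{\bf W})$ is formed by identifying $\mathcal F$ with $\mathcal H$ through any unitary. Moreover, the map $\Phi:{\bf PH}^\infty_{\mathcal K}\to\boldsymbol{\mathcal T}$, $\Phi(F)=T$, is a completely isometric isomorphism of operator spaces: it is a linear bijection, and $\|[\Phi(F_{ij})]_q\|=\|[F_{ij}]_q\|$ for every $q$ and every $q\times q$ matrix $[F_{ij}]_q$ over ${\bf PH}^\infty_{\mathcal K}$. -/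

import Mathlib

open scoped TensorProduct InnerProductSpace Topology

universe v w

noncomputable section

namespace PolyHyperball

/-! ### Hilbert space tensor products -/

section Tensor

/-- The Hilbert space tensor product `E ⊗ F`: the completion of the algebraic tensor product with
respect to `⟪x ⊗ y, x' ⊗ y'⟫ = ⟪x, x'⟫ ⟪y, y'⟫`. -/
def HTensor (E F : Type*) [NormedAddCommGroup E] [InnerProductSpace ℂ E]
    [NormedAddCommGroup F] [InnerProductSpace ℂ F] : Type _ :=
  UniformSpace.Completion (E ⊗[ℂ] F)

variable {E F G E' F' : Type*}
  [NormedAddCommGroup E] [InnerProductSpace ℂ E]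
  [NormedAddCommGroup F] [InnerProductSpace ℂ F]
  [NormedAddCommGroup G] [InnerProductSpace ℂ G]
  [NormedAddCommGroup E'] [InnerProductSpace ℂ E']
  [NormedAddCommGroup F'] [InnerProductSpace ℂ F']

instance : NormedAddCommGroup (HTensor E F) :=
  inferInstanceAs (NormedAddCommGroup (UniformSpace.Completion (E ⊗[ℂ] F)))

instance : InnerProductSpace ℂ (HTensor E F) :=
  inferInstanceAs (InnerProductSpace ℂ (UniformSpace.Completion (E ⊗[ℂ] F)))

instance : CompleteSpace (HTensor E F) :=
  inferInstanceAs (CompleteSpace (UniformSpace.Completion (E ⊗[ℂ] F)))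

variable (E F) in
/-- The canonical isometric embedding of the algebraic tensor product, with dense range. -/
def hIncl : E ⊗[ℂ] F →ₗᵢ[ℂ] HTensor E F :=
  (UniformSpace.Completion.toComplₗᵢ : E ⊗[ℂ] F →ₗᵢ[ℂ] UniformSpace.Completion (E ⊗[ℂ] F))

theorem denseRange_hIncl : DenseRange (hIncl E F) :=
  (UniformSpace.Completion.denseRange_coe : DenseRange
    ((↑) : E ⊗[ℂ] F → UniformSpace.Completion (E ⊗[ℂ] F)))

/-- The elementary tensor `x ⊗ y` as a vector of the Hilbert space tensor product. -/
def hTmul (x : E) (y : F) : HTensor E F := hIncl E F (x ⊗ₜ[ℂ] y)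

/-- The tensor product `f ⊗ g` of two bounded operators: the bounded operator with
`(f ⊗ g) (x ⊗ y) = f x ⊗ g y`, see `hMap_hTmul`. -/
def hMap (f : E →L[ℂ] E') (g : F →L[ℂ] F') : HTensor E F →L[ℂ] HTensor E' F' :=
  ContinuousLinearMap.extend
    ((hIncl E' F').toContinuousLinearMap.comp (TensorProduct.mapL f g))
    (hIncl E F).toContinuousLinearMap

theorem hMap_hIncl (f : E →L[ℂ] E') (g : F →L[ℂ] F') (z : E ⊗[ℂ] F) :
    hMap f g (hIncl E F z) = hIncl E' F' (TensorProduct.mapL f g z) :=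
  ContinuousLinearMap.extend_eq
    ((hIncl E' F').toContinuousLinearMap.comp (TensorProduct.mapL f g))
    (e := (hIncl E F).toContinuousLinearMap) denseRange_hIncl
    (hIncl E F).isometry.isUniformInducing z

theorem hMap_hTmul (f : E →L[ℂ] E') (g : F →L[ℂ] F') (x : E) (y : F) :
    hMap f g (hTmul x y) = hTmul (f x) (g y) := by
  simp [hTmul, hMap_hIncl]

theorem hTensor_inner (x x' : E) (y y' : F) :
    ⟪hTmul x y, hTmul x' y'⟫_ℂ = ⟪x, x'⟫_ℂ * ⟪y, y'⟫_ℂ := by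
  simp [hTmul]

theorem denseRange_lTensor (f : F →ₗᵢ[ℂ] G) (hf : DenseRange f) :
    DenseRange (f.lTensor E) := by
  intro z
  induction z using TensorProduct.induction_on with
  | zero => exact subset_closure ⟨0, map_zero _⟩
  | tmul x y =>
    have hc : Continuous fun y : G => x ⊗ₜ[ℂ] y := by fun_prop
    refine map_mem_closure (f := fun y : G => x ⊗ₜ[ℂ] y) hc (hf y) ?_
    rintro _ ⟨w, rfl⟩
    exact ⟨x ⊗ₜ w, by simp⟩
  | add a b ha hb =>
    refine map_mem_closure₂ continuous_add ha hb ?_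
    rintro _ ⟨u, rfl⟩ _ ⟨v, rfl⟩
    exact ⟨u + v, map_add _ _ _⟩

theorem denseRange_rTensor (f : F →ₗᵢ[ℂ] G) (hf : DenseRange f) :
    DenseRange (f.rTensor E) := by
  intro z
  induction z using TensorProduct.induction_on with
  | zero => exact subset_closure ⟨0, map_zero _⟩
  | tmul x y =>
    have hc : Continuous fun x : G => x ⊗ₜ[ℂ] y := by fun_prop
    refine map_mem_closure (f := fun x : G => x ⊗ₜ[ℂ] y) hc (hf x) ?_
    rintro _ ⟨w, rfl⟩
    exact ⟨w ⊗ₜ y, by simp⟩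
  | add a b ha hb =>
    refine map_mem_closure₂ continuous_add ha hb ?_
    rintro _ ⟨u, rfl⟩ _ ⟨v, rfl⟩
    exact ⟨u + v, map_add _ _ _⟩

variable (E F G) in
/-- The isometric embedding of the algebraic tensor product `E ⊗ (F ⊗ G)` in the Hilbert space
tensor product. -/
def assocEmbL : E ⊗[ℂ] (F ⊗[ℂ] G) →ₗᵢ[ℂ] HTensor E (HTensor F G) :=
  (hIncl E (HTensor F G)).comp ((hIncl F G).lTensor E)

variable (E F G) in
/-- The isometric embedding of the algebraic tensor product `(E ⊗ F) ⊗ G` in the Hilbert space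
tensor product. -/
def assocEmbR : (E ⊗[ℂ] F) ⊗[ℂ] G →ₗᵢ[ℂ] HTensor (HTensor E F) G :=
  (hIncl (HTensor E F) G).comp ((hIncl E F).rTensor G)

theorem denseRange_assocEmbL : DenseRange (assocEmbL E F G).toLinearMap :=
  denseRange_hIncl.comp (denseRange_lTensor _ denseRange_hIncl) (hIncl _ _).continuous

theorem denseRange_assocEmbR : DenseRange (assocEmbR E F G).toLinearMap :=
  denseRange_hIncl.comp (denseRange_rTensor _ denseRange_hIncl) (hIncl _ _).continuous

theorem norm_assocEmb (z : E ⊗[ℂ] (F ⊗[ℂ] G)) :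
    ‖(assocEmbR E F G).toLinearMap ((TensorProduct.assoc ℂ E F G).symm z)‖ =
      ‖(assocEmbL E F G).toLinearMap z‖ := by
  have h := TensorProduct.norm_assoc ((TensorProduct.assoc ℂ E F G).symm z)
  simp only [LinearEquiv.apply_symm_apply] at h
  simp only [LinearIsometry.coe_toLinearMap, LinearIsometry.norm_map]
  exact h.symm

variable (E F G) in
/-- The canonical unitary `E ⊗ (F ⊗ G) ≃ (E ⊗ F) ⊗ G`, see `hAssoc_hTmul`. -/
def hAssoc : HTensor E (HTensor F G) ≃ₗᵢ[ℂ] HTensor (HTensor E F) G :=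
  (TensorProduct.assoc ℂ E F G).symm.extendOfIsometry
    (assocEmbL E F G).toLinearMap (assocEmbR E F G).toLinearMap
    denseRange_assocEmbL denseRange_assocEmbR norm_assocEmb

theorem hAssoc_hTmul (x : E) (y : F) (z : G) :
    hAssoc E F G (hTmul x (hTmul y z)) = hTmul (hTmul x y) z :=
  LinearEquiv.extendOfIsometry_eq (TensorProduct.assoc ℂ E F G).symm
    (assocEmbL E F G).toLinearMap (assocEmbR E F G).toLinearMap
    denseRange_assocEmbL denseRange_assocEmbR norm_assocEmb (x ⊗ₜ (y ⊗ₜ z))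

variable (E F) in
/-- The minimal (spatial) tensor product `B(E) ⊗_min B(F)`: the norm closure in `B(E ⊗ F)` of the
linear span of the operators `a ⊗ b`. -/
def minTensor : Submodule ℂ (HTensor E F →L[ℂ] HTensor E F) :=
  (Submodule.span ℂ
    {c | ∃ (a : E →L[ℂ] E) (b : F →L[ℂ] F), c = hMap a b}).topologicalClosure

/-- The operator on the `q`-fold Hilbert space direct sum of `E` given by a `q × q` matrix of
operators on `E`. -/
def blockOp {q : ℕ} (M : Matrix (Fin q) (Fin q) (E →L[ℂ] E)) :
    PiLp 2 (fun _ : Fin q => E) →L[ℂ] PiLp 2 (fun _ : Fin q => E) :=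
  ((PiLp.continuousLinearEquiv 2 ℂ (fun _ : Fin q => E)).symm :
      (Fin q → E) →L[ℂ] PiLp 2 (fun _ : Fin q => E)).comp
    ((ContinuousLinearMap.pi fun i =>
        ∑ j, (M i j).comp (ContinuousLinearMap.proj (R := ℂ) (φ := fun _ : Fin q => E) j)).comp
      ((PiLp.continuousLinearEquiv 2 ℂ (fun _ : Fin q => E)) :
        PiLp 2 (fun _ : Fin q => E) →L[ℂ] (Fin q → E)))

end Tensor

/-! ### Operator tuples and the noncommutative poly-hyperball -/

section Domain

variable {k : ℕ} (n m : Fin k → ℕ)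

/-- Tuples `X = (X₁, …, X_k)` with `X_i = (X_{i,1}, …, X_{i,n_i})` of bounded operators on `E`. -/
abbrev OpTuple (E : Type*) [NormedAddCommGroup E] [InnerProductSpace ℂ E] : Type _ :=
  ∀ i : Fin k, Fin (n i) → (E →L[ℂ] E)

variable {E : Type*} [NormedAddCommGroup E] [InnerProductSpace ℂ E] [CompleteSpace E]

variable {n} in
/-- The completely positive map `Φ_{X_i}(Y) = ∑_j X_{i,j} Y X_{i,j}^*`. -/
def cpMap (X : OpTuple n E) (i : Fin k) : Module.End ℂ (E →L[ℂ] E) where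
  toFun Y := ∑ j, X i j * Y * star (X i j)
  map_add' Y Z := by simp [mul_add, add_mul, Finset.sum_add_distrib]
  map_smul' c Y := by simp [Finset.smul_sum]

variable {n} in
/-- The defect map `Δ_X^p = (id - Φ_{X_1})^{p_1} ∘ ⋯ ∘ (id - Φ_{X_k})^{p_k}`. -/
def defectMap (X : OpTuple n E) (p : Fin k → ℕ) : Module.End ℂ (E →L[ℂ] E) :=
  (List.ofFn fun i => (1 - cpMap X i) ^ p i).prod

/-- The noncommutative poly-hyperball `D_n^m(E)`. -/
def polyHyperball (E : Type*) [NormedAddCommGroup E] [InnerProductSpace ℂ E] [CompleteSpace E] :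
    Set (OpTuple n E) :=
  {X | (∀ p q, p ≠ q → ∀ i j, Commute (X p i) (X q j)) ∧
    ∀ p : Fin k → ℕ, p ≤ m → (defectMap X p 1).IsPositive}

/-- The radial part `⋃_{0 ≤ r < 1} r D_n^m(E)` of the poly-hyperball. -/
def radial (E : Type*) [NormedAddCommGroup E] [InnerProductSpace ℂ E] [CompleteSpace E] :
    Set (OpTuple n E) :=
  {X | ∃ r : ℝ, 0 ≤ r ∧ r < 1 ∧ ∃ Y ∈ polyHyperball n m E, X = (r : ℂ) • Y}

/-- Elements `α = (α₁, …, α_k)` of `F_{n_1}^+ × ⋯ × F_{n_k}^+`: the free unital semigroup on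
`n_i` generators is the set of words in `n_i` letters, the identity being the empty word. -/
abbrev Words : Type := ∀ i : Fin k, List (Fin (n i))

/-- `X_{i,α} = X_{i,j_1} ⋯ X_{i,j_p}` for the word `α = g_{j_1} ⋯ g_{j_p}`. -/
def wordOp {d : ℕ} (x : Fin d → (E →L[ℂ] E)) (α : List (Fin d)) : E →L[ℂ] E :=
  (α.map x).prod

variable {n} in
/-- `X_{1,α_1} ⋯ X_{k,α_k}`. -/
def multiOp (X : OpTuple n E) (α : Words n) : E →L[ℂ] E :=
  (List.ofFn fun i => wordOp (X i) (α i)).prod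

variable {n} in
/-- `X_{1,β_1}^* ⋯ X_{k,β_k}^*`. -/
def multiOpStar (X : OpTuple n E) (β : Words n) : E →L[ℂ] E :=
  (List.ofFn fun i => star (wordOp (X i) (β i))).prod

end Domain

/-! ### The Fock space and the universal model -/

section Model

variable {k : ℕ} (n m : Fin k → ℕ)

/-- The tensor product `F²(H_{n_1}) ⊗ ⋯ ⊗ F²(H_{n_k})` of the full Fock spaces, realised as the
`ℓ²` space on its canonical orthonormal basis `e_α = e_{α_1} ⊗ ⋯ ⊗ e_{α_k}`, where `α_i` runs
over the words in `n_i` letters. -/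
abbrev Fock : Type := lp (fun _ : Words n => ℂ) 2

/-- The basis vector `e_α = e_{α_1} ⊗ ⋯ ⊗ e_{α_k}`. -/
def basisVec (α : Words n) : Fock n := lp.single 2 α (1 : ℂ)

theorem orthonormal_basisVec : Orthonormal ℂ (basisVec n) := by
  classical
  rw [orthonormal_iff_ite]
  intro α β
  simp only [basisVec, lp.inner_single_left, lp.single_apply]
  by_cases h : α = β
  · subst h; simp
  · simp [h]

/-- The weights `b_α^{(m)} = binom(|α| + m - 1, m - 1)`, for `m ≥ 1`. -/
def weight {d : ℕ} (m : ℕ) (α : List (Fin d)) : ℝ :=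
  (Nat.choose (α.length + m - 1) (m - 1) : ℝ)

theorem weight_pos {d : ℕ} (m : ℕ) (α : List (Fin d)) : 0 < weight m α := by
  unfold weight
  exact_mod_cast Nat.choose_pos (by omega)

theorem weight_le_cons {d : ℕ} (m : ℕ) (j : Fin d) (α : List (Fin d)) :
    weight m α ≤ weight m (j :: α) := by
  unfold weight
  exact_mod_cast Nat.choose_le_choose _ (by simp only [List.length_cons]; omega)

/-- The diagonal operator on `Fock n` with `e_α ↦ d α • e_α`, for `|d| ≤ 1`. -/
def diagOp (d : Words n → ℝ) (hd : ∀ α, |d α| ≤ 1) : Fock n →L[ℂ] Fock n :=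
  have key : ∀ (f : Fock n) (α : Words n), ‖(d α : ℂ) * f α‖ ≤ ‖f α‖ := fun f α => by
    rw [norm_mul, Complex.norm_real, Real.norm_eq_abs]
    exact mul_le_of_le_one_left (norm_nonneg _) (hd α)
  LinearMap.mkContinuous
    { toFun := fun f => ⟨fun α => (d α : ℂ) * f α, by
        refine memℓp_gen ?_
        refine Summable.of_nonneg_of_le (fun α => by positivity) (fun α => ?_)
          ((lp.memℓp f).summable (by simp))
        exact Real.rpow_le_rpow (norm_nonneg _) (key f α) (by simp)⟩
      map_add' := fun f g => by
        ext α; exact mul_add _ _ _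
      map_smul' := fun c f => by
        ext α; exact mul_left_comm _ _ _ } 1
    (fun f => by
      rw [one_mul]
      refine lp.norm_le_of_tsum_le (by simp) (norm_nonneg _) ?_
      rw [lp.norm_rpow_eq_tsum (by simp) f]
      refine Summable.tsum_le_tsum (fun α => Real.rpow_le_rpow (norm_nonneg _) (key f α) (by simp))
        ?_ ((lp.memℓp f).summable (by simp))
      refine Summable.of_nonneg_of_le (fun α => by positivity) (fun α => ?_)
        ((lp.memℓp f).summable (by simp))
      exact Real.rpow_le_rpow (norm_nonneg _) (key f α) (by simp))

theorem diagOp_basisVec (d : Words n → ℝ) (hd : ∀ α, |d α| ≤ 1) (α : Words n) :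
    diagOp n d hd (basisVec n α) = (d α : ℂ) • basisVec n α := by
  classical
  ext β
  change (d β : ℂ) * (basisVec n α : Words n → ℂ) β = (d α : ℂ) * (basisVec n α : Words n → ℂ) β
  by_cases h : β = α
  · rw [h]
  · simp [basisVec, lp.single_apply, h]

/-- `g_j^i α`: the generator `g_j` put in front of the `i`-th word of `α`. -/
def consAt (i : Fin k) (j : Fin (n i)) (α : Words n) : Words n :=
  Function.update α i (j :: α i)

theorem consAt_injective (i : Fin k) (j : Fin (n i)) : Function.Injective (consAt n i j) := by
  intro α β h
  funext l
  have hl := congrFun h l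
  by_cases hli : l = i
  · subst hli
    simpa [consAt] using hl
  · simpa [consAt, hli] using hl

/-- The left creation operator `I ⊗ ⋯ ⊗ S_{i,j} ⊗ ⋯ ⊗ I` on `Fock n`, `e_α ↦ e_{g_j^i α}`. -/
def leftCreation (i : Fin k) (j : Fin (n i)) : Fock n →L[ℂ] Fock n :=
  (((orthonormal_basisVec n).comp _ (consAt_injective n i j)).orthogonalFamily
    ).linearIsometry.toContinuousLinearMap

theorem leftCreation_basisVec (i : Fin k) (j : Fin (n i)) (α : Words n) :
    leftCreation n i j (basisVec n α) = basisVec n (consAt n i j α) := by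
  classical
  have h := (((orthonormal_basisVec n).comp _ (consAt_injective n i j)).orthogonalFamily
    ).linearIsometry_apply_single (i := α) (1 : ℂ)
  refine (Eq.trans ?_ h).trans ?_
  · rw [basisVec]
    rfl
  · simp

theorem abs_diag_le (i : Fin k) (j : Fin (n i)) (α : Words n) :
    |Real.sqrt (weight (m i) (α i) / weight (m i) (j :: α i))| ≤ 1 := by
  rw [abs_of_nonneg (Real.sqrt_nonneg _), Real.sqrt_le_one]
  exact (div_le_one (weight_pos _ _)).2 (weight_le_cons _ _ _)

/-- The universal model `W = (W_{i,j})`: the weighted left creation operators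
`W_{i,j} = S_{i,j} D_{i,j}`, `D_{i,j} e_α = √(b_{α_i} / b_{g_j α_i}) e_α`, acting in the `i`-th
tensor factor. -/
def model : OpTuple n (Fock n) := fun i j =>
  (leftCreation n i j).comp
    (diagOp n (fun α => Real.sqrt (weight (m i) (α i) / weight (m i) (j :: α i)))
      (abs_diag_le n m i j))

theorem model_basisVec (i : Fin k) (j : Fin (n i)) (α : Words n) :
    model n m i j (basisVec n α) =
      ((Real.sqrt (weight (m i) (α i) / weight (m i) (j :: α i)) : ℝ) : ℂ) •
        basisVec n (consAt n i j α) := by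
  rw [model, ContinuousLinearMap.comp_apply, diagOp_basisVec, map_smul, leftCreation_basisVec]

end Model

/-! ### The noncommutative Berezin transform -/

section Berezin

variable {k : ℕ} {n : Fin k → ℕ} (m : Fin k → ℕ)
variable {E : Type*} [NormedAddCommGroup E] [InnerProductSpace ℂ E] [CompleteSpace E]

/-- The summand `√b_{1,β_1} ⋯ √b_{k,β_k} e_β ⊗ Δ_X^m(I)^{1/2} X_{1,β_1}^* ⋯ X_{k,β_k}^* h` of the
Berezin kernel. -/
def kernelTerm (X : OpTuple n E) (h : E) (β : Words n) : HTensor (Fock n) E :=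
  ((∏ i, Real.sqrt (weight (m i) (β i)) : ℝ) : ℂ) •
    hTmul (basisVec n β) (CFC.sqrt (defectMap X m 1) (multiOpStar X β h))

open Classical in
/-- The noncommutative Berezin kernel `K_X : E → Fock ⊗ E`, i.e. the bounded operator
`h ↦ ∑_β √b_β e_β ⊗ Δ_X^m(I)^{1/2} X_β^* h`. (It exists, and is unique, for `X` in the
poly-hyperball; the value `0` is a dummy for tuples where there is no such bounded operator.) -/
def berezinKernel (X : OpTuple n E) : E →L[ℂ] HTensor (Fock n) E :=
  if hV : ∃ V : E →L[ℂ] HTensor (Fock n) E, ∀ h, HasSum (kernelTerm m X h) (V h)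
  then hV.choose else 0

variable {K : Type*} [NormedAddCommGroup K] [InnerProductSpace ℂ K]

/-- The extended noncommutative Berezin transform
`B_X[g] = (I_K ⊗ K_X^*) (g ⊗ I_E) (I_K ⊗ K_X)` of `g ∈ B(K ⊗ Fock)`; the identification of
`K ⊗ (Fock ⊗ E)` with `(K ⊗ Fock) ⊗ E` is made explicit. -/
def berezin (X : OpTuple n E) (g : HTensor K (Fock n) →L[ℂ] HTensor K (Fock n)) :
    HTensor K E →L[ℂ] HTensor K E :=
  let V : HTensor K E →L[ℂ] HTensor (HTensor K (Fock n)) E :=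
    ((hAssoc K (Fock n) E : HTensor K (HTensor (Fock n) E) →L[ℂ] HTensor (HTensor K (Fock n)) E)).comp
      (hMap (ContinuousLinearMap.id ℂ K) (berezinKernel m X))
  (ContinuousLinearMap.adjoint V).comp ((hMap g (ContinuousLinearMap.id ℂ E)).comp V)

end Berezin

/-! ### Weighted multi-Toeplitz operators -/

section Toeplitz

variable {k : ℕ} {n : Fin k → ℕ} (m : Fin k → ℕ)

/-- Comparability: for each `i`, one of `ω_i`, `γ_i` is of the form `σ` times the other. -/
def Comparable (ω γ : Words n) : Prop := ∀ i, γ i <:+ ω i ∨ ω i <:+ γ i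

/-- `ω \_r γ = σ` if `ω = σ γ`, and the empty word if `ω` is not of this form. -/
def rdiff {d : ℕ} (ω γ : List (Fin d)) : List (Fin d) :=
  if γ <:+ ω then ω.take (ω.length - γ.length) else []

/-- The weight `τ_{(ω,γ)} = ∏_i √(b_{min(ω_i,γ_i)} / b_{max(ω_i,γ_i)})`, for comparable words. -/
def tau (ω γ : Words n) : ℝ :=
  ∏ i, Real.sqrt (weight (m i) (if γ i <:+ ω i then γ i else ω i) /
    weight (m i) (if γ i <:+ ω i then ω i else γ i))

variable {K : Type*} [NormedAddCommGroup K] [InnerProductSpace ℂ K]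

open Classical in
/-- Weighted (right) multi-Toeplitz operators on `K ⊗ Fock`. (`inner` is linear in the second
variable. Only the values of `A` at the simplifications of comparable pairs matter.) -/
def IsMultiToeplitz (T : HTensor K (Fock n) →L[ℂ] HTensor K (Fock n)) : Prop :=
  ∃ A : Words n → Words n → (K →L[ℂ] K), ∀ (ω γ : Words n) (x y : K),
    ⟪hTmul y (basisVec n ω), T (hTmul x (basisVec n γ))⟫_ℂ =
      if Comparable ω γ then
        (tau m ω γ : ℂ) * ⟪y, A (fun i => rdiff (ω i) (γ i)) (fun i => rdiff (γ i) (ω i)) x⟫_ℂ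
      else 0

variable (n K) in
/-- The space of all weighted multi-Toeplitz operators on `K ⊗ Fock`. -/
def multiToeplitz : Submodule ℂ (HTensor K (Fock n) →L[ℂ] HTensor K (Fock n)) where
  carrier := {T | IsMultiToeplitz m T}
  zero_mem' := ⟨fun _ _ => 0, fun ω γ x y => by simp⟩
  add_mem' := by
    rintro S T ⟨A, hA⟩ ⟨B, hB⟩
    refine ⟨fun σ β => A σ β + B σ β, fun ω γ x y => ?_⟩
    rw [add_apply, inner_add_right, hA, hB]
    split_ifs
    · rw [add_apply, inner_add_right, mul_add]
    · simp
  smul_mem' := by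
    rintro c T ⟨A, hA⟩
    refine ⟨fun σ β => c • A σ β, fun ω γ x y => ?_⟩
    rw [smul_apply, inner_smul_right, hA]
    split_ifs
    · rw [smul_apply, inner_smul_right]; ring
    · simp

end Toeplitz

/-! ### Free `k`-pluriharmonic functions -/

section Pluriharmonic

/-- Convergence of the two-sided series `∑_{s ∈ ℤ} g s` to `a`, in norm. -/
def TwoSidedSum {V : Type*} [NormedAddCommGroup V] (g : ℤ → V) (a : V) : Prop :=
  Filter.Tendsto (fun N : ℕ × ℕ => ∑ s ∈ Finset.Icc (-(N.1 : ℤ)) (N.2 : ℤ), g s) Filter.atTop (𝓝 a)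

/-- Convergence of the iterated series `∑_{s_1 ∈ ℤ} ⋯ ∑_{s_k ∈ ℤ} f (s_1, …, s_k)` to `a`,
in norm. -/
def IteratedSum {V : Type*} [NormedAddCommGroup V] :
    ∀ {k : ℕ}, ((Fin k → ℤ) → V) → V → Prop
  | 0, f, a => f Fin.elim0 = a
  | _ + 1, f, a => ∃ g : ℤ → V,
      (∀ s, IteratedSum (fun t => f (Fin.cons s t)) (g s)) ∧ TwoSidedSum g a

theorem IteratedSum.zero {V : Type*} [NormedAddCommGroup V] {k : ℕ} :
    IteratedSum (fun _ : Fin k → ℤ => (0 : V)) 0 := by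
  induction k with
  | zero => rfl
  | succ k ih => exact ⟨fun _ => 0, fun _ => ih, by simp [TwoSidedSum]⟩

theorem IteratedSum.add {V : Type*} [NormedAddCommGroup V] {k : ℕ} {f g : (Fin k → ℤ) → V}
    {a b : V} (hf : IteratedSum f a) (hg : IteratedSum g b) :
    IteratedSum (fun s => f s + g s) (a + b) := by
  induction k generalizing a b with
  | zero =>
    have h1 : f Fin.elim0 = a := hf
    have h2 : g Fin.elim0 = b := hg
    change f Fin.elim0 + g Fin.elim0 = a + b
    rw [h1, h2]
  | succ k ih =>
    obtain ⟨u, hu, hu'⟩ := hf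
    obtain ⟨v, hv, hv'⟩ := hg
    refine ⟨fun s => u s + v s, fun s => ih (hu s) (hv s), ?_⟩
    simpa [TwoSidedSum, Finset.sum_add_distrib] using Filter.Tendsto.add hu' hv'

theorem IteratedSum.const_smul {V : Type*} [NormedAddCommGroup V] [NormedSpace ℂ V] {k : ℕ}
    {f : (Fin k → ℤ) → V} {a : V} (c : ℂ) (hf : IteratedSum f a) :
    IteratedSum (fun s => c • f s) (c • a) := by
  induction k generalizing a with
  | zero =>
    have h1 : f Fin.elim0 = a := hf
    change c • f Fin.elim0 = c • a
    rw [h1]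
  | succ k ih =>
    obtain ⟨u, hu, hu'⟩ := hf
    refine ⟨fun s => c • u s, fun s => ih (hu s), ?_⟩
    simpa [TwoSidedSum, Finset.smul_sum] using Filter.Tendsto.const_smul hu' c

variable {k : ℕ} {n m : Fin k → ℕ}
variable {K : Type*} [NormedAddCommGroup K] [InnerProductSpace ℂ K]

/-- The multi-homogeneous term
`q_s(X, X^*) = ∑ A_{(α, β)} ⊗ X_{1,α_1} ⋯ X_{k,α_k} X_{1,β_1}^* ⋯ X_{k,β_k}^*`, the sum over all
`α, β` with `|α_i| = s_i^+`, `|β_i| = s_i^-`. -/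
def homTerm {E : Type*} [NormedAddCommGroup E] [InnerProductSpace ℂ E] [CompleteSpace E]
    (A : Words n → Words n → (K →L[ℂ] K)) (X : OpTuple n E) (s : Fin k → ℤ) :
    HTensor K E →L[ℂ] HTensor K E :=
  ∑ α : (∀ i, List.Vector (Fin (n i)) (s i).toNat),
    ∑ β : (∀ i, List.Vector (Fin (n i)) (-s i).toNat),
      hMap (A (fun i => (α i).toList) (fun i => (β i).toList))
        (multiOp X (fun i => (α i).toList) * multiOpStar X (fun i => (β i).toList))

/-- A bundled complex Hilbert space. -/
structure HilbertSp : Type (w + 1) where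
  carrier : Type w
  [normed : NormedAddCommGroup carrier]
  [inner : InnerProductSpace ℂ carrier]
  [complete : CompleteSpace carrier]

attribute [instance] HilbertSp.normed HilbertSp.inner HilbertSp.complete

instance : CoeSort HilbertSp.{w} (Type w) := ⟨HilbertSp.carrier⟩

variable (n m K) in
/-- Free maps on the radial poly-hyperball: a representation
`D_{n,rad}^m(E) → B(K) ⊗_min B(E)` on every Hilbert space `E`. -/
abbrev FreeMap : Type _ := ∀ E : HilbertSp.{w}, radial n m E → minTensor K E

/-- Free `k`-pluriharmonic functions on the radial poly-hyperball with coefficients in `B(K)`: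
one family of coefficients gives the representation on every Hilbert space. -/
def IsFreePluriharmonic (F : FreeMap.{w} n m K) : Prop :=
  ∃ A : Words n → Words n → (K →L[ℂ] K),
    ∀ (E : HilbertSp.{w}) (X : radial n m E),
      IteratedSum (homTerm A X.1) (F E X : HTensor K E →L[ℂ] HTensor K E)

/-- Boundedness: the supremum of `‖F(X)‖` over all `X` and all Hilbert spaces is finite. -/
def IsBoundedFree (F : FreeMap.{w} n m K) : Prop :=
  ∃ C : ℝ, ∀ (E : HilbertSp.{w}) (X : radial n m E),
    ‖(F E X : HTensor K E →L[ℂ] HTensor K E)‖ ≤ C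

theorem hMap_zero_left {E : Type*} [NormedAddCommGroup E] [InnerProductSpace ℂ E]
    (g : E →L[ℂ] E) : hMap (0 : K →L[ℂ] K) g = 0 := by
  ext z
  refine denseRange_hIncl.induction_on z (isClosed_eq (by fun_prop) (by fun_prop)) fun z => ?_
  simp [hMap_hIncl]

theorem hMap_add_left {E : Type*} [NormedAddCommGroup E] [InnerProductSpace ℂ E]
    (a b : K →L[ℂ] K) (g : E →L[ℂ] E) : hMap (a + b) g = hMap a g + hMap b g := by
  ext z
  refine denseRange_hIncl.induction_on z (isClosed_eq (by fun_prop) (by fun_prop)) fun z => ?_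
  simp only [_root_.add_apply, hMap_hIncl, TensorProduct.mapL_add_left, map_add]

theorem hMap_smul_left {E : Type*} [NormedAddCommGroup E] [InnerProductSpace ℂ E]
    (c : ℂ) (a : K →L[ℂ] K) (g : E →L[ℂ] E) : hMap (c • a) g = c • hMap a g := by
  ext z
  refine denseRange_hIncl.induction_on z (isClosed_eq (hMap (c • a) g).continuous
    (c • hMap a g).continuous) fun z => ?_
  rw [_root_.smul_apply, hMap_hIncl, hMap_hIncl, TensorProduct.mapL_smul_left,
    _root_.smul_apply, map_smul]

variable (n m K) in
/-- The space `PH_K^∞` of bounded free `k`-pluriharmonic functions, with pointwise operations. -/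
def boundedPluriharmonic : Submodule ℂ (FreeMap.{w} n m K) where
  carrier := {F | IsFreePluriharmonic F ∧ IsBoundedFree F}
  zero_mem' := by
    refine ⟨⟨fun _ _ => 0, fun E X => ?_⟩, ⟨0, fun E X => ?_⟩⟩
    · have h : homTerm (fun _ _ => (0 : K →L[ℂ] K)) X.1 = fun _ => 0 := by
        funext s
        simp [homTerm, hMap_zero_left]
      rw [h]
      exact IteratedSum.zero
    · exact ContinuousLinearMap.opNorm_zero.le
  add_mem' := by
    rintro F G ⟨⟨A, hA⟩, C, hC⟩ ⟨⟨B, hB⟩, D, hD⟩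
    refine ⟨⟨fun α β => A α β + B α β, fun E X => ?_⟩, ⟨C + D, fun E X => ?_⟩⟩
    · have h : homTerm (fun α β => A α β + B α β) X.1 =
          fun s => homTerm A X.1 s + homTerm B X.1 s := by
        funext s
        simp only [homTerm, hMap_add_left, Finset.sum_add_distrib]
      rw [h]
      exact (hA E X).add (hB E X)
    · exact (ContinuousLinearMap.opNorm_add_le _ _).trans (add_le_add (hC E X) (hD E X))
  smul_mem' := by
    rintro c F ⟨⟨A, hA⟩, C, hC⟩
    refine ⟨⟨fun α β => c • A α β, fun E X => ?_⟩, ⟨‖c‖ * C, fun E X => ?_⟩⟩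
    · have h : homTerm (fun α β => c • A α β) X.1 = fun s => c • homTerm A X.1 s := by
        funext s
        simp only [homTerm, hMap_smul_left, Finset.smul_sum]
      rw [h]
      exact (hA E X).const_smul c
    · exact (ContinuousLinearMap.opNorm_smul_le _ _).trans
        (mul_le_mul_of_nonneg_left (hC E X) (norm_nonneg c))

/-- The set of the values `‖[F_{ij}(X)]‖`, for `X` in the radial poly-hyperball of any Hilbert
space. Its supremum is the norm of the matrix `[F_{ij}]` over the bounded free
`k`-pluriharmonic functions. -/
def matrixNormValues {q : ℕ} (F : Matrix (Fin q) (Fin q) (boundedPluriharmonic.{w} n m K)) :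
    Set ℝ :=
  {c | ∃ (E : HilbertSp.{w}) (X : radial n m E),
    c = ‖blockOp (fun i j => ((F i j).1 E X : HTensor K E →L[ℂ] HTensor K E))‖}

variable {H : Type*} [NormedAddCommGroup H] [InnerProductSpace ℂ H] [CompleteSpace H]

open Classical in
/-- The value `F(X)` of a map on the radial poly-hyperball (with dummy value `0` elsewhere). -/
def valueAt (F : radial n m H → minTensor K H) (X : OpTuple n H) :
    HTensor K H →L[ℂ] HTensor K H :=
  if hX : X ∈ radial n m H then (F ⟨X, hX⟩ : HTensor K H →L[ℂ] HTensor K H) else 0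

/-- The tuple `U X U^*` on `H`, for a tuple `X` on the Fock space and a unitary `U : Fock → H`. -/
def transport (U : Fock n ≃ₗᵢ[ℂ] H) (X : OpTuple n (Fock n)) : OpTuple n H := fun i j =>
  (U : Fock n →L[ℂ] H).comp ((X i j).comp (U.symm : H →L[ℂ] Fock n))

/-- `F(r W)`, as an operator on `K ⊗ Fock`, for a map `F` given by its representation on a Hilbert
space `H` that is identified with the Fock space through the unitary `U`. -/
def valueAtModel (F : radial n m H → minTensor K H) (U : Fock n ≃ₗᵢ[ℂ] H) (r : ℝ) :
    HTensor K (Fock n) →L[ℂ] HTensor K (Fock n) :=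
  (hMap (ContinuousLinearMap.id ℂ K) (U.symm : H →L[ℂ] Fock n)).comp
    ((valueAt F (transport U ((r : ℂ) • model n m))).comp
      (hMap (ContinuousLinearMap.id ℂ K) (U : Fock n →L[ℂ] H)))

/-- `T = SOT-lim_{r → 1} F(r W)`, for every identification of `H` with the Fock space. -/
def IsRadialSOTLimit (F : radial n m H → minTensor K H)
    (T : HTensor K (Fock n) →L[ℂ] HTensor K (Fock n)) : Prop :=
  ∀ (U : Fock n ≃ₗᵢ[ℂ] H) (ξ : HTensor K (Fock n)),
    Filter.Tendsto (fun r : ℝ => valueAtModel F U r ξ) (𝓝[<] 1) (𝓝 (T ξ))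

end Pluriharmonic

end PolyHyperball

end

open PolyHyperball

/-! For `X` in the radial part every `Φ_{X_i}` has norm at most `r ^ 2 < 1`, so the negative
binomial series of `(1 - Φ_{X_1})^{-m_1} ⋯ (1 - Φ_{X_k})^{-m_k}` converge. Applied to `Δ_X^m(I)`
they return the identity (`hasSum_resolution`), which says exactly that the Berezin kernel `K_X` is
isometric. The weights of the model are those for which `(W_{i,j}^* ⊗ I) K_X = K_X X_{i,j}^*`. With
`K_X^* K_X = I` this gives `B_X[A ⊗ W_α W_β^*] = A ⊗ X_α X_β^*` (`berezin_hMap_multiOp`).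

From Toeplitz operators to functions: cut a Toeplitz operator `T` into blocks `P_a T P_b` by word
lengths. The pieces of `K_X` in these blocks are absolutely summable in norm, so `B_X[T]` is the
norm-convergent sum of the `B_X[P_a T P_b]`. On the blocks with `a - b = s`, `T` agrees with the
homogeneous polynomial `q_s(W, W^*)` built from its coefficients, and `q_s(W, W^*)` has no other
blocks. Grouping by `s` gives `B_X[T] = ∑_s q_s(X, X^*)` (`hasSum_homTerm`).

From functions to Toeplitz operators: the model lies in the poly-hyperball, so a bounded `F` may be
evaluated at `r W`. The entry of `F(r W)` at `(ω, γ)` is the Toeplitz entry given by the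
coefficients of `F`, times `∏ r^{| |ω_i| - |γ_i| |}`. A weak limit point as `r → 1` is therefore a
Toeplitz operator with the coefficients of `F` (`exists_hasCoeffs`), and by the expansion its
Berezin transform is the same series as `F` on every Hilbert space.

Limit and norms: `F(r W) (x ⊗ e_γ)` arises from `T (x ⊗ e_γ)` by a diagonal contraction that tends
strongly to the identity, so the limit is strong. The Berezin transform is completely contractive,
being an amplification followed by a compression, and the strong limit of `F(r W)` gives the reverse
inequality for matrices (`isLUB_matrixNormValues`). -/

noncomputable section

set_option linter.unusedSectionVars false

namespace PolyHyperball

/-! ### Total sets and strong convergence -/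

section Strong

variable {V W : Type*} [NormedAddCommGroup V] [NormedSpace ℂ V]
  [NormedAddCommGroup W] [NormedSpace ℂ W]

/-- A uniformly bounded family of operators converges strongly as soon as it converges on the
vectors of a total set. -/
theorem tendsto_clm_apply_of_total {ι : Type*} {l : Filter ι} {f : ι → (V →L[ℂ] W)} {C : ℝ}
    (hC : ∀ᶠ t in l, ‖f t‖ ≤ C) {f₀ : V →L[ℂ] W} {s : Set V}
    (hs : Dense (Submodule.span ℂ s : Set V))
    (h : ∀ x ∈ s, Filter.Tendsto (fun t => f t x) l (𝓝 (f₀ x))) (x : V) :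
    Filter.Tendsto (fun t => f t x) l (𝓝 (f₀ x)) := by
  have hspan : ∀ x ∈ Submodule.span ℂ s, Filter.Tendsto (fun t => f t x) l (𝓝 (f₀ x)) := by
    intro x hx
    induction hx using Submodule.span_induction with
    | mem x hx => exact h x hx
    | zero => simpa using tendsto_const_nhds
    | add x y _ _ hx hy => simpa using hx.add hy
    | smul c x _ hx => simpa using hx.const_smul c
  rw [Metric.tendsto_nhds]
  intro ε hε
  -- The error is split through a vector `y` of the span with `‖x - y‖ < ε / (2 D)`; `D` dominates
  -- `|C| + ‖f₀‖`, and the summand `1` keeps it positive.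
  set D : ℝ := |C| + ‖f₀‖ + 1 with hD
  have hDpos : 0 < D := by positivity
  obtain ⟨y, hy, hxy⟩ := Metric.dense_iff.1 hs x (ε / (2 * D)) (by positivity)
  rw [Metric.mem_ball, dist_comm, dist_eq_norm] at hy
  filter_upwards [hC, Metric.tendsto_nhds.1 (hspan y hxy) (ε / 2) (by positivity)] with t ht hty
  rw [dist_eq_norm] at hty ⊢
  have h1 : f t x - f₀ x = f t (x - y) - f₀ (x - y) + (f t y - f₀ y) := by
    simp only [map_sub]; abel
  have h2 : ‖f t (x - y)‖ ≤ |C| * ‖x - y‖ :=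
    ((f t).le_opNorm _).trans (mul_le_mul_of_nonneg_right (ht.trans (le_abs_self C))
      (norm_nonneg _))
  have h3 : ‖f₀ (x - y)‖ ≤ ‖f₀‖ * ‖x - y‖ := f₀.le_opNorm _
  have h4 : D * ‖x - y‖ < ε / 2 := by
    have := (lt_div_iff₀ (by positivity)).1 hy
    nlinarith
  have h5 : (|C| + ‖f₀‖) * ‖x - y‖ ≤ D * ‖x - y‖ :=
    mul_le_mul_of_nonneg_right (by linarith) (norm_nonneg _)
  calc ‖f t x - f₀ x‖ ≤ ‖f t (x - y)‖ + ‖f₀ (x - y)‖ + ‖f t y - f₀ y‖ := by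
        rw [h1]; exact (norm_add_le _ _).trans (add_le_add_left (norm_sub_le _ _) _)
    _ < ε := by linarith

theorem clm_ext_of_total {f g : V →L[ℂ] W} {s : Set V}
    (hs : Dense (Submodule.span ℂ s : Set V)) (h : ∀ x ∈ s, f x = g x) : f = g :=
  ContinuousLinearMap.ext_on hs h

theorem ext_inner_of_total {V : Type*} [NormedAddCommGroup V] [InnerProductSpace ℂ V] {s : Set V}
    (hs : Dense (Submodule.span ℂ s : Set V)) {z z' : V} (h : ∀ x ∈ s, ⟪x, z⟫_ℂ = ⟪x, z'⟫_ℂ) :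
    z = z' := by
  refine ext_inner_right ℂ fun w => ?_
  have h' : innerSL ℂ z = innerSL ℂ z' := clm_ext_of_total hs fun x hx => by
    rw [innerSL_apply_apply, innerSL_apply_apply, ← inner_conj_symm, h x hx, inner_conj_symm]
  exact DFunLike.congr_fun h' w

end Strong

/-! ### Elementary tensors and tensor products of operators -/

section TensorLemmas

variable {E F G E' F' G' : Type*}
  [NormedAddCommGroup E] [InnerProductSpace ℂ E]
  [NormedAddCommGroup F] [InnerProductSpace ℂ F]
  [NormedAddCommGroup G] [InnerProductSpace ℂ G]
  [NormedAddCommGroup E'] [InnerProductSpace ℂ E']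
  [NormedAddCommGroup F'] [InnerProductSpace ℂ F']
  [NormedAddCommGroup G'] [InnerProductSpace ℂ G']

theorem hTmul_add_left (x x' : E) (y : F) : hTmul (x + x') y = hTmul x y + hTmul x' y := by
  simp [hTmul, TensorProduct.add_tmul]

theorem hTmul_add_right (x : E) (y y' : F) : hTmul x (y + y') = hTmul x y + hTmul x y' := by
  simp [hTmul, TensorProduct.tmul_add]

theorem hTmul_smul_left (c : ℂ) (x : E) (y : F) : hTmul (c • x) y = c • hTmul x y := by
  simp [hTmul, ← TensorProduct.smul_tmul']

theorem hTmul_smul_right (c : ℂ) (x : E) (y : F) : hTmul x (c • y) = c • hTmul x y := by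
  simp [hTmul]

theorem norm_hTmul (x : E) (y : F) : ‖hTmul x y‖ = ‖x‖ * ‖y‖ := by
  simp [hTmul]

variable (F) in
/-- `x ↦ x ⊗ y` as a bounded operator. -/
def hTmulRight (y : F) : E →L[ℂ] HTensor E F :=
  LinearMap.mkContinuous
    { toFun := fun x => hTmul x y
      map_add' := fun x x' => hTmul_add_left x x' y
      map_smul' := fun c x => hTmul_smul_left c x y } ‖y‖
    (fun x => by simp [norm_hTmul, mul_comm])

/-- `y ↦ x ⊗ y` as a bounded operator. -/
def hTmulLeft (x : E) : F →L[ℂ] HTensor E F :=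
  LinearMap.mkContinuous
    { toFun := fun y => hTmul x y
      map_add' := fun y y' => hTmul_add_right x y y'
      map_smul' := fun c y => hTmul_smul_right c x y } ‖x‖
    (fun y => by simp [norm_hTmul])

theorem hTmulRight_apply (x : E) (y : F) : hTmulRight F y x = hTmul x y := rfl

theorem hTmulLeft_apply (x : E) (y : F) : hTmulLeft x y = hTmul x y := rfl

/-- A closed additive property of vectors of a Hilbert tensor product may be checked on elementary
tensors. -/
theorem hTensor_induction {p : HTensor E F → Prop} (hc : IsClosed {z | p z})
    (h0 : p 0) (ht : ∀ x y, p (hTmul x y)) (ha : ∀ z z', p z → p z' → p (z + z'))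
    (z : HTensor E F) : p z := by
  refine denseRange_hIncl.induction_on z hc fun z => ?_
  induction z using TensorProduct.induction_on with
  | zero => simpa using h0
  | tmul x y => exact ht x y
  | add a b ha' hb' => rw [map_add]; exact ha _ _ ha' hb'

theorem hTensor_clm_ext {f g : HTensor E F →L[ℂ] G}
    (h : ∀ x y, f (hTmul x y) = g (hTmul x y)) : f = g := by
  ext z
  refine hTensor_induction (p := fun z => f z = g z)
    (isClosed_eq f.continuous g.continuous) (by simp) h (fun z z' hz hz' => ?_) z
  rw [map_add, map_add, hz, hz']

theorem hTensor_ext_inner {z z' : HTensor E F}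
    (h : ∀ x y, ⟪hTmul x y, z⟫_ℂ = ⟪hTmul x y, z'⟫_ℂ) : z = z' := by
  refine ext_inner_left ℂ fun w => ?_
  refine hTensor_induction (p := fun w => ⟪w, z⟫_ℂ = ⟪w, z'⟫_ℂ)
    (isClosed_eq (by fun_prop) (by fun_prop)) (by simp) h (fun w w' hw hw' => ?_) w
  rw [inner_add_left, inner_add_left, hw, hw']

theorem hMap_comp (f : E' →L[ℂ] G) (f' : E →L[ℂ] E') (g : F' →L[ℂ] G') (g' : F →L[ℂ] F') :
    (hMap f g).comp (hMap f' g') = hMap (f.comp f') (g.comp g') :=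
  hTensor_clm_ext fun x y => by simp [hMap_hTmul]

theorem hMap_id : hMap (ContinuousLinearMap.id ℂ E) (ContinuousLinearMap.id ℂ F) =
    ContinuousLinearMap.id ℂ (HTensor E F) :=
  hTensor_clm_ext fun x y => by simp [hMap_hTmul]

theorem hMap_add_left' (f f' : E →L[ℂ] E') (g : F →L[ℂ] F') :
    hMap (f + f') g = hMap f g + hMap f' g :=
  hTensor_clm_ext fun x y => by simp [hMap_hTmul, hTmul_add_left]

theorem hMap_add_right (f : E →L[ℂ] E') (g g' : F →L[ℂ] F') :
    hMap f (g + g') = hMap f g + hMap f g' :=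
  hTensor_clm_ext fun x y => by simp [hMap_hTmul, hTmul_add_right]

theorem hMap_smul_left' (c : ℂ) (f : E →L[ℂ] E') (g : F →L[ℂ] F') :
    hMap (c • f) g = c • hMap f g :=
  hTensor_clm_ext fun x y => by simp [hMap_hTmul, hTmul_smul_left]

theorem hMap_smul_right (c : ℂ) (f : E →L[ℂ] E') (g : F →L[ℂ] F') :
    hMap f (c • g) = c • hMap f g :=
  hTensor_clm_ext fun x y => by simp [hMap_hTmul, hTmul_smul_right]

theorem norm_hMap_le (f : E →L[ℂ] E') (g : F →L[ℂ] F') : ‖hMap f g‖ ≤ ‖f‖ * ‖g‖ := by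
  refine ContinuousLinearMap.opNorm_le_bound _ (by positivity) fun z => ?_
  refine denseRange_hIncl.induction_on z (isClosed_le (by fun_prop) (by fun_prop)) fun z => ?_
  rw [hMap_hIncl, LinearIsometry.norm_map, LinearIsometry.norm_map]
  exact ((TensorProduct.mapL f g).le_opNorm z).trans
    (mul_le_mul_of_nonneg_right (TensorProduct.norm_mapL_le f g) (norm_nonneg _))

theorem norm_hMap_id_left_le (g : F →L[ℂ] F') :
    ‖hMap (ContinuousLinearMap.id ℂ E) g‖ ≤ ‖g‖ :=
  (norm_hMap_le _ _).trans
    (mul_le_of_le_one_left (norm_nonneg _) ContinuousLinearMap.norm_id_le)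

theorem norm_hMap_id_right_le (f : E →L[ℂ] E') :
    ‖hMap f (ContinuousLinearMap.id ℂ F)‖ ≤ ‖f‖ :=
  (norm_hMap_le _ _).trans
    (mul_le_of_le_one_right (norm_nonneg _) ContinuousLinearMap.norm_id_le)

variable (E F F') in
/-- `g ↦ I ⊗ g` as a bounded operator. -/
def hMapRightL : (F →L[ℂ] F') →L[ℂ] (HTensor E F →L[ℂ] HTensor E F') :=
  LinearMap.mkContinuous
    { toFun := fun g => hMap (ContinuousLinearMap.id ℂ E) g
      map_add' := fun g g' => hMap_add_right _ g g'
      map_smul' := fun c g => hMap_smul_right c _ g } 1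
    (fun g => by simpa using norm_hMap_id_left_le g)

variable (E F E') in
/-- `f ↦ f ⊗ I` as a bounded operator. -/
def hMapLeftL : (E →L[ℂ] E') →L[ℂ] (HTensor E F →L[ℂ] HTensor E' F) :=
  LinearMap.mkContinuous
    { toFun := fun f => hMap f (ContinuousLinearMap.id ℂ F)
      map_add' := fun f f' => hMap_add_left' f f' _
      map_smul' := fun c f => hMap_smul_left' c f _ } 1
    (fun f => by simpa using norm_hMap_id_right_le f)

theorem hMapLeftL_apply (f : E →L[ℂ] E') :
    hMapLeftL E F E' f = hMap f (ContinuousLinearMap.id ℂ F) := rfl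

theorem hMap_adjoint [CompleteSpace E] [CompleteSpace F] [CompleteSpace E'] [CompleteSpace F']
    (f : E →L[ℂ] E') (g : F →L[ℂ] F') :
    ContinuousLinearMap.adjoint (hMap f g) =
      hMap (ContinuousLinearMap.adjoint f) (ContinuousLinearMap.adjoint g) := by
  refine hTensor_clm_ext fun x y => hTensor_ext_inner fun x' y' => ?_
  rw [ContinuousLinearMap.adjoint_inner_right, hMap_hTmul, hMap_hTmul, hTensor_inner,
    hTensor_inner, ContinuousLinearMap.adjoint_inner_right,
    ContinuousLinearMap.adjoint_inner_right]

/-- The elementary tensors `x ⊗ y`, with `y` in a total set, are total. -/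
theorem dense_span_hTmul {s : Set F} (hs : Dense (Submodule.span ℂ s : Set F)) :
    Dense (Submodule.span ℂ {z | ∃ (x : E) (y : F), y ∈ s ∧ z = hTmul x y} :
      Set (HTensor E F)) := by
  set S := Submodule.span ℂ {z | ∃ (x : E) (y : F), y ∈ s ∧ z = hTmul x y} with hS
  intro z
  rw [← Submodule.topologicalClosure_coe]
  refine hTensor_induction (p := fun z => z ∈ (S.topologicalClosure : Set (HTensor E F)))
    (Submodule.isClosed_topologicalClosure _) (Submodule.zero_mem _) (fun x y => ?_)
    (fun a b ha hb => Submodule.add_mem _ ha hb) z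
  have hy : y ∈ closure (Submodule.span ℂ s : Set F) := hs y
  rw [Submodule.topologicalClosure_coe, ← hTmulLeft_apply]
  refine map_mem_closure (hTmulLeft (F := F) x).continuous hy fun w hw => ?_
  change hTmulLeft x w ∈ S
  rw [SetLike.mem_coe] at hw
  induction hw using Submodule.span_induction with
  | mem w hw => exact Submodule.subset_span ⟨x, w, hw, rfl⟩
  | zero => simp
  | add a b ha' hb' ha hb => rw [map_add]; exact S.add_mem ha hb
  | smul c a ha' ha => rw [map_smul]; exact S.smul_mem _ ha

/-- Strong convergence of a bounded family `g_t → g` implies strong convergence of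
`I ⊗ g_t → I ⊗ g`. -/
theorem tendsto_hMap_id_apply {ι : Type*} {l : Filter ι} {g : ι → (F →L[ℂ] F')} {C : ℝ}
    (hC : ∀ᶠ t in l, ‖g t‖ ≤ C) {g₀ : F →L[ℂ] F'}
    (h : ∀ y, Filter.Tendsto (fun t => g t y) l (𝓝 (g₀ y))) (z : HTensor E F) :
    Filter.Tendsto (fun t => hMap (ContinuousLinearMap.id ℂ E) (g t) z) l
      (𝓝 (hMap (ContinuousLinearMap.id ℂ E) g₀ z)) := by
  have hs : Dense (Submodule.span ℂ (Set.univ : Set F) : Set F) := by simp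
  refine tendsto_clm_apply_of_total (hC.mono fun t ht => (norm_hMap_id_left_le (g t)).trans ht)
    (dense_span_hTmul hs) ?_ z
  rintro _ ⟨x, y, -, rfl⟩
  simp only [hMap_hTmul, ContinuousLinearMap.id_apply]
  exact ((hTmulLeft x).continuous.tendsto _).comp (h y)

theorem hAssoc_hMap (a : E →L[ℂ] E) (b : F →L[ℂ] F) (c : G →L[ℂ] G)
    (z : HTensor E (HTensor F G)) :
    hAssoc E F G (hMap a (hMap b c) z) = hMap (hMap a b) c (hAssoc E F G z) := by
  have h : (hAssoc E F G : HTensor E (HTensor F G) →L[ℂ] HTensor (HTensor E F) G).comp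
      (hMap a (hMap b c)) = (hMap (hMap a b) c).comp
      (hAssoc E F G : HTensor E (HTensor F G) →L[ℂ] HTensor (HTensor E F) G) := by
    refine hTensor_clm_ext fun x w => ?_
    have h' : ((hAssoc E F G : HTensor E (HTensor F G) →L[ℂ] HTensor (HTensor E F) G).comp
        (hMap a (hMap b c))).comp (hTmulLeft x) = ((hMap (hMap a b) c).comp
        (hAssoc E F G : HTensor E (HTensor F G) →L[ℂ] HTensor (HTensor E F) G)).comp
        (hTmulLeft x) := by
      refine hTensor_clm_ext fun y z => ?_
      simp [hTmulLeft_apply, hMap_hTmul, hAssoc_hTmul]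
    exact DFunLike.congr_fun h' w
  exact DFunLike.congr_fun h z

/-! ### Matrices of operators -/

theorem blockOp_apply {q : ℕ} (M : Matrix (Fin q) (Fin q) (E →L[ℂ] E))
    (ξ : PiLp 2 (fun _ : Fin q => E)) (i : Fin q) : blockOp M ξ i = ∑ j, M i j (ξ j) := by
  simp [blockOp]

/-- The `i`-th inclusion in the `q`-fold direct sum. -/
def blockIncl (E : Type*) [NormedAddCommGroup E] [InnerProductSpace ℂ E] {q : ℕ} (i : Fin q) :
    E →L[ℂ] PiLp 2 (fun _ : Fin q => E) :=
  ((PiLp.continuousLinearEquiv 2 ℂ (fun _ : Fin q => E)).symm :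
      (Fin q → E) →L[ℂ] PiLp 2 (fun _ : Fin q => E)).comp
    (ContinuousLinearMap.single ℂ (fun _ : Fin q => E) i)

theorem blockIncl_apply {q : ℕ} (i j : Fin q) (x : E) :
    blockIncl E i x j = if j = i then x else 0 := by
  by_cases h : j = i
  · subst h; simp [blockIncl]
  · simp [blockIncl, h]

theorem inner_blockIncl {q : ℕ} (i j : Fin q) (x y : E) :
    ⟪blockIncl E i x, blockIncl E j y⟫_ℂ = if i = j then ⟪x, y⟫_ℂ else 0 := by
  rw [PiLp.inner_apply, Finset.sum_eq_single i]
  · by_cases h : i = j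
    · subst h; simp [blockIncl_apply]
    · simp [blockIncl_apply, h]
  · intro l _ hl; simp [blockIncl_apply, hl]
  · simp

theorem inner_hMap_blockIncl {q : ℕ} (i j : Fin q) (z z' : HTensor E F) :
    ⟪hMap (blockIncl E i) (ContinuousLinearMap.id ℂ F) z,
      hMap (blockIncl E j) (ContinuousLinearMap.id ℂ F) z'⟫_ℂ = if i = j then ⟪z, z'⟫_ℂ else 0 := by
  refine hTensor_induction (p := fun z => ⟪hMap (blockIncl E i) (ContinuousLinearMap.id ℂ F) z,
      hMap (blockIncl E j) (ContinuousLinearMap.id ℂ F) z'⟫_ℂ = if i = j then ⟪z, z'⟫_ℂ else 0)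
      (isClosed_eq (by fun_prop) (by split_ifs <;> fun_prop)) (by simp) (fun x y => ?_)
      (fun a b ha hb => ?_) z
  · refine hTensor_induction (p := fun z' => ⟪hMap (blockIncl E i)
      (ContinuousLinearMap.id ℂ F) (hTmul x y),
      hMap (blockIncl E j) (ContinuousLinearMap.id ℂ F) z'⟫_ℂ =
        if i = j then ⟪hTmul x y, z'⟫_ℂ else 0)
      (isClosed_eq (by fun_prop) (by split_ifs <;> fun_prop)) (by simp) (fun x' y' => ?_)
      (fun a b ha hb => ?_) z'
    · rw [hMap_hTmul, hMap_hTmul, hTensor_inner, hTensor_inner, inner_blockIncl]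
      split_ifs <;> simp
    · rw [map_add, inner_add_right, ha, hb]
      split_ifs <;> simp
  · rw [map_add, inner_add_left, ha, hb]
    split_ifs <;> simp

variable (E F) in
/-- The canonical isometry `(E ⊗ F)^q → E^q ⊗ F`, on vectors. -/
def gather {q : ℕ} (ξ : PiLp 2 (fun _ : Fin q => HTensor E F)) :
    HTensor (PiLp 2 (fun _ : Fin q => E)) F :=
  ∑ j, hMap (blockIncl E j) (ContinuousLinearMap.id ℂ F) (ξ j)

theorem norm_gather {q : ℕ} (ξ : PiLp 2 (fun _ : Fin q => HTensor E F)) :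
    ‖gather E F ξ‖ = ‖ξ‖ := by
  have h : ⟪gather E F ξ, gather E F ξ⟫_ℂ = ⟪ξ, ξ⟫_ℂ := by
    simp only [gather, sum_inner, inner_sum, inner_hMap_blockIncl, PiLp.inner_apply]
    simp
  rw [@norm_eq_sqrt_re_inner ℂ, @norm_eq_sqrt_re_inner ℂ, h]

/-- The isometry `gather` intertwines the matrix with entries `M_{ij} ⊗ I` and the single operator
`[M_{ij}] ⊗ I`; it suffices to check this on each column `j`. -/
theorem gather_blockOp {q : ℕ} (M : Matrix (Fin q) (Fin q) (E →L[ℂ] E))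
    (ξ : PiLp 2 (fun _ : Fin q => HTensor E F)) :
    gather E F (blockOp (fun i j => hMap (M i j) (ContinuousLinearMap.id ℂ F)) ξ) =
      hMap (blockOp M) (ContinuousLinearMap.id ℂ F) (gather E F ξ) := by
  have key : ∀ j (z : HTensor E F),
      hMap (blockOp M) (ContinuousLinearMap.id ℂ F)
        (hMap (blockIncl E j) (ContinuousLinearMap.id ℂ F) z) =
      ∑ i, hMap (blockIncl E i) (ContinuousLinearMap.id ℂ F)
        (hMap (M i j) (ContinuousLinearMap.id ℂ F) z) := by
    intro j z
    have h1 : (blockOp M).comp (blockIncl E j) = ∑ i, (blockIncl E i).comp (M i j) := by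
      ext x l
      simp [blockOp_apply, blockIncl_apply, apply_ite]
    have h2 := DFunLike.congr_fun (hMap_comp (blockOp M) (blockIncl E j)
      (ContinuousLinearMap.id ℂ F) (ContinuousLinearMap.id ℂ F)) z
    rw [ContinuousLinearMap.comp_apply] at h2
    rw [h2, h1, ContinuousLinearMap.id_comp, ← hMapLeftL_apply, map_sum,
      sum_apply]
    refine Finset.sum_congr rfl fun i _ => ?_
    rw [hMapLeftL_apply, ← ContinuousLinearMap.comp_apply, hMap_comp, ContinuousLinearMap.id_comp]
  have h3 : ∀ i, blockOp (fun i j => hMap (M i j) (ContinuousLinearMap.id ℂ F)) ξ i =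
      ∑ j, hMap (M i j) (ContinuousLinearMap.id ℂ F) (ξ j) := fun i =>
    blockOp_apply (fun i j => hMap (M i j) (ContinuousLinearMap.id ℂ F)) ξ i
  simp only [gather, h3, map_sum, key]
  rw [Finset.sum_comm]

/-- Through `gather` the matrix on the left is a restriction of `[M_{ij}] ⊗ I`, and amplification by
the identity does not increase norms. This is why `g ↦ g ⊗ I` is completely contractive. -/
theorem norm_blockOp_hMap_le {q : ℕ} (M : Matrix (Fin q) (Fin q) (E →L[ℂ] E)) :
    ‖blockOp (fun i j => hMap (M i j) (ContinuousLinearMap.id ℂ F))‖ ≤ ‖blockOp M‖ := by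
  refine ContinuousLinearMap.opNorm_le_bound _ (ContinuousLinearMap.opNorm_nonneg _) fun ξ => ?_
  rw [← norm_gather, gather_blockOp, ← norm_gather ξ]
  exact (ContinuousLinearMap.le_opNorm _ _).trans
    (mul_le_mul_of_nonneg_right (norm_hMap_id_right_le _) (norm_nonneg _))

/-- Compressing every entry of an operator matrix by contractions does not increase its norm. -/
theorem norm_blockOp_conj_le {q : ℕ} (M : Matrix (Fin q) (Fin q) (E →L[ℂ] E))
    (R : E →L[ℂ] F) (V : F →L[ℂ] E) (hR : ‖R‖ ≤ 1) (hV : ‖V‖ ≤ 1) :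
    ‖blockOp (fun i j => R.comp ((M i j).comp V))‖ ≤ ‖blockOp M‖ := by
  refine ContinuousLinearMap.opNorm_le_bound _ (ContinuousLinearMap.opNorm_nonneg _) fun ξ => ?_
  set η : PiLp 2 (fun _ : Fin q => E) := WithLp.toLp 2 fun j => V (ξ j) with hη
  have h1 : ‖blockOp (fun i j => R.comp ((M i j).comp V)) ξ‖ ≤ ‖blockOp M η‖ := by
    rw [PiLp.norm_eq_of_L2, PiLp.norm_eq_of_L2]
    refine Real.sqrt_le_sqrt (Finset.sum_le_sum fun i _ => ?_)
    refine pow_le_pow_left₀ (norm_nonneg _) ?_ 2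
    have : blockOp (fun i j => R.comp ((M i j).comp V)) ξ i = R (blockOp M η i) := by
      refine (blockOp_apply (fun i j => R.comp ((M i j).comp V)) ξ i).trans ?_
      simp [blockOp_apply, hη]
    rw [this]
    exact (R.le_opNorm _).trans (mul_le_of_le_one_left (norm_nonneg _) hR)
  have h2 : ‖η‖ ≤ ‖ξ‖ := by
    rw [PiLp.norm_eq_of_L2, PiLp.norm_eq_of_L2]
    refine Real.sqrt_le_sqrt (Finset.sum_le_sum fun i _ => ?_)
    exact pow_le_pow_left₀ (norm_nonneg _)
      ((V.le_opNorm _).trans (mul_le_of_le_one_left (norm_nonneg _) hV)) 2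
  exact h1.trans (((blockOp M).le_opNorm η).trans
    (mul_le_mul_of_nonneg_left h2 (norm_nonneg _)))

end TensorLemmas

/-! ### Noncommutative products over `Fin k` -/

section Products

theorem prod_ofFn_succ {M : Type*} [Monoid M] {k : ℕ} (f : Fin (k + 1) → M) :
    (List.ofFn f).prod = f 0 * (List.ofFn fun i : Fin k => f i.succ).prod := by
  rw [List.ofFn_succ, List.prod_cons]

theorem commute_prod_ofFn {M : Type*} [Monoid M] {k : ℕ} {f : Fin k → M} {y : M}
    (h : ∀ i, Commute (f i) y) : Commute (List.ofFn f).prod y := by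
  refine Commute.list_prod_left _ _ fun x hx => ?_
  obtain ⟨i, rfl⟩ := List.mem_ofFn.1 hx
  exact h i

/-- Only factors with different indices have to be exchanged, so `f i` and `g i` need not commute.
This matters for words in the noncommuting operators `X_{i,1}, …, X_{i,n_i}`. -/
theorem prod_ofFn_mul {M : Type*} [Monoid M] {k : ℕ} {f g : Fin k → M}
    (h : ∀ i j, i ≠ j → Commute (f i) (g j)) :
    (List.ofFn f).prod * (List.ofFn g).prod = (List.ofFn fun i => f i * g i).prod := by
  induction k with
  | zero => simp
  | succ k ih =>
    have hc : Commute (List.ofFn fun i : Fin k => f i.succ).prod (g 0) :=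
      commute_prod_ofFn fun i => h _ _ (Fin.succ_ne_zero i)
    rw [prod_ofFn_succ f, prod_ofFn_succ g, prod_ofFn_succ fun i => f i * g i,
      ← ih fun i j hij => h _ _ fun e => hij (Fin.succ_injective _ e)]
    simp only [mul_assoc]
    rw [← mul_assoc (List.prod _) (g 0), hc.eq, mul_assoc]

theorem prod_ofFn_one {M : Type*} [Monoid M] {k : ℕ} :
    (List.ofFn fun _ : Fin k => (1 : M)).prod = 1 := by
  induction k with
  | zero => simp
  | succ k ih => rw [prod_ofFn_succ, ih, one_mul]

/-- Serves to read one factor as a full ordered product: it specialises `Δ_X^p` to `id - Φ_{X_i}`,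
and it lets `X_{i,j}` be merged into `multiOp`. -/
theorem prod_ofFn_pow_single {M : Type*} [Monoid M] {k : ℕ} (f : Fin k → M) (i : Fin k) :
    (List.ofFn fun l => f l ^ (Pi.single i 1 : Fin k → ℕ) l).prod = f i := by
  induction k with
  | zero => exact i.elim0
  | succ k ih =>
    rw [prod_ofFn_succ]
    refine Fin.cases ?_ (fun i => ?_) i
    · have h : (fun l : Fin k => f l.succ ^ (Pi.single 0 1 : Fin (k + 1) → ℕ) l.succ) =
          fun _ => 1 := by
        funext l; simp [Fin.succ_ne_zero]
      rw [h, prod_ofFn_one]; simp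
    · have h : (fun l : Fin k => f l.succ ^ (Pi.single i.succ 1 : Fin (k + 1) → ℕ) l.succ) =
          fun l => (fun l : Fin k => f l.succ) l ^ (Pi.single i 1 : Fin k → ℕ) l := by
        funext l
        by_cases hl : l = i
        · subst hl; simp
        · simp [hl]
      rw [h, ih (fun l : Fin k => f l.succ) i]
      simp [(Fin.succ_ne_zero i).symm]

/-- The adjoint reverses the order of the factors; their commutation restores it. -/
theorem star_prod_ofFn {M : Type*} [Monoid M] [StarMul M] {k : ℕ} {f : Fin k → M}
    (h : ∀ i j, i ≠ j → Commute (f i) (f j)) :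
    star (List.ofFn f).prod = (List.ofFn fun i => star (f i)).prod := by
  induction k with
  | zero => simp
  | succ k ih =>
    have hc : Commute (List.ofFn fun i : Fin k => f i.succ).prod (f 0) :=
      commute_prod_ofFn fun i => h _ _ (Fin.succ_ne_zero i)
    rw [prod_ofFn_succ f, prod_ofFn_succ fun i => star (f i), ← hc.eq, star_mul,
      ih fun i j hij => h _ _ fun e => hij (Fin.succ_injective _ e)]

theorem prod_ofFn_smul {S R : Type*} [CommMonoid S] [Monoid R] [MulAction S R]
    [IsScalarTower S R R] [SMulCommClass S R R] {k : ℕ} (c : Fin k → S) (f : Fin k → R) :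
    (List.ofFn fun i => c i • f i).prod = (∏ i, c i) • (List.ofFn f).prod := by
  induction k with
  | zero => simp
  | succ k ih =>
    rw [prod_ofFn_succ, prod_ofFn_succ f, ih, Fin.prod_univ_succ, smul_mul_smul_comm]

theorem prod_ofFn_sum {R : Type*} [Semiring R] {k : ℕ} {ι : Fin k → Type*}
    [∀ i, Fintype (ι i)] (c : ∀ i, ι i → R) :
    (List.ofFn fun i => ∑ t, c i t).prod =
      ∑ t : ∀ i, ι i, (List.ofFn fun i => c i (t i)).prod := by
  induction k with
  | zero => simp
  | succ k ih =>
    rw [prod_ofFn_succ, ih (fun i : Fin k => c i.succ), Finset.sum_mul_sum,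
      ← (Fin.consEquiv ι).sum_comp, Fintype.sum_prod_type]
    refine Finset.sum_congr rfl fun a _ => Finset.sum_congr rfl fun t _ => ?_
    rw [prod_ofFn_succ]
    rfl

/-- Iterated Cauchy product. Absolute summability is carried through the induction because the
product of two series needs it at every step. -/
theorem hasSum_prod_ofFn {R : Type*} [NormedRing R] [CompleteSpace R] {k : ℕ}
    {c : Fin k → ℕ → R} {S : Fin k → R} (hc : ∀ i, Summable fun l => ‖c i l‖)
    (hS : ∀ i, HasSum (c i) (S i)) :
    (Summable fun a : Fin k → ℕ => ‖(List.ofFn fun i => c i (a i)).prod‖) ∧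
      HasSum (fun a : Fin k → ℕ => (List.ofFn fun i => c i (a i)).prod) (List.ofFn S).prod := by
  induction k with
  | zero =>
    refine ⟨(hasSum_unique _).summable, ?_⟩
    exact hasSum_unique fun a : Fin 0 → ℕ => (List.ofFn fun i => c i (a i)).prod
  | succ k ih =>
    obtain ⟨h1, h2⟩ := ih (fun i => hc i.succ) (fun i => hS i.succ)
    have hfun : (fun a : Fin (k + 1) → ℕ => (List.ofFn fun i => c i (a i)).prod) ∘
        Fin.consEquiv (fun _ : Fin (k + 1) => ℕ) =
        fun x : ℕ × (Fin k → ℕ) => c 0 x.1 * (List.ofFn fun i => c i.succ (x.2 i)).prod := by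
      funext x
      rw [Function.comp_apply, prod_ofFn_succ]
      rfl
    have hn := (hc 0).mul_norm h1
    refine ⟨?_, ?_⟩
    · rw [← (Fin.consEquiv fun _ : Fin (k + 1) => ℕ).summable_iff]
      refine hn.congr fun x => ?_
      exact congrArg norm (congrFun hfun x).symm
    · have h3 : HasSum (fun x : ℕ × (Fin k → ℕ) =>
          c 0 x.1 * (List.ofFn fun i => c i.succ (x.2 i)).prod) (List.ofFn S).prod := by
        have h4 := HasSum.mul (f := c 0)
          (g := fun b : Fin k → ℕ => (List.ofFn fun i => c i.succ (b i)).prod) (hS 0) h2 hn.of_norm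
        rwa [← prod_ofFn_succ S] at h4
      rw [← hfun] at h3
      exact (Equiv.hasSum_iff _).1 h3

theorem map_prod_ofFn {M N F : Type*} [Monoid M] [Monoid N] [FunLike F M N] [MonoidHomClass F M N]
    (φ : F) {k : ℕ} (f : Fin k → M) :
    φ (List.ofFn f).prod = (List.ofFn fun i => φ (f i)).prod := by
  rw [map_list_prod, List.map_ofFn]
  rfl

end Products

/-! ### The completely positive maps `Φ_{X_i}` -/

section CPMaps

variable {k : ℕ} {n : Fin k → ℕ}
variable {E : Type*} [NormedAddCommGroup E] [InnerProductSpace ℂ E] [CompleteSpace E]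

/-- `Y ↦ c Y c^*`, multiplicatively in `c`. -/
def conjEnd : (E →L[ℂ] E) →* Module.End ℂ (E →L[ℂ] E) where
  toFun c :=
    { toFun := fun Y => c * Y * star c
      map_add' := fun Y Z => by simp [mul_add, add_mul]
      map_smul' := fun t Y => by simp }
  map_one' := by ext1 Y; simp
  map_mul' a b := by ext1 Y; simp [mul_assoc]

theorem conjEnd_apply (c Y : E →L[ℂ] E) : conjEnd c Y = c * Y * star c := rfl

theorem cpMap_eq_sum (X : OpTuple n E) (i : Fin k) : cpMap X i = ∑ j, conjEnd (X i j) := by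
  ext1 Y
  simp [cpMap, conjEnd_apply]

theorem cpMap_apply (X : OpTuple n E) (i : Fin k) (Y : E →L[ℂ] E) :
    cpMap X i Y = ∑ j, X i j * Y * star (X i j) := rfl

/-- The words of length `l + 1` are the words `g_j β` with `β` of length `l`. -/
def vectorConsEquiv (α : Type*) (l : ℕ) : α × List.Vector α l ≃ List.Vector α (l + 1) where
  toFun p := p.1 ::ᵥ p.2
  invFun v := (v.head, v.tail)
  left_inv p := by simp
  right_inv v := by simp

/-- `Φ_{X_i}` is a sum of the maps `conjEnd (X i j)` and `conjEnd` is multiplicative, so expanding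
the power produces one term for each word of length `l`. -/
theorem cpMap_pow_eq_sum (X : OpTuple n E) (i : Fin k) (l : ℕ) :
    cpMap X i ^ l = ∑ β : List.Vector (Fin (n i)) l, conjEnd (wordOp (X i) β.toList) := by
  induction l with
  | zero =>
    rw [pow_zero, Fintype.sum_eq_single (List.Vector.nil : List.Vector (Fin (n i)) 0)
      fun β hβ => absurd (Subsingleton.elim _ _) hβ]
    simp [wordOp]
  | succ l ih =>
    rw [pow_succ', ih, cpMap_eq_sum, Finset.sum_mul_sum,
      ← (vectorConsEquiv (Fin (n i)) l).sum_comp, Fintype.sum_prod_type]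
    refine Finset.sum_congr rfl fun j _ => Finset.sum_congr rfl fun β _ => ?_
    rw [← map_mul]
    congr 1

theorem prod_cpMap_pow (X : OpTuple n E) (a : Fin k → ℕ) :
    (List.ofFn fun i => cpMap X i ^ a i).prod =
      ∑ β : ∀ i, List.Vector (Fin (n i)) (a i), conjEnd (multiOp X fun i => (β i).toList) := by
  simp only [cpMap_pow_eq_sum]
  rw [prod_ofFn_sum]
  refine Finset.sum_congr rfl fun β _ => ?_
  rw [multiOp, map_prod_ofFn]

theorem conjEnd_commute {a b : E →L[ℂ] E} (h : Commute a b) : Commute (conjEnd a) (conjEnd b) :=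
  h.map conjEnd

theorem cpMap_commute {X : OpTuple n E} (h : ∀ p q, p ≠ q → ∀ i j, Commute (X p i) (X q j))
    {p q : Fin k} (hpq : p ≠ q) : Commute (cpMap X p) (cpMap X q) := by
  rw [cpMap_eq_sum, cpMap_eq_sum]
  exact Commute.sum_left _ _ _ fun i _ => Commute.sum_right _ _ _ fun j _ =>
    conjEnd_commute (h p q hpq i j)

theorem wordOp_commute {d : ℕ} {x : Fin d → (E →L[ℂ] E)} {y : E →L[ℂ] E}
    (h : ∀ j, Commute (x j) y) (α : List (Fin d)) : Commute (wordOp x α) y := by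
  refine Commute.list_prod_left _ _ fun z hz => ?_
  obtain ⟨j, -, rfl⟩ := List.mem_map.1 hz
  exact h j

theorem wordOp_commute_wordOp {X : OpTuple n E}
    (h : ∀ p q, p ≠ q → ∀ i j, Commute (X p i) (X q j)) {p q : Fin k} (hpq : p ≠ q)
    (α : List (Fin (n p))) (β : List (Fin (n q))) :
    Commute (wordOp (X p) α) (wordOp (X q) β) :=
  wordOp_commute (fun i => (wordOp_commute (fun j => (h p q hpq i j).symm) β).symm) α

theorem multiOpStar_eq_star {X : OpTuple n E}
    (h : ∀ p q, p ≠ q → ∀ i j, Commute (X p i) (X q j)) (β : Words n) :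
    multiOpStar X β = star (multiOp X β) := by
  rw [multiOp, star_prod_ofFn fun p q hpq => wordOp_commute_wordOp h hpq _ _, multiOpStar]

/-- `Φ_{X_i}` as a bounded operator on `B(E)`. -/
def cpMapL (X : OpTuple n E) (i : Fin k) : (E →L[ℂ] E) →L[ℂ] (E →L[ℂ] E) :=
  ⟨cpMap X i, by
    change Continuous fun Y => ∑ j, X i j * Y * star (X i j)
    fun_prop⟩

theorem cpMapL_apply (X : OpTuple n E) (i : Fin k) (Y : E →L[ℂ] E) :
    cpMapL X i Y = cpMap X i Y := rfl

theorem toLinearMapRingHom_cpMapL (X : OpTuple n E) (i : Fin k) :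
    ContinuousLinearMap.toLinearMapRingHom (cpMapL X i) = cpMap X i := rfl

theorem prod_cpMapL_pow_apply (X : OpTuple n E) (a : Fin k → ℕ) (Y : E →L[ℂ] E) :
    (List.ofFn fun i => cpMapL X i ^ a i).prod Y = (List.ofFn fun i => cpMap X i ^ a i).prod Y := by
  have h := map_prod_ofFn (ContinuousLinearMap.toLinearMapRingHom
    (R₁ := ℂ) (M₁ := E →L[ℂ] E)) fun i => cpMapL X i ^ a i
  simp only [map_pow, toLinearMapRingHom_cpMapL] at h
  rw [← h]; rfl

theorem prod_one_sub_cpMapL_pow_apply (X : OpTuple n E) (p : Fin k → ℕ) (Y : E →L[ℂ] E) :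
    (List.ofFn fun i => (1 - cpMapL X i) ^ p i).prod Y = defectMap X p Y := by
  have h := map_prod_ofFn (ContinuousLinearMap.toLinearMapRingHom
    (R₁ := ℂ) (M₁ := E →L[ℂ] E)) fun i => (1 - cpMapL X i) ^ p i
  simp only [map_pow, map_sub, map_one, toLinearMapRingHom_cpMapL] at h
  rw [defectMap, ← h]; rfl

theorem cpMapL_commute {X : OpTuple n E} (h : ∀ p q, p ≠ q → ∀ i j, Commute (X p i) (X q j))
    {p q : Fin k} (hpq : p ≠ q) : Commute (cpMapL X p) (cpMapL X q) := by
  ext1 Y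
  exact DFunLike.congr_fun (cpMap_commute h hpq).eq Y

/-- The hypothesis bounds the row `(X_{i,1}, X_{i,2}, …)` in norm by `√c`, and `Φ_{X_i}(Y)` is the
row times `diag(Y, …, Y)` times its adjoint. The estimate is Cauchy–Schwarz applied to `⟪z,
Φ_{X_i}(Y) x⟫` with `z = Φ_{X_i}(Y) x`. -/
theorem norm_cpMapL_le {X : OpTuple n E} {i : Fin k} {c : ℝ} (hc : 0 ≤ c)
    (h : ∀ x, ∑ j, ‖star (X i j) x‖ ^ 2 ≤ c * ‖x‖ ^ 2) : ‖cpMapL X i‖ ≤ c := by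
  refine ContinuousLinearMap.opNorm_le_bound _ hc fun Y => ?_
  refine ContinuousLinearMap.opNorm_le_bound _ (by positivity) fun x => ?_
  by_cases hz : cpMapL X i Y x = 0
  · rw [hz, norm_zero]; positivity
  have hzp : 0 < ‖cpMapL X i Y x‖ := norm_pos_iff.2 hz
  set z := cpMapL X i Y x with hzdef
  have h1 : ⟪z, z⟫_ℂ = ∑ j, ⟪star (X i j) z, Y (star (X i j) x)⟫_ℂ := by
    have h0 : z = ∑ j, (X i j * Y * star (X i j)) x := by
      rw [hzdef, cpMapL_apply, cpMap_apply, sum_apply]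
    -- `h0` expands both arguments; once the second is split by `inner_sum`, the first is folded
    -- back.
    conv_lhs => rw [h0, inner_sum, ← h0]
    refine Finset.sum_congr rfl fun j _ => ?_
    rw [mul_apply_eq_comp, mul_apply_eq_comp,
      ContinuousLinearMap.star_eq_adjoint, ContinuousLinearMap.adjoint_inner_left]
  have h2 : ‖z‖ ^ 2 ≤ ‖Y‖ * ∑ j, ‖star (X i j) z‖ * ‖star (X i j) x‖ := by
    have h3 : ‖z‖ ^ 2 = ‖⟪z, z⟫_ℂ‖ := by
      rw [inner_self_eq_norm_sq_to_K]; simp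
    rw [h3, h1, Finset.mul_sum]
    refine (norm_sum_le _ _).trans (Finset.sum_le_sum fun j _ => ?_)
    refine (norm_inner_le_norm _ _).trans ?_
    calc ‖star (X i j) z‖ * ‖Y (star (X i j) x)‖
        ≤ ‖star (X i j) z‖ * (‖Y‖ * ‖star (X i j) x‖) :=
          mul_le_mul_of_nonneg_left (Y.le_opNorm _) (norm_nonneg _)
      _ = _ := by ring
  have h4 : ∑ j, ‖star (X i j) z‖ * ‖star (X i j) x‖ ≤ c * (‖z‖ * ‖x‖) := by
    refine (Real.sum_mul_le_sqrt_mul_sqrt _ _ _).trans ?_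
    calc √(∑ j, ‖star (X i j) z‖ ^ 2) * √(∑ j, ‖star (X i j) x‖ ^ 2)
        ≤ √(c * ‖z‖ ^ 2) * √(c * ‖x‖ ^ 2) :=
          mul_le_mul (Real.sqrt_le_sqrt (h z)) (Real.sqrt_le_sqrt (h x)) (Real.sqrt_nonneg _)
            (Real.sqrt_nonneg _)
      _ = c * (‖z‖ * ‖x‖) := by
        rw [Real.sqrt_mul hc, Real.sqrt_mul hc, Real.sqrt_sq (norm_nonneg _),
          Real.sqrt_sq (norm_nonneg _)]
        calc √c * ‖z‖ * (√c * ‖x‖) = (√c * √c) * (‖z‖ * ‖x‖) := by ring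
          _ = _ := by rw [Real.mul_self_sqrt hc]
  have h5 : ‖z‖ * ‖z‖ ≤ (c * ‖Y‖ * ‖x‖) * ‖z‖ := by
    have := mul_le_mul_of_nonneg_left h4 (norm_nonneg Y)
    nlinarith
  exact le_of_mul_le_mul_right h5 hzp

end CPMaps

/-! ### The radial part of the poly-hyperball -/

section Radial

variable {k : ℕ} {n m : Fin k → ℕ}
variable {E : Type*} [NormedAddCommGroup E] [InnerProductSpace ℂ E] [CompleteSpace E]

theorem cpMap_smul (c : ℂ) (X : OpTuple n E) (i : Fin k) :
    cpMap (c • X) i = (c * star c) • cpMap X i := by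
  ext1 Y
  simp only [cpMap_apply, LinearMap.smul_apply, Finset.smul_sum, Pi.smul_apply, star_smul]
  refine Finset.sum_congr rfl fun j _ => ?_
  rw [smul_mul_assoc, smul_mul_smul_comm]

theorem add_smul_pow_eq_sum {R : Type*} [Ring R] [Algebra ℂ R] (t : ℝ) (δ : R) (p : ℕ) :
    (((1 - t : ℝ) : ℂ) • (1 : R) + (t : ℂ) • δ) ^ p =
      ∑ q : Fin (p + 1), ((t ^ (q : ℕ) * (1 - t) ^ (p - q) * p.choose q : ℝ) : ℂ) •
        δ ^ (q : ℕ) := by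
  have hc : Commute ((t : ℂ) • δ) (((1 - t : ℝ) : ℂ) • (1 : R)) :=
    ((Commute.one_right δ).smul_right _).smul_left _
  rw [add_comm, hc.add_pow, Finset.sum_range]
  refine Finset.sum_congr rfl fun q _ => ?_
  rw [smul_pow, smul_pow, one_pow, smul_mul_smul_comm, mul_one, ← nsmul_eq_mul', ← Nat.cast_smul_eq_nsmul ℂ,
    smul_smul]
  push_cast
  congr 1
  ring

/-- The poly-hyperball is star-shaped. -/
theorem isPositive_defectMap_smul {Y : OpTuple n E}
    (hY : ∀ p : Fin k → ℕ, p ≤ m → (defectMap Y p 1).IsPositive) {r : ℝ} (h0 : 0 ≤ r) (h1 : r ≤ 1)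
    {p : Fin k → ℕ} (hp : p ≤ m) : (defectMap ((r : ℂ) • Y) p 1).IsPositive := by
  -- With `t = r ^ 2`, `id - Φ_{rY} = (1 - t) id + t (id - Φ_Y)` is a convex combination. Hence
  -- `Δ_{rY}^p` expands into the `Δ_Y^q`, `q ≤ p`, with nonnegative coefficients.
  have h : ∀ i, (1 : Module.End ℂ (E →L[ℂ] E)) - cpMap ((r : ℂ) • Y) i =
      ((1 - r ^ 2 : ℝ) : ℂ) • 1 + ((r ^ 2 : ℝ) : ℂ) • (1 - cpMap Y i) := by
    intro i
    have hr : (r : ℂ) * star (r : ℂ) = ((r ^ 2 : ℝ) : ℂ) := by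
      rw [Complex.star_def, Complex.conj_ofReal]; push_cast; ring
    rw [cpMap_smul, hr]
    push_cast
    module
  rw [defectMap]
  simp only [h, add_smul_pow_eq_sum]
  rw [prod_ofFn_sum, LinearMap.sum_apply, ← ContinuousLinearMap.nonneg_iff_isPositive]
  refine Finset.sum_nonneg fun q _ => ?_
  rw [prod_ofFn_smul, LinearMap.smul_apply, ContinuousLinearMap.nonneg_iff_isPositive]
  refine ContinuousLinearMap.IsPositive.smul_of_nonneg (hY (fun i => (q i : ℕ)) fun i => ?_) ?_
  · exact (Nat.lt_succ_iff.1 (q i).2).trans (hp i)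
  · rw [← Complex.ofReal_prod]
    refine Complex.zero_le_real.2 (Finset.prod_nonneg fun i _ => ?_)
    have : 0 ≤ 1 - r ^ 2 := by nlinarith
    positivity

/-- The positivity condition for the unit multi-index `e_i`, admissible because `m i ≥ 1`, says
`Φ_{Y_i}(I) ≤ I`, that is, the row `Y_i` is contractive. Dilation by `r` contributes the factor `r ^
2`. -/
theorem norm_cpMapL_smul_le (hm : ∀ i, 1 ≤ m i) {Y : OpTuple n E} (hY : Y ∈ polyHyperball n m E)
    (r : ℝ) (i : Fin k) : ‖cpMapL ((r : ℂ) • Y) i‖ ≤ r ^ 2 := by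
  have hp : (Pi.single i 1 : Fin k → ℕ) ≤ m := by
    intro l
    by_cases hl : l = i
    · subst hl; simpa using hm l
    · simp [hl]
  have h1 := hY.2 _ hp
  rw [defectMap, prod_ofFn_pow_single (fun l => (1 : Module.End ℂ (E →L[ℂ] E)) - cpMap Y l) i] at h1
  refine norm_cpMapL_le (by positivity) fun x => ?_
  have h2 := h1.re_inner_nonneg_left x
  have h3 : ⟪cpMap Y i 1 x, x⟫_ℂ = ((∑ j, ‖star (Y i j) x‖ ^ 2 : ℝ) : ℂ) := by
    rw [cpMap_apply, sum_apply, sum_inner, Complex.ofReal_sum]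
    refine Finset.sum_congr rfl fun j _ => ?_
    rw [mul_one, Complex.ofReal_pow, mul_apply_eq_comp, ContinuousLinearMap.star_eq_adjoint,
      ← ContinuousLinearMap.adjoint_inner_right, inner_self_eq_norm_sq_to_K]
    rfl
  have h4 : ∑ j, ‖star (Y i j) x‖ ^ 2 ≤ ‖x‖ ^ 2 := by
    have h5 : ((1 : Module.End ℂ (E →L[ℂ] E)) - cpMap Y i) 1 x = x - cpMap Y i 1 x := rfl
    rw [h5, inner_sub_left, h3, inner_self_eq_norm_sq_to_K, map_sub] at h2
    have h6 : RCLike.re (((‖x‖ : ℝ) : ℂ) ^ 2) = ‖x‖ ^ 2 := by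
      rw [← Complex.ofReal_pow]; exact Complex.ofReal_re _
    have h7 : RCLike.re (((∑ j, ‖star (Y i j) x‖ ^ 2 : ℝ) : ℂ)) = ∑ j, ‖star (Y i j) x‖ ^ 2 :=
      Complex.ofReal_re _
    rw [h7] at h2
    have h8 := h6
    change 0 ≤ RCLike.re (((‖x‖ : ℝ) : ℂ) ^ 2) - _ at h2
    linarith
  calc ∑ j, ‖star (((r : ℂ) • Y) i j) x‖ ^ 2 = r ^ 2 * ∑ j, ‖star (Y i j) x‖ ^ 2 := by
        rw [Finset.mul_sum]
        refine Finset.sum_congr rfl fun j _ => ?_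
        rw [Pi.smul_apply, Pi.smul_apply, star_smul, smul_apply, norm_smul, norm_star, mul_pow]
        simp
    _ ≤ r ^ 2 * ‖x‖ ^ 2 := mul_le_mul_of_nonneg_left h4 (by positivity)

theorem radial_commute {X : OpTuple n E} (hX : X ∈ radial n m E) (p q : Fin k) (hpq : p ≠ q)
    (i : Fin (n p)) (j : Fin (n q)) : Commute (X p i) (X q j) := by
  obtain ⟨r, -, -, Y, hY, rfl⟩ := hX
  change Commute ((r : ℂ) • Y p i) ((r : ℂ) • Y q j)
  exact ((hY.1 p q hpq i j).smul_left _).smul_right _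

theorem radial_isPositive_defectMap {X : OpTuple n E} (hX : X ∈ radial n m E) :
    (defectMap X m 1).IsPositive := by
  obtain ⟨r, h0, h1, Y, hY, rfl⟩ := hX
  exact isPositive_defectMap_smul hY.2 h0 h1.le le_rfl

theorem radial_norm_cpMapL (hm : ∀ i, 1 ≤ m i) {X : OpTuple n E} (hX : X ∈ radial n m E) :
    ∃ r : ℝ, 0 ≤ r ∧ r < 1 ∧ ∀ i, ‖cpMapL X i‖ ≤ r ^ 2 := by
  obtain ⟨r, h0, h1, Y, hY, rfl⟩ := hX
  exact ⟨r, h0, h1, norm_cpMapL_smul_le hm hY r⟩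

variable (m) in
/-- The product of the weights of words of lengths `a₁, …, a_k`. -/
def lengthWeight (a : Fin k → ℕ) : ℝ := ∏ i, ((a i + m i - 1).choose (m i - 1) : ℝ)

theorem lengthWeight_nonneg (a : Fin k → ℕ) : 0 ≤ lengthWeight m a :=
  Finset.prod_nonneg fun _ _ => Nat.cast_nonneg _

theorem one_le_lengthWeight (a : Fin k → ℕ) : 1 ≤ lengthWeight m a := by
  rw [lengthWeight, ← Nat.cast_prod]
  exact_mod_cast Finset.prod_pos fun i _ => Nat.choose_pos (by omega)

theorem prod_weight (β : Words n) :
    ∏ i, weight (m i) (β i) = lengthWeight m fun i => (β i).length := rfl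

/-- This is `∏ (1 - x_i)^{-m_i} · ∏ (1 - x_i)^{m_i} = 1` at `x_i = Φ_{X_i}`, with the first factor
expanded in negative binomial series in the Banach algebra of bounded operators on `B(E)` and
everything evaluated at `I`. -/
theorem hasSum_resolution (hm : ∀ i, 1 ≤ m i) {X : OpTuple n E}
    (hc : ∀ p q, p ≠ q → ∀ i j, Commute (X p i) (X q j)) (hX : ∀ i, ‖cpMapL X i‖ < 1) :
    HasSum (fun a : Fin k → ℕ => (lengthWeight m a : ℂ) •
      (List.ofFn fun i => cpMap X i ^ a i).prod (defectMap X m 1)) 1 := by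
  have hk : ∀ i, m i - 1 + 1 = m i := fun i => Nat.sub_add_cancel (hm i)
  have hS : ∀ i, HasSum (fun l : ℕ => (((l + m i - 1).choose (m i - 1) : ℝ) : ℂ) • cpMapL X i ^ l)
      (Ring.inverse (1 - cpMapL X i) ^ m i) := by
    intro i
    have h := hasSum_choose_mul_geometric_of_norm_lt_one' (m i - 1) (hX i)
    rw [hk] at h
    have e : (fun l : ℕ => (((l + m i - 1).choose (m i - 1) : ℝ) : ℂ) • cpMapL X i ^ l) =
        fun l : ℕ => ((l + (m i - 1)).choose (m i - 1) : (E →L[ℂ] E) →L[ℂ] (E →L[ℂ] E)) *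
          cpMapL X i ^ l := by
      funext l
      rw [← nsmul_eq_mul, ← Nat.cast_smul_eq_nsmul ℂ, Nat.add_sub_assoc (hm i),
        Complex.ofReal_natCast]
    rw [e]
    exact h
  have hN : ∀ i, Summable fun l : ℕ =>
      ‖(((l + m i - 1).choose (m i - 1) : ℝ) : ℂ) • cpMapL X i ^ l‖ := by
    intro i
    have h := (hasSum_choose_mul_geometric_of_norm_lt_one' (m i - 1)
      (r := ‖cpMapL X i‖) (by rw [norm_norm]; exact hX i)).summable
    -- The term with exponent `0` is dropped: the bound on the norm of a power is used for positive
    -- exponents only, since for `E = 0` the identity does not have norm `1`.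
    rw [← summable_nat_add_iff 1] at h ⊢
    refine Summable.of_nonneg_of_le (fun _ => norm_nonneg _) (fun l => ?_) h
    rw [norm_smul, Nat.add_sub_assoc (hm i)]
    refine mul_le_mul (by simp) (norm_pow_le' _ (Nat.succ_pos _)) (norm_nonneg _)
      (Nat.cast_nonneg _)
  have hP := (hasSum_prod_ofFn hN hS).2
  have hU : ∀ i, IsUnit (1 - cpMapL X i) := fun i => isUnit_one_sub_of_norm_lt_one (hX i)
  have hone : (List.ofFn fun i => Ring.inverse (1 - cpMapL X i) ^ m i).prod *
      (List.ofFn fun i => (1 - cpMapL X i) ^ m i).prod = 1 := by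
    -- Factors with different indices commute, so each inverse can be brought next to the power it
    -- cancels.
    rw [prod_ofFn_mul]
    · have : ∀ i, Ring.inverse (1 - cpMapL X i) ^ m i * (1 - cpMapL X i) ^ m i = 1 := by
        intro i
        have hcomm : Commute (Ring.inverse (1 - cpMapL X i)) (1 - cpMapL X i) := by
          rw [Commute, SemiconjBy, Ring.inverse_mul_cancel _ (hU i),
            Ring.mul_inverse_cancel _ (hU i)]
        rw [← hcomm.mul_pow, Ring.inverse_mul_cancel _ (hU i), one_pow]
      simp only [this, prod_ofFn_one]
    · intro i j hij
      refine Commute.pow_pow ?_ _ _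
      have h1 : Commute (1 - cpMapL X i) (1 - cpMapL X j) :=
        (((Commute.one_left _).sub_left ((Commute.one_right _).sub_right
          (cpMapL_commute hc hij))))
      obtain ⟨u, hu⟩ := hU i
      rw [← hu] at h1 ⊢
      rw [Ring.inverse_unit]
      exact h1.units_inv_left
  have hev := hP.mapL ((ContinuousLinearMap.apply ℂ (E →L[ℂ] E)) (defectMap X m 1))
  have h1 : (ContinuousLinearMap.apply ℂ (E →L[ℂ] E)) (defectMap X m 1)
      (List.ofFn fun i => Ring.inverse (1 - cpMapL X i) ^ m i).prod = 1 := by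
    rw [ContinuousLinearMap.apply_apply, ← prod_one_sub_cpMapL_pow_apply, ← mul_apply_eq_comp,
      hone]
    rfl
  rw [h1] at hev
  have hfun : (fun a : Fin k → ℕ => (lengthWeight m a : ℂ) •
      (List.ofFn fun i => cpMap X i ^ a i).prod (defectMap X m 1)) =
      fun a : Fin k → ℕ => (ContinuousLinearMap.apply ℂ (E →L[ℂ] E)) (defectMap X m 1)
        (List.ofFn fun i => (((a i + m i - 1).choose (m i - 1) : ℝ) : ℂ) •
          cpMapL X i ^ a i).prod := by
    funext a
    have h := map_prod_ofFn (ContinuousLinearMap.toLinearMapRingHom (R₁ := ℂ) (M₁ := E →L[ℂ] E))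
      fun i => (((a i + m i - 1).choose (m i - 1) : ℝ) : ℂ) • cpMapL X i ^ a i
    have h' : ∀ i, ContinuousLinearMap.toLinearMapRingHom
        ((((a i + m i - 1).choose (m i - 1) : ℝ) : ℂ) • cpMapL X i ^ a i) =
        (((a i + m i - 1).choose (m i - 1) : ℝ) : ℂ) • cpMap X i ^ a i := fun i => by
      rw [← toLinearMapRingHom_cpMapL, ← map_pow]
      rfl
    simp only [h', prod_ofFn_smul] at h
    rw [lengthWeight, Complex.ofReal_prod, ← LinearMap.smul_apply, ← h]
    rfl
  rw [hfun]
  exact hev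

end Radial

/-! ### Words and their lengths -/

section WordsLength

variable {k : ℕ} {n : Fin k → ℕ}

/-- Tuples of words, sorted by their lengths. -/
def wordsEquiv : (Σ a : Fin k → ℕ, ∀ i, List.Vector (Fin (n i)) (a i)) ≃ Words n where
  toFun x i := (x.2 i).toList
  invFun β := ⟨fun i => (β i).length, fun i => ⟨β i, rfl⟩⟩
  left_inv := by
    rintro ⟨a, v⟩
    -- Naming the underlying lists allows `a` to be replaced by their lengths, so that no cast
    -- between vector types appears.
    obtain ⟨l, hl⟩ : ∃ l : Words n, ∀ i, l i = (v i).toList := ⟨_, fun i => rfl⟩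
    obtain rfl : a = fun i => (l i).length := by
      funext i; rw [hl i, List.Vector.toList_length]
    obtain rfl : v = fun i => ⟨l i, rfl⟩ := by
      funext i
      exact Subtype.ext (hl i).symm
    rfl
  right_inv β := rfl

theorem wordsEquiv_apply (a : Fin k → ℕ) (v : ∀ i, List.Vector (Fin (n i)) (a i)) (i : Fin k) :
    wordsEquiv (n := n) ⟨a, v⟩ i = (v i).toList := rfl

end WordsLength

/-! ### The Berezin kernel -/

section Kernel

variable {k : ℕ} {n : Fin k → ℕ} (m : Fin k → ℕ)
variable {E : Type*} [NormedAddCommGroup E] [InnerProductSpace ℂ E] [CompleteSpace E]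

/-- The components `√b_β Δ_X^m(I)^{1/2} X_β^* h` of the Berezin kernel. -/
def kernelCoeff (X : OpTuple n E) (h : E) (β : Words n) : E :=
  ((∏ i, Real.sqrt (weight (m i) (β i)) : ℝ) : ℂ) • CFC.sqrt (defectMap X m 1) (multiOpStar X β h)

theorem norm_sqrt_apply_sq {D : E →L[ℂ] E} (hD : D.IsPositive) (x : E) :
    ‖CFC.sqrt D x‖ ^ 2 = (⟪D x, x⟫_ℂ).re := by
  have h0 : (0 : E →L[ℂ] E) ≤ D := (ContinuousLinearMap.nonneg_iff_isPositive D).2 hD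
  have h1 : (CFC.sqrt D).IsPositive :=
    (ContinuousLinearMap.nonneg_iff_isPositive _).1 (CFC.sqrt_nonneg D)
  have h2 : D x = CFC.sqrt D (CFC.sqrt D x) := by
    conv_lhs => rw [← CFC.sqrt_mul_sqrt_self D h0]
    rfl
  rw [h2, h1.inner_left_eq_inner_right, inner_self_eq_norm_sq_to_K]
  change _ = (((‖CFC.sqrt D x‖ : ℝ) : ℂ) ^ 2).re
  rw [← Complex.ofReal_pow, Complex.ofReal_re]

theorem norm_kernelCoeff_sq {X : OpTuple n E} (hc : ∀ p q, p ≠ q → ∀ i j, Commute (X p i) (X q j))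
    (hD : (defectMap X m 1).IsPositive) (h : E) (β : Words n) :
    ‖kernelCoeff m X h β‖ ^ 2 = lengthWeight m (fun i => (β i).length) *
      (⟪conjEnd (multiOp X β) (defectMap X m 1) h, h⟫_ℂ).re := by
  rw [kernelCoeff, norm_smul, mul_pow, norm_sqrt_apply_sq hD, Complex.norm_real, Real.norm_eq_abs,
    sq_abs, ← Finset.prod_pow, ← prod_weight, multiOpStar_eq_star hc, conjEnd_apply,
    mul_apply_eq_comp, mul_apply_eq_comp, ContinuousLinearMap.star_eq_adjoint,
    ← ContinuousLinearMap.adjoint_inner_right (multiOp X β)]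
  congr 1
  exact Finset.prod_congr rfl fun i _ => Real.sq_sqrt (weight_pos _ _).le

/-- Words of multi-length `a` share one weight, and the conjugations by their operators add up to
`Φ_{X_1}^{a_1} ⋯ Φ_{X_k}^{a_k}`. This links the kernel to the terms of `hasSum_resolution`. -/
theorem sum_norm_kernelCoeff_sq {X : OpTuple n E}
    (hc : ∀ p q, p ≠ q → ∀ i j, Commute (X p i) (X q j))
    (hD : (defectMap X m 1).IsPositive) (h : E) (a : Fin k → ℕ) :
    ∑ v : ∀ i, List.Vector (Fin (n i)) (a i), ‖kernelCoeff m X h (wordsEquiv ⟨a, v⟩)‖ ^ 2 =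
      (⟪((lengthWeight m a : ℂ) •
        (List.ofFn fun i => cpMap X i ^ a i).prod (defectMap X m 1)) h, h⟫_ℂ).re := by
  rw [prod_cpMap_pow, smul_apply, inner_smul_left, LinearMap.sum_apply, sum_apply, sum_inner,
    Complex.conj_ofReal, Complex.re_ofReal_mul, Complex.re_sum, Finset.mul_sum]
  refine Finset.sum_congr rfl fun v _ => ?_
  rw [norm_kernelCoeff_sq m hc hD]
  simp only [wordsEquiv_apply, List.Vector.toList_length]
  rfl

variable {m}

/-- The resolution of the identity, tested on `h`, is Parseval's identity for the components of `K_X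
h`. -/
theorem hasSum_norm_kernelCoeff_sq (hm : ∀ i, 1 ≤ m i) {X : OpTuple n E} (hX : X ∈ radial n m E)
    (h : E) : HasSum (fun β : Words n => ‖kernelCoeff m X h β‖ ^ 2) (‖h‖ ^ 2) := by
  obtain ⟨r, h0, h1, hr⟩ := radial_norm_cpMapL hm hX
  have hr' : ∀ i, ‖cpMapL X i‖ < 1 := fun i => (hr i).trans_lt (by nlinarith)
  have hs := hasSum_resolution hm (radial_commute hX) hr'
  have hs2 : HasSum (fun a : Fin k → ℕ => ∑ v : ∀ i, List.Vector (Fin (n i)) (a i),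
      ‖kernelCoeff m X h (wordsEquiv ⟨a, v⟩)‖ ^ 2) (‖h‖ ^ 2) := by
    have h2 := (hs.mapL (ContinuousLinearMap.apply ℂ E h)).mapL (innerSL ℂ h)
    have h3 := h2.mapL Complex.reCLM
    have h4 : Complex.reCLM (innerSL ℂ h (ContinuousLinearMap.apply ℂ E h (1 : E →L[ℂ] E))) =
        ‖h‖ ^ 2 := by
      change (⟪h, h⟫_ℂ).re = _
      rw [inner_self_eq_norm_sq_to_K]
      change (((‖h‖ : ℝ) : ℂ) ^ 2).re = _
      rw [← Complex.ofReal_pow, Complex.ofReal_re]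
    rw [h4] at h3
    have h5 : (fun a : Fin k → ℕ => ∑ v : ∀ i, List.Vector (Fin (n i)) (a i),
        ‖kernelCoeff m X h (wordsEquiv ⟨a, v⟩)‖ ^ 2) = fun a => Complex.reCLM (innerSL ℂ h
          (ContinuousLinearMap.apply ℂ E h ((lengthWeight m a : ℂ) •
            (List.ofFn fun i => cpMap X i ^ a i).prod (defectMap X m 1)))) := by
      funext a
      rw [sum_norm_kernelCoeff_sq m (radial_commute hX) (radial_isPositive_defectMap hX),
        ← inner_conj_symm, Complex.conj_re]
      rfl
    rw [h5]
    exact h3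
  -- The sum over lengths is unfolded into a sum over words; nonnegativity of the terms justifies
  -- this.
  rw [← wordsEquiv.hasSum_iff]
  refine HasSum.sigma_of_hasSum hs2 (fun a => hasSum_fintype _) ?_
  refine (summable_sigma_of_nonneg fun _ => sq_nonneg _).2 ⟨fun a => (hasSum_fintype _).summable, ?_⟩
  refine hs2.summable.congr fun a => ?_
  rw [tsum_fintype]

theorem hasSum_norm_sq_of_orthogonalFamily {ι G V : Type*} [NormedAddCommGroup G]
    [InnerProductSpace ℂ G] [NormedAddCommGroup V] [InnerProductSpace ℂ V] {J : ι → G →ₗᵢ[ℂ] V}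
    (hJ : OrthogonalFamily ℂ (fun _ : ι => G) J) {f : ι → G} {v : V}
    (hv : HasSum (fun i => J i (f i)) v) : HasSum (fun i => ‖f i‖ ^ 2) (‖v‖ ^ 2) := by
  have h := (Filter.Tendsto.norm hv).pow 2
  simp only [hJ.norm_sum] at h
  exact h

/-- `y ↦ e_β ⊗ y` as a linear isometry. -/
def basisTmul (n : Fin k → ℕ) (E : Type*) [NormedAddCommGroup E] [InnerProductSpace ℂ E]
    (β : Words n) : E →ₗᵢ[ℂ] HTensor (Fock n) E :=
  { (hTmulLeft (basisVec n β) : E →L[ℂ] HTensor (Fock n) E).toLinearMap with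
    norm_map' := fun y => by
      change ‖hTmul (basisVec n β) y‖ = ‖y‖
      rw [norm_hTmul, (orthonormal_basisVec n).1 β, one_mul] }

theorem basisTmul_apply (β : Words n) (y : E) : basisTmul n E β y = hTmul (basisVec n β) y := rfl

theorem orthogonalFamily_basisTmul :
    OrthogonalFamily ℂ (fun _ : Words n => E) (basisTmul n E) := by
  intro β γ hβγ x y
  rw [basisTmul_apply, basisTmul_apply, hTensor_inner, (orthonormal_basisVec n).2 hβγ, zero_mul]

theorem kernelTerm_eq (X : OpTuple n E) (h : E) (β : Words n) :
    kernelTerm m X h β = basisTmul n E β (kernelCoeff m X h β) := by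
  rw [kernelCoeff, map_smul, basisTmul_apply, kernelTerm]

/-- The terms lie in the mutually orthogonal subspaces `e_β ⊗ E`, so square summability of their
norms is enough. -/
theorem summable_kernelTerm (hm : ∀ i, 1 ≤ m i) {X : OpTuple n E} (hX : X ∈ radial n m E)
    (h : E) : Summable (kernelTerm m X h) := by
  rw [funext (kernelTerm_eq X h)]
  exact (orthogonalFamily_basisTmul.summable_iff_norm_sq_summable _).2
    (hasSum_norm_kernelCoeff_sq hm hX h).summable

theorem norm_tsum_kernelTerm (hm : ∀ i, 1 ≤ m i) {X : OpTuple n E} (hX : X ∈ radial n m E)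
    (h : E) : ‖∑' β, kernelTerm m X h β‖ = ‖h‖ := by
  have h1 := (summable_kernelTerm hm hX h).hasSum
  rw [funext (kernelTerm_eq X h)] at h1 ⊢
  have h2 := (hasSum_norm_sq_of_orthogonalFamily orthogonalFamily_basisTmul h1).unique
    (hasSum_norm_kernelCoeff_sq hm hX h)
  exact (sq_eq_sq₀ (norm_nonneg _) (norm_nonneg _)).1 h2

theorem kernelTerm_add (X : OpTuple n E) (x y : E) (β : Words n) :
    kernelTerm m X (x + y) β = kernelTerm m X x β + kernelTerm m X y β := by
  simp only [kernelTerm, map_add, hTmul_add_right, smul_add]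

theorem kernelTerm_smul (X : OpTuple n E) (c : ℂ) (x : E) (β : Words n) :
    kernelTerm m X (c • x) β = c • kernelTerm m X x β := by
  simp only [kernelTerm, map_smul, hTmul_smul_right]
  rw [smul_comm]

theorem exists_berezinKernel (hm : ∀ i, 1 ≤ m i) {X : OpTuple n E} (hX : X ∈ radial n m E) :
    ∃ V : E →L[ℂ] HTensor (Fock n) E, ∀ h, HasSum (kernelTerm m X h) (V h) := by
  have hs := summable_kernelTerm hm hX
  let L : E →ₗ[ℂ] HTensor (Fock n) E :=
    { toFun := fun h => ∑' β, kernelTerm m X h β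
      map_add' := fun x y => by
        rw [← (hs x).tsum_add (hs y)]
        exact tsum_congr fun β => kernelTerm_add X x y β
      map_smul' := fun c x => by
        rw [RingHom.id_apply, ← (hs x).tsum_const_smul c]
        exact tsum_congr fun β => kernelTerm_smul X c x β }
  exact ⟨L.mkContinuous 1 fun h => by
    rw [one_mul]; exact (norm_tsum_kernelTerm hm hX h).le, fun h => (hs h).hasSum⟩

theorem hasSum_kernelTerm (hm : ∀ i, 1 ≤ m i) {X : OpTuple n E} (hX : X ∈ radial n m E) (h : E) :
    HasSum (kernelTerm m X h) (berezinKernel m X h) := by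
  have hV := exists_berezinKernel hm hX
  rw [berezinKernel, dif_pos hV]
  exact hV.choose_spec h

theorem norm_berezinKernel_apply (hm : ∀ i, 1 ≤ m i) {X : OpTuple n E} (hX : X ∈ radial n m E)
    (h : E) : ‖berezinKernel m X h‖ = ‖h‖ := by
  have h1 := hasSum_kernelTerm hm hX h
  simp only [funext (kernelTerm_eq X h)] at h1
  have h2 := (hasSum_norm_sq_of_orthogonalFamily orthogonalFamily_basisTmul h1).unique
    (hasSum_norm_kernelCoeff_sq hm hX h)
  exact (sq_eq_sq₀ (norm_nonneg _) (norm_nonneg _)).1 h2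

theorem norm_berezinKernel_le (hm : ∀ i, 1 ≤ m i) {X : OpTuple n E} (hX : X ∈ radial n m E) :
    ‖berezinKernel m X‖ ≤ 1 :=
  ContinuousLinearMap.opNorm_le_bound _ zero_le_one fun h => by
    rw [norm_berezinKernel_apply hm hX, one_mul]

theorem adjoint_berezinKernel_comp_self (hm : ∀ i, 1 ≤ m i) {X : OpTuple n E}
    (hX : X ∈ radial n m E) :
    (ContinuousLinearMap.adjoint (berezinKernel m X)).comp (berezinKernel m X) =
      ContinuousLinearMap.id ℂ E :=
  (ContinuousLinearMap.norm_map_iff_adjoint_comp_self _).1 (norm_berezinKernel_apply hm hX)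

end Kernel

/-! ### Intertwining properties of the Berezin kernel -/

section Total

variable {k : ℕ} {n : Fin k → ℕ}
variable {E F : Type*} [NormedAddCommGroup E] [InnerProductSpace ℂ E]
  [NormedAddCommGroup F] [InnerProductSpace ℂ F]

theorem dense_span_basisVec :
    Dense (Submodule.span ℂ (Set.range (basisVec n)) : Set (Fock n)) := by
  classical
  let b : HilbertBasis (Words n) ℂ (Fock n) := ⟨LinearIsometryEquiv.refl ℂ _⟩
  have hb : ⇑b = basisVec n := by
    funext α
    have h := b.repr_symm_single α
    rw [← h, basisVec]
    have h2 : b.repr.symm (lp.single 2 α (1 : ℂ)) = lp.single 2 α (1 : ℂ) := rfl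
    rw [h2]
  have h := b.dense_span
  rw [hb] at h
  exact Submodule.dense_iff_topologicalClosure_eq_top.2 h

/-- The elementary tensors `x ⊗ y`, with `x` in a total set, are total. -/
theorem dense_span_hTmul_left {s : Set E} (hs : Dense (Submodule.span ℂ s : Set E)) :
    Dense (Submodule.span ℂ {z | ∃ (x : E) (y : F), x ∈ s ∧ z = hTmul x y} :
      Set (HTensor E F)) := by
  set S := Submodule.span ℂ {z | ∃ (x : E) (y : F), x ∈ s ∧ z = hTmul x y} with hS
  intro z
  rw [← Submodule.topologicalClosure_coe]
  refine hTensor_induction (p := fun z => z ∈ (S.topologicalClosure : Set (HTensor E F)))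
    (Submodule.isClosed_topologicalClosure _) (Submodule.zero_mem _) (fun x y => ?_)
    (fun a b ha hb => Submodule.add_mem _ ha hb) z
  have hx : x ∈ closure (Submodule.span ℂ s : Set E) := hs x
  rw [Submodule.topologicalClosure_coe, ← hTmulRight_apply]
  refine map_mem_closure (hTmulRight F y : E →L[ℂ] HTensor E F).continuous hx fun w hw => ?_
  change hTmulRight F y w ∈ S
  rw [SetLike.mem_coe] at hw
  induction hw using Submodule.span_induction with
  | mem w hw => exact Submodule.subset_span ⟨w, y, hw, rfl⟩
  | zero => simp
  | add a b ha' hb' ha hb => rw [map_add]; exact S.add_mem ha hb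
  | smul c a ha' ha => rw [map_smul]; exact S.smul_mem _ ha

theorem ext_inner_basisVec_left {z z' : HTensor (Fock n) E}
    (h : ∀ (γ : Words n) (y : E),
      ⟪hTmul (basisVec n γ) y, z⟫_ℂ = ⟪hTmul (basisVec n γ) y, z'⟫_ℂ) : z = z' := by
  refine ext_inner_of_total (dense_span_hTmul_left (dense_span_basisVec (n := n))) ?_
  rintro _ ⟨_, y, ⟨γ, rfl⟩, rfl⟩
  exact h γ y

theorem ext_inner_basisVec_right {z z' : HTensor E (Fock n)}
    (h : ∀ (x : E) (γ : Words n),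
      ⟪hTmul x (basisVec n γ), z⟫_ℂ = ⟪hTmul x (basisVec n γ), z'⟫_ℂ) : z = z' := by
  refine ext_inner_of_total (dense_span_hTmul (dense_span_basisVec (n := n))) ?_
  rintro _ ⟨x, _, ⟨γ, rfl⟩, rfl⟩
  exact h x γ

theorem clm_ext_basisVec_right {f g : HTensor E (Fock n) →L[ℂ] F}
    (h : ∀ (x : E) (γ : Words n), f (hTmul x (basisVec n γ)) = g (hTmul x (basisVec n γ))) :
    f = g := by
  refine clm_ext_of_total (dense_span_hTmul (dense_span_basisVec (n := n))) ?_
  rintro _ ⟨x, _, ⟨γ, rfl⟩, rfl⟩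
  exact h x γ

/-- An operator on `E ⊗ Fock` is determined by its matrix entries. -/
theorem clm_ext_entries {f g : HTensor E (Fock n) →L[ℂ] HTensor E (Fock n)}
    (h : ∀ (ω γ : Words n) (x y : E), ⟪hTmul y (basisVec n ω), f (hTmul x (basisVec n γ))⟫_ℂ =
      ⟪hTmul y (basisVec n ω), g (hTmul x (basisVec n γ))⟫_ℂ) : f = g :=
  clm_ext_basisVec_right fun x γ => ext_inner_basisVec_right fun y ω => h ω γ x y

end Total

section Intertwining

variable {k : ℕ} {n m : Fin k → ℕ}
variable {E : Type*} [NormedAddCommGroup E] [InnerProductSpace ℂ E] [CompleteSpace E]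

theorem inner_basisVec_berezinKernel (hm : ∀ i, 1 ≤ m i) {X : OpTuple n E}
    (hX : X ∈ radial n m E) (γ : Words n) (y h : E) :
    ⟪hTmul (basisVec n γ) y, berezinKernel m X h⟫_ℂ = ⟪y, kernelCoeff m X h γ⟫_ℂ := by
  have h1 := (hasSum_kernelTerm hm hX h).mapL (innerSL ℂ (hTmul (basisVec n γ) y))
  have h2 := hasSum_single (f := fun β => innerSL ℂ (hTmul (basisVec n γ) y)
    (kernelTerm m X h β)) γ fun β hβ => by
      rw [innerSL_apply_apply, kernelTerm_eq, basisTmul_apply, hTensor_inner,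
        (orthonormal_basisVec n).2 hβ.symm, zero_mul]
  have h3 := h1.unique h2
  rw [innerSL_apply_apply, innerSL_apply_apply, kernelTerm_eq, basisTmul_apply, hTensor_inner,
    inner_self_eq_norm_sq_to_K, (orthonormal_basisVec n).1] at h3
  simpa using h3

/-- The new letter stands inside the `i`-th word; it moves to the front past words with other
indices only, which commute with it. -/
theorem multiOp_consAt {X : OpTuple n E} (hc : ∀ p q, p ≠ q → ∀ i j, Commute (X p i) (X q j))
    (i : Fin k) (j : Fin (n i)) (γ : Words n) :
    multiOp X (consAt n i j γ) = X i j * multiOp X γ := by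
  have h : ∀ l, wordOp (X l) (consAt n i j γ l) =
      (fun _ => X i j) l ^ (Pi.single i 1 : Fin k → ℕ) l * wordOp (X l) (γ l) := by
    intro l
    by_cases hl : l = i
    · subst hl; simp [consAt, wordOp]
    · simp [consAt, hl]
  rw [multiOp, multiOp, ← prod_ofFn_pow_single (fun _ => X i j) i, prod_ofFn_mul]
  · simp only [h]
  · intro a b hab
    by_cases ha : a = i
    · subst ha
      exact Commute.pow_left (wordOp_commute (fun l => (hc a b hab j l).symm) _).symm _
    · simp [ha]

/-- The coefficient of the model is exactly the ratio of consecutive kernel coefficients; this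
cancellation makes the weighted shifts, rather than the plain ones, the universal model. -/
theorem prod_sqrt_weight_consAt (i : Fin k) (j : Fin (n i)) (γ : Words n) :
    Real.sqrt (weight (m i) (γ i) / weight (m i) (j :: γ i)) *
      ∏ l, Real.sqrt (weight (m l) (consAt n i j γ l)) = ∏ l, Real.sqrt (weight (m l) (γ l)) := by
  classical
  rw [← Finset.mul_prod_erase _ _ (Finset.mem_univ i), ← Finset.mul_prod_erase _ (fun l =>
    Real.sqrt (weight (m l) (γ l))) (Finset.mem_univ i), ← mul_assoc]
  congr 1
  · rw [consAt, Function.update_self, ← Real.sqrt_mul (div_nonneg (weight_pos _ _).le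
      (weight_pos _ _).le), div_mul_cancel₀ _ (weight_pos _ _).ne']
  · refine Finset.prod_congr rfl fun l hl => ?_
    rw [consAt, Function.update_of_ne (Finset.ne_of_mem_erase hl)]

theorem kernelCoeff_consAt {X : OpTuple n E}
    (hc : ∀ p q, p ≠ q → ∀ i j, Commute (X p i) (X q j)) (i : Fin k) (j : Fin (n i)) (h : E)
    (γ : Words n) :
    ((Real.sqrt (weight (m i) (γ i) / weight (m i) (j :: γ i)) : ℝ) : ℂ) •
      kernelCoeff m X h (consAt n i j γ) = kernelCoeff m X (star (X i j) h) γ := by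
  rw [kernelCoeff, kernelCoeff, smul_smul, ← Complex.ofReal_mul, prod_sqrt_weight_consAt,
    multiOpStar_eq_star hc, multiOpStar_eq_star hc, multiOp_consAt hc, star_mul, mul_apply_eq_comp]

/-- Pairing with `e_γ ⊗ y` moves `W_{i,j}` onto the basis vector and reduces the claim to the
coefficient identity `kernelCoeff_consAt`. -/
theorem star_model_comp_berezinKernel (hm : ∀ i, 1 ≤ m i) {X : OpTuple n E}
    (hX : X ∈ radial n m E) (i : Fin k) (j : Fin (n i)) :
    (hMap (star (model n m i j)) (ContinuousLinearMap.id ℂ E)).comp (berezinKernel m X) =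
      (berezinKernel m X).comp (star (X i j)) := by
  ext1 h
  refine ext_inner_basisVec_left fun γ y => ?_
  have hid : ContinuousLinearMap.id ℂ E =
      ContinuousLinearMap.adjoint (ContinuousLinearMap.id ℂ E) := by
    rw [ContinuousLinearMap.adjoint_id]
  rw [ContinuousLinearMap.comp_apply, ContinuousLinearMap.comp_apply, hid,
    ContinuousLinearMap.star_eq_adjoint, ← hMap_adjoint, ContinuousLinearMap.adjoint_inner_right,
    hMap_hTmul, model_basisVec, ContinuousLinearMap.id_apply, hTmul_smul_left, inner_smul_left,
    inner_basisVec_berezinKernel hm hX, inner_basisVec_berezinKernel hm hX,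
    ← kernelCoeff_consAt (radial_commute hX),
    inner_smul_right, Complex.conj_ofReal]

/-- `(w^* ⊗ I) K_X = K_X x^*`. -/
def Intertwines (m : Fin k → ℕ) (X : OpTuple n E) (w : Fock n →L[ℂ] Fock n) (x : E →L[ℂ] E) :
    Prop :=
  (hMap (star w) (ContinuousLinearMap.id ℂ E)).comp (berezinKernel m X) =
      (berezinKernel m X).comp (star x)

theorem Intertwines.one (X : OpTuple n E) : Intertwines m X 1 1 := by
  rw [Intertwines, star_one, star_one]
  change (hMap (ContinuousLinearMap.id ℂ _) _).comp _ = _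
  rw [hMap_id]
  rfl

theorem Intertwines.mul {X : OpTuple n E} {w w' : Fock n →L[ℂ] Fock n} {x x' : E →L[ℂ] E}
    (h : Intertwines m X w x) (h' : Intertwines m X w' x') :
    Intertwines m X (w * w') (x * x') := by
  rw [Intertwines] at *
  have e : hMap (star (w * w')) (ContinuousLinearMap.id ℂ E) =
      (hMap (star w') (ContinuousLinearMap.id ℂ E)).comp
        (hMap (star w) (ContinuousLinearMap.id ℂ E)) := by
    rw [hMap_comp, star_mul]; rfl
  rw [e, ContinuousLinearMap.comp_assoc, h, ← ContinuousLinearMap.comp_assoc, h', star_mul]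
  rfl

theorem Intertwines.list_prod {ι : Type*} {X : OpTuple n E} {f : ι → (Fock n →L[ℂ] Fock n)}
    {g : ι → (E →L[ℂ] E)} (h : ∀ i, Intertwines m X (f i) (g i)) (l : List ι) :
    Intertwines m X (l.map f).prod (l.map g).prod := by
  induction l with
  | nil => exact Intertwines.one X
  | cons i l ih => simpa using (h i).mul ih

theorem intertwines_multiOp (hm : ∀ i, 1 ≤ m i) {X : OpTuple n E}
    (hX : X ∈ radial n m E) (α : Words n) :
    Intertwines m X (multiOp (model n m) α) (multiOp X α) := by
  rw [multiOp, multiOp, List.ofFn_eq_map, List.ofFn_eq_map]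
  refine Intertwines.list_prod (fun i => ?_) _
  exact Intertwines.list_prod (fun j => star_model_comp_berezinKernel hm hX i j) _

end Intertwining

/-! ### The Berezin transform as a bounded linear map -/

section Transform

variable {k : ℕ} {n m : Fin k → ℕ}
variable {E : Type*} [NormedAddCommGroup E] [InnerProductSpace ℂ E] [CompleteSpace E]
variable {K : Type*} [NormedAddCommGroup K] [InnerProductSpace ℂ K]

variable (K) in
/-- `I_K ⊗ R`, followed by the identification of `K ⊗ (Fock ⊗ E)` with `(K ⊗ Fock) ⊗ E`, as a
bounded linear function of `R`. -/
def ampL : (E →L[ℂ] HTensor (Fock n) E) →L[ℂ]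
    (HTensor K E →L[ℂ] HTensor (HTensor K (Fock n)) E) :=
  (ContinuousLinearMap.compL ℂ _ _ _ (hAssoc K (Fock n) E :
    HTensor K (HTensor (Fock n) E) →L[ℂ] HTensor (HTensor K (Fock n)) E)).comp
      (hMapRightL K E (HTensor (Fock n) E))

theorem ampL_apply (R : E →L[ℂ] HTensor (Fock n) E) (z : HTensor K E) :
    ampL K R z = hAssoc K (Fock n) E (hMap (ContinuousLinearMap.id ℂ K) R z) := rfl

theorem norm_ampL_le (R : E →L[ℂ] HTensor (Fock n) E) : ‖ampL K R‖ ≤ ‖R‖ := by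
  refine ContinuousLinearMap.opNorm_le_bound _ (norm_nonneg _) fun z => ?_
  rw [ampL_apply, LinearIsometryEquiv.norm_map]
  exact ((hMap _ _).le_opNorm z).trans
    (mul_le_mul_of_nonneg_right (norm_hMap_id_left_le R) (norm_nonneg _))

theorem berezin_eq (X : OpTuple n E) (g : HTensor K (Fock n) →L[ℂ] HTensor K (Fock n)) :
    berezin m X g = (ContinuousLinearMap.adjoint (ampL K (berezinKernel m X))).comp
      ((hMap g (ContinuousLinearMap.id ℂ E)).comp (ampL K (berezinKernel m X))) := rfl

variable (m K) in
/-- The Berezin transform as a linear map. -/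
def berezinL (X : OpTuple n E) : (HTensor K (Fock n) →L[ℂ] HTensor K (Fock n)) →L[ℂ]
    (HTensor K E →L[ℂ] HTensor K E) :=
  (ContinuousLinearMap.compL ℂ _ _ _
      (ContinuousLinearMap.adjoint (ampL K (berezinKernel m X)))).comp
    (((ContinuousLinearMap.compL ℂ _ _ _).flip (ampL K (berezinKernel m X))).comp
      (hMapLeftL _ _ _))

theorem berezinL_apply (X : OpTuple n E) (g : HTensor K (Fock n) →L[ℂ] HTensor K (Fock n)) :
    berezinL m K X g = berezin m X g := rfl

theorem norm_ampL_berezinKernel_le (hm : ∀ i, 1 ≤ m i) {X : OpTuple n E}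
    (hX : X ∈ radial n m E) : ‖ampL K (berezinKernel m X)‖ ≤ 1 :=
  (norm_ampL_le _).trans (norm_berezinKernel_le hm hX)

/-- Complete contractivity: `B_X` is the amplification `g ↦ g ⊗ I` followed by compression to the
range of the contraction `I_K ⊗ K_X`, and neither step increases matrix norms. -/
theorem norm_blockOp_berezin_le (hm : ∀ i, 1 ≤ m i) {X : OpTuple n E} (hX : X ∈ radial n m E)
    {q : ℕ} (M : Matrix (Fin q) (Fin q) (HTensor K (Fock n) →L[ℂ] HTensor K (Fock n))) :
    ‖blockOp (fun i j => berezin m X (M i j))‖ ≤ ‖blockOp M‖ := by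
  have hV := norm_ampL_berezinKernel_le (K := K) hm hX
  refine (norm_blockOp_conj_le (fun i j => hMap (M i j) (ContinuousLinearMap.id ℂ E)) _ _ ?_
    hV).trans (norm_blockOp_hMap_le M)
  rw [LinearIsometryEquiv.norm_map]
  exact hV

theorem norm_berezin_le (hm : ∀ i, 1 ≤ m i) {X : OpTuple n E} (hX : X ∈ radial n m E)
    (g : HTensor K (Fock n) →L[ℂ] HTensor K (Fock n)) : ‖berezin m X g‖ ≤ ‖g‖ := by
  have hV := norm_ampL_berezinKernel_le (K := K) hm hX
  rw [berezin_eq]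
  have h1 : ‖ContinuousLinearMap.adjoint (ampL K (berezinKernel m X))‖ ≤ 1 := by
    rw [LinearIsometryEquiv.norm_map]; exact hV
  refine (ContinuousLinearMap.opNorm_comp_le _ _).trans ?_
  refine (mul_le_of_le_one_left (norm_nonneg _) h1).trans ?_
  refine (ContinuousLinearMap.opNorm_comp_le _ _).trans ?_
  exact (mul_le_of_le_one_right (norm_nonneg _) hV).trans (norm_hMap_id_right_le g)

theorem ampL_comp_left (w : Fock n →L[ℂ] Fock n) (R : E →L[ℂ] HTensor (Fock n) E) :
    ampL K ((hMap w (ContinuousLinearMap.id ℂ E)).comp R) =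
      (hMap (hMap (ContinuousLinearMap.id ℂ K) w) (ContinuousLinearMap.id ℂ E)).comp
        (ampL K R) := by
  ext1 z
  rw [ampL_apply, ContinuousLinearMap.comp_apply, ampL_apply, ← hAssoc_hMap,
    ← ContinuousLinearMap.comp_apply, hMap_comp, ContinuousLinearMap.id_comp]

theorem berezin_hMap [CompleteSpace K] (X : OpTuple n E) (A : K →L[ℂ] K) (w : Fock n →L[ℂ] Fock n) :
    berezin m X (hMap A w) = hMap A ((ContinuousLinearMap.adjoint (berezinKernel m X)).comp
      ((hMap w (ContinuousLinearMap.id ℂ E)).comp (berezinKernel m X))) := by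
  ext1 z
  refine ext_inner_left ℂ fun z' => ?_
  rw [berezin_eq, ContinuousLinearMap.comp_apply, ContinuousLinearMap.adjoint_inner_right,
    ContinuousLinearMap.comp_apply, ampL_apply, ampL_apply, ← hAssoc_hMap,
    LinearIsometryEquiv.inner_map_map, ← ContinuousLinearMap.adjoint_inner_right, hMap_adjoint,
    ← ContinuousLinearMap.comp_apply, ← ContinuousLinearMap.comp_apply, hMap_comp, hMap_comp,
    ContinuousLinearMap.adjoint_id, ContinuousLinearMap.comp_id, ContinuousLinearMap.id_comp,
    ContinuousLinearMap.comp_assoc]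

/-- `W_β^*` passes through `K_X` as `X_β^*`, the adjoint relation takes `W_α` through `K_X^*` as
`X_α`, and what is left in the middle is `K_X^* K_X = I`. -/
theorem berezin_hMap_multiOp [CompleteSpace K] (hm : ∀ i, 1 ≤ m i) {X : OpTuple n E}
    (hX : X ∈ radial n m E) (A : K →L[ℂ] K) (α β : Words n) :
    berezin m X (hMap A (multiOp (model n m) α * star (multiOp (model n m) β))) =
      hMap A (multiOp X α * multiOpStar X β) := by
  rw [berezin_hMap, multiOpStar_eq_star (radial_commute hX)]
  congr 1
  set W := model n m
  set B := berezinKernel m X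
  have h1 : (hMap (star (multiOp W β)) (ContinuousLinearMap.id ℂ E)).comp B =
      B.comp (star (multiOp X β)) := intertwines_multiOp hm hX β
  have h2 : (hMap (star (multiOp W α)) (ContinuousLinearMap.id ℂ E)).comp B =
      B.comp (star (multiOp X α)) := intertwines_multiOp hm hX α
  have h3 : (ContinuousLinearMap.adjoint B).comp
      (hMap (multiOp W α) (ContinuousLinearMap.id ℂ E)) =
      (multiOp X α).comp (ContinuousLinearMap.adjoint B) := by
    have h4 := congrArg ContinuousLinearMap.adjoint h2
    rw [ContinuousLinearMap.adjoint_comp, ContinuousLinearMap.adjoint_comp, hMap_adjoint,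
      ContinuousLinearMap.star_eq_adjoint, ContinuousLinearMap.star_eq_adjoint,
      ContinuousLinearMap.adjoint_adjoint, ContinuousLinearMap.adjoint_adjoint,
      ContinuousLinearMap.adjoint_id] at h4
    exact h4
  have h5 : hMap (multiOp W α * star (multiOp W β)) (ContinuousLinearMap.id ℂ E) =
      (hMap (multiOp W α) (ContinuousLinearMap.id ℂ E)).comp
        (hMap (star (multiOp W β)) (ContinuousLinearMap.id ℂ E)) := by
    rw [hMap_comp]; rfl
  rw [h5, ContinuousLinearMap.comp_assoc, h1, ← ContinuousLinearMap.comp_assoc, h3,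
    ContinuousLinearMap.comp_assoc, ← ContinuousLinearMap.comp_assoc B.adjoint,
    adjoint_berezinKernel_comp_self hm hX]
  rfl

end Transform

/-! ### The universal model -/

section ModelHyperball

variable {k : ℕ} {n m : Fin k → ℕ}

theorem ext_inner_basisVec {z z' : Fock n}
    (h : ∀ γ : Words n, ⟪basisVec n γ, z⟫_ℂ = ⟪basisVec n γ, z'⟫_ℂ) : z = z' := by
  refine ext_inner_of_total (dense_span_basisVec (n := n)) ?_
  rintro _ ⟨γ, rfl⟩
  exact h γ

theorem clm_ext_basisVec {V : Type*} [NormedAddCommGroup V] [NormedSpace ℂ V]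
    {f g : Fock n →L[ℂ] V} (h : ∀ γ : Words n, f (basisVec n γ) = g (basisVec n γ)) : f = g := by
  refine clm_ext_of_total (dense_span_basisVec (n := n)) ?_
  rintro _ ⟨γ, rfl⟩
  exact h γ

theorem inner_basisVec (α β : Words n) [Decidable (α = β)] :
    ⟪basisVec n α, basisVec n β⟫_ℂ = if α = β then 1 else 0 := by
  split_ifs with h
  · subst h
    rw [inner_self_eq_norm_sq_to_K, (orthonormal_basisVec n).1]; simp
  · exact (orthonormal_basisVec n).2 h

theorem model_commute {p q : Fin k} (hpq : p ≠ q) (i : Fin (n p)) (j : Fin (n q)) :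
    Commute (model n m p i) (model n m q j) := by
  refine clm_ext_basisVec fun γ => ?_
  rw [mul_apply_eq_comp, mul_apply_eq_comp, model_basisVec, model_basisVec, map_smul, map_smul,
    model_basisVec, model_basisVec, smul_comm]
  have h1 : consAt n q j γ p = γ p := Function.update_of_ne hpq _ _
  have h2 : consAt n p i γ q = γ q := Function.update_of_ne hpq.symm _ _
  have h3 : consAt n p i (consAt n q j γ) = consAt n q j (consAt n p i γ) := by
    rw [consAt, h1, consAt, consAt, h2, consAt, Function.update_comm hpq]
  rw [h1, h2, h3]

theorem star_model_basisVec_of_nil {i : Fin k} (j : Fin (n i)) {γ : Words n} (hγ : γ i = []) :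
    star (model n m i j) (basisVec n γ) = 0 := by
  classical
  refine ext_inner_basisVec fun δ => ?_
  rw [ContinuousLinearMap.star_eq_adjoint, ContinuousLinearMap.adjoint_inner_right, model_basisVec,
    inner_smul_left, inner_basisVec, if_neg, mul_zero, inner_zero_right]
  intro h
  have := congrFun h i
  rw [hγ, consAt, Function.update_self] at this
  exact List.cons_ne_nil _ _ this

theorem star_model_basisVec_consAt {i : Fin k} (j j' : Fin (n i)) (δ : Words n) :
    star (model n m i j) (basisVec n (consAt n i j' δ)) = if j = j' then
      ((Real.sqrt (weight (m i) (δ i) / weight (m i) (j :: δ i)) : ℝ) : ℂ) • basisVec n δ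
      else 0 := by
  classical
  refine ext_inner_basisVec fun ε => ?_
  rw [ContinuousLinearMap.star_eq_adjoint, ContinuousLinearMap.adjoint_inner_right, model_basisVec,
    inner_smul_left, inner_basisVec, Complex.conj_ofReal]
  split_ifs with h1 h2 h2
  · subst h2
    have := consAt_injective n i j h1
    subst this
    rw [inner_smul_right, inner_basisVec, if_pos rfl]
  · have := congrFun h1 i
    simp only [consAt, Function.update_self, List.cons.injEq] at this
    exact absurd this.1 h2
  · subst h2
    rw [inner_smul_right, inner_basisVec, if_neg (fun e => h1 (by rw [e])), mul_zero, mul_zero]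
  · rw [inner_zero_right, mul_zero]

/-- In this form the weights obey the Pascal rule for `Nat.multichoose`, on which the computation of
the defect operators of the model rests. -/
theorem weight_eq_multichoose {d : ℕ} {r : ℕ} (hr : 1 ≤ r) (α : List (Fin d)) :
    weight r α = (Nat.multichoose r α.length : ℝ) := by
  rw [weight, Nat.multichoose_eq, Nat.add_comm r]
  congr 1
  rw [← Nat.choose_symm_of_eq_add]
  omega

theorem consAt_eq_of_cons {i : Fin k} {γ : Words n} {j : Fin (n i)} {l : List (Fin (n i))}
    (h : γ i = j :: l) : γ = consAt n i j (Function.update γ i l) := by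
  rw [consAt, Function.update_self, Function.update_idem, ← h, Function.update_eq_self]

/-- The eigenvalues of the defect operators of the universal model. -/
def defectEigenvalue (m q : Fin k → ℕ) (γ : Words n) : ℝ :=
  ∏ i, (Nat.multichoose (q i) (γ i).length : ℝ) / weight (m i) (γ i)

theorem defectEigenvalue_nonneg (q : Fin k → ℕ) (γ : Words n) : 0 ≤ defectEigenvalue m q γ :=
  Finset.prod_nonneg fun _ _ => div_nonneg (Nat.cast_nonneg _) (weight_pos _ _).le

/-- `Y` is diagonal with the eigenvalues `defectEigenvalue m q`. -/
def IsDefectDiagonal (m q : Fin k → ℕ) (Y : Fock n →L[ℂ] Fock n) : Prop :=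
  ∀ γ, Y (basisVec n γ) = (defectEigenvalue m q γ : ℂ) • basisVec n γ

theorem isDefectDiagonal_one (hm : ∀ i, 1 ≤ m i) :
    IsDefectDiagonal m m (1 : Fock n →L[ℂ] Fock n) := by
  intro γ
  have h : defectEigenvalue m m γ = 1 := by
    refine Finset.prod_eq_one fun i _ => ?_
    rw [← weight_eq_multichoose (hm i), div_self (weight_pos _ _).ne']
  rw [h, Complex.ofReal_one, one_smul]
  rfl

theorem cpMap_model_basisVec_of_nil (i : Fin k) (Y : Fock n →L[ℂ] Fock n) {γ : Words n}
    (hγ : γ i = []) : cpMap (model n m) i Y (basisVec n γ) = 0 := by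
  rw [cpMap_apply, sum_apply]
  refine Finset.sum_eq_zero fun j _ => ?_
  rw [mul_apply_eq_comp, mul_apply_eq_comp, star_model_basisVec_of_nil j hγ, map_zero, map_zero]

theorem cpMap_model_basisVec_consAt (i : Fin k) {Y : Fock n →L[ℂ] Fock n} {c : ℂ} (j : Fin (n i))
    {δ : Words n} (hY : Y (basisVec n δ) = c • basisVec n δ) :
    cpMap (model n m) i Y (basisVec n (consAt n i j δ)) =
      (c * ((weight (m i) (δ i) / weight (m i) (j :: δ i) : ℝ) : ℂ)) •
        basisVec n (consAt n i j δ) := by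
  rw [cpMap_apply, sum_apply, Finset.sum_eq_single j]
  · rw [mul_apply_eq_comp, mul_apply_eq_comp, star_model_basisVec_consAt, if_pos rfl, map_smul,
      hY, map_smul, map_smul, model_basisVec, smul_smul, smul_smul]
    congr 1
    rw [← Real.mul_self_sqrt (div_nonneg (weight_pos (m i) (δ i)).le
      (weight_pos (m i) (j :: δ i)).le), Complex.ofReal_mul]
    -- The rewrite before also altered the radicands on the left-hand side; here they are folded
    -- back.
    rw [Real.mul_self_sqrt (div_nonneg (weight_pos (m i) (δ i)).le
      (weight_pos (m i) (j :: δ i)).le)]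
    ring
  · intro l _ hl
    rw [mul_apply_eq_comp, mul_apply_eq_comp, star_model_basisVec_consAt, if_neg hl, map_zero,
      map_zero]
  · simp

theorem defectEigenvalue_update_nil {q : Fin k → ℕ} {i : Fin k} {γ : Words n} (hγ : γ i = [])
    (r : ℕ) : defectEigenvalue m (Function.update q i r) γ = defectEigenvalue m q γ := by
  refine Finset.prod_congr rfl fun l _ => ?_
  by_cases hl : l = i
  · subst hl; simp [hγ]
  · rw [Function.update_of_ne hl]

/-- All factors except the `i`-th agree. There the identity is the Pascal rule `multichoose (r+1)
(l+1) = multichoose r (l+1) + multichoose (r+1) l`, divided by the weight of the longer word. -/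
theorem defectEigenvalue_consAt {q : Fin k → ℕ} {i : Fin k} {r : ℕ} (hq : q i = r + 1)
    (j : Fin (n i)) (δ : Words n) :
    defectEigenvalue m (Function.update q i r) (consAt n i j δ) =
      defectEigenvalue m q (consAt n i j δ) - defectEigenvalue m q δ *
        (weight (m i) (δ i) / weight (m i) (j :: δ i)) := by
  classical
  have he : ∀ l ∈ Finset.univ.erase i,
      (Nat.multichoose (Function.update q i r l) (consAt n i j δ l).length : ℝ) /
        weight (m l) (consAt n i j δ l) =
      (Nat.multichoose (q l) (δ l).length : ℝ) / weight (m l) (δ l) := by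
    intro l hl
    have hl' := Finset.ne_of_mem_erase hl
    rw [Function.update_of_ne hl', consAt, Function.update_of_ne hl']
  have he' : ∀ l ∈ Finset.univ.erase i,
      (Nat.multichoose (q l) (consAt n i j δ l).length : ℝ) /
        weight (m l) (consAt n i j δ l) =
      (Nat.multichoose (q l) (δ l).length : ℝ) / weight (m l) (δ l) := by
    intro l hl
    rw [consAt, Function.update_of_ne (Finset.ne_of_mem_erase hl)]
  simp only [defectEigenvalue]
  rw [← Finset.mul_prod_erase _ _ (Finset.mem_univ i), Finset.prod_congr rfl he,
    ← Finset.mul_prod_erase Finset.univ (fun l => (Nat.multichoose (q l) (consAt n i j δ l).length : ℝ) /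
        weight (m l) (consAt n i j δ l)) (Finset.mem_univ i), Finset.prod_congr rfl he',
    ← Finset.mul_prod_erase Finset.univ (fun l => (Nat.multichoose (q l) (δ l).length : ℝ) /
        weight (m l) (δ l)) (Finset.mem_univ i)]
  have hb := (weight_pos (m i) (δ i)).ne'
  have hb' := (weight_pos (m i) (j :: δ i)).ne'
  have h1 : (Nat.multichoose (q i) ((δ i).length + 1) : ℝ) =
      Nat.multichoose r ((δ i).length + 1) + Nat.multichoose (q i) (δ i).length := by
    rw [hq, Nat.multichoose_succ_succ]
    push_cast; ring
  rw [Function.update_self, consAt, Function.update_self, List.length_cons, h1]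
  field_simp
  ring

/-- Each application of `id - Φ_{W_i}` lowers the `i`-th index of the eigenvalues by one. On basis
vectors whose `i`-th word is empty `Φ_{W_i}(Y)` vanishes, and the eigenvalue does not depend on that
index. -/
theorem IsDefectDiagonal.sub_cpMap {q : Fin k → ℕ} {Y : Fock n →L[ℂ] Fock n}
    (hY : IsDefectDiagonal m q Y) {i : Fin k} {r : ℕ} (hq : q i = r + 1) :
    IsDefectDiagonal m (Function.update q i r)
      (((1 : Module.End ℂ (Fock n →L[ℂ] Fock n)) - cpMap (model n m) i) Y) := by
  intro γ
  have h0 : (((1 : Module.End ℂ (Fock n →L[ℂ] Fock n)) - cpMap (model n m) i) Y) (basisVec n γ) =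
      Y (basisVec n γ) - cpMap (model n m) i Y (basisVec n γ) := rfl
  rw [h0, hY γ]
  rcases hγ : γ i with _ | ⟨j, l⟩
  · rw [cpMap_model_basisVec_of_nil i Y hγ, sub_zero, defectEigenvalue_update_nil hγ]
  · rw [consAt_eq_of_cons hγ, cpMap_model_basisVec_consAt i j (hY _), ← sub_smul,
      defectEigenvalue_consAt hq]
    push_cast
    rfl

theorem IsDefectDiagonal.pow {q : Fin k → ℕ} {Y : Fock n →L[ℂ] Fock n}
    (hY : IsDefectDiagonal m q Y) (i : Fin k) {p : ℕ} (hp : p ≤ q i) :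
    IsDefectDiagonal m (Function.update q i (q i - p))
      ((((1 : Module.End ℂ (Fock n →L[ℂ] Fock n)) - cpMap (model n m) i) ^ p) Y) := by
  induction p with
  | zero => simpa using hY
  | succ p ih =>
    have h := (ih (by omega)).sub_cpMap (i := i) (r := q i - (p + 1))
      (by rw [Function.update_self]; omega)
    rw [Function.update_idem] at h
    rw [pow_succ']
    exact h

theorem IsDefectDiagonal.list_prod {q p : Fin k → ℕ} {Y : Fock n →L[ℂ] Fock n}
    (hY : IsDefectDiagonal m q Y) (hp : p ≤ q) {l : List (Fin k)} (hl : l.Nodup) :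
    IsDefectDiagonal m (fun i => if i ∈ l then q i - p i else q i)
      ((l.map fun i => ((1 : Module.End ℂ (Fock n →L[ℂ] Fock n)) - cpMap (model n m) i) ^ p i).prod
        Y) := by
  induction l with
  | nil => simpa using hY
  | cons i l ih =>
    have hi := (List.nodup_cons.1 hl).1
    have h := (ih (List.nodup_cons.1 hl).2).pow i (p := p i) (by simpa [hi] using hp i)
    have e : (fun a => if a ∈ i :: l then q a - p a else q a) = Function.update
        (fun a => if a ∈ l then q a - p a else q a) i
          ((fun a => if a ∈ l then q a - p a else q a) i - p i) := by
      funext a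
      by_cases ha : a = i
      · subst ha; simp [hi]
      · simp [ha]
    rw [e, List.map_cons, List.prod_cons]
    exact h

theorem isPositive_of_diagonal {Y : Fock n →L[ℂ] Fock n} {d : Words n → ℝ} (hd : ∀ γ, 0 ≤ d γ)
    (hY : ∀ γ, Y (basisVec n γ) = (d γ : ℂ) • basisVec n γ) : Y.IsPositive := by
  classical
  have hcoord : ∀ (f : Fock n) (α : Words n), ⟪basisVec n α, f⟫_ℂ = f α := fun f α => by
    rw [basisVec, lp.inner_single_left]; simp
  have h1 : ∀ (x : Fock n) (α : Words n), Y x α = (d α : ℂ) * x α := by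
    intro x α
    have h : (innerSL ℂ (basisVec n α)).comp Y = (d α : ℂ) • innerSL ℂ (basisVec n α) := by
      refine clm_ext_basisVec fun γ => ?_
      rw [ContinuousLinearMap.comp_apply, innerSL_apply_apply, smul_apply, innerSL_apply_apply, hY,
        inner_smul_right, inner_basisVec, smul_eq_mul]
      split_ifs with h
      · rw [h]
      · simp
    have h2 := DFunLike.congr_fun h x
    rwa [ContinuousLinearMap.comp_apply, innerSL_apply_apply, smul_apply, innerSL_apply_apply,
      hcoord, hcoord, smul_eq_mul] at h2
  rw [ContinuousLinearMap.isPositive_iff_complex]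
  intro x
  have h2 : HasSum (fun α => ((d α * ‖x α‖ ^ 2 : ℝ) : ℂ)) ⟪Y x, x⟫_ℂ := by
    have h3 := lp.hasSum_inner (𝕜 := ℂ) (Y x) x
    have e : (fun α => ((d α * ‖x α‖ ^ 2 : ℝ) : ℂ)) = fun α => ⟪Y x α, x α⟫_ℂ := by
      funext α
      rw [h1, RCLike.inner_apply, map_mul, Complex.conj_ofReal, mul_left_comm, Complex.mul_conj]
      push_cast [Complex.normSq_eq_norm_sq]
      ring
    rw [e]
    exact h3
  have hre := Complex.hasSum_re h2
  have him := Complex.hasSum_im h2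
  simp only [Complex.ofReal_re, Complex.ofReal_im] at hre him
  have him0 := him.unique hasSum_zero
  refine ⟨?_, hre.nonneg fun α => mul_nonneg (hd α) (sq_nonneg _)⟩
  apply Complex.ext
  · simp
  · simp [him0]

/-- Starting from `I`, which has index `m`, the map `Δ_W^p` lowers the index to `m - p`. So
`Δ_W^p(I)` is diagonal with nonnegative entries. -/
theorem model_mem_polyHyperball (hm : ∀ i, 1 ≤ m i) :
    model n m ∈ polyHyperball n m (Fock n) := by
  refine ⟨fun p q hpq i j => model_commute hpq i j, fun p hp => ?_⟩
  have h := (isDefectDiagonal_one (n := n) hm).list_prod hp (List.nodup_finRange k)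
  rw [defectMap, List.ofFn_eq_map]
  exact isPositive_of_diagonal (fun γ => defectEigenvalue_nonneg _ γ) h

end ModelHyperball

/-! ### Matrix entries of the homogeneous terms at the universal model -/

section Entries

variable {k : ℕ} {n m : Fin k → ℕ}

theorem wordOp_model_basisVec (i : Fin k) (α : List (Fin (n i))) (γ : Words n) :
    wordOp (model n m i) α (basisVec n γ) =
      ((Real.sqrt (weight (m i) (γ i) / weight (m i) (α ++ γ i)) : ℝ) : ℂ) •
        basisVec n (Function.update γ i (α ++ γ i)) := by
  induction α with
  | nil => simp [wordOp, div_self (weight_pos (m i) (γ i)).ne']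
  | cons j α ih =>
    have h : wordOp (model n m i) (j :: α) = model n m i j * wordOp (model n m i) α := by
      simp [wordOp]
    rw [h, mul_apply_eq_comp, ih, map_smul, model_basisVec, smul_smul, consAt, Function.update_self,
      Function.update_idem, ← Complex.ofReal_mul, ← Real.sqrt_mul (div_nonneg (weight_pos _ _).le
      (weight_pos _ _).le), div_mul_div_cancel₀ (weight_pos _ _).ne']
    rfl

/-- The coefficient of `e_{αγ}` in `W_α e_γ`. -/
def modelCoeff (m : Fin k → ℕ) (α γ : Words n) : ℝ :=
  ∏ i, Real.sqrt (weight (m i) (γ i) / weight (m i) (α i ++ γ i))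

theorem list_prod_wordOp_model_basisVec (α γ : Words n) {l : List (Fin k)} (hl : l.Nodup) :
    (l.map fun i => wordOp (model n m i) (α i)).prod (basisVec n γ) =
      (((l.map fun i => Real.sqrt (weight (m i) (γ i) / weight (m i) (α i ++ γ i))).prod : ℝ) : ℂ) •
        basisVec n (fun i => if i ∈ l then α i ++ γ i else γ i) := by
  induction l with
  | nil => simp
  | cons i l ih =>
    have hi := (List.nodup_cons.1 hl).1
    rw [List.map_cons, List.prod_cons, mul_apply_eq_comp, ih (List.nodup_cons.1 hl).2, map_smul,
      wordOp_model_basisVec, smul_smul, List.map_cons, List.prod_cons, ← Complex.ofReal_mul,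
      mul_comm]
    simp only [if_neg hi]
    congr 2
    funext a
    by_cases ha : a = i
    · subst ha; simp
    · simp [ha]

theorem multiOp_model_basisVec (α γ : Words n) :
    multiOp (model n m) α (basisVec n γ) =
      (modelCoeff m α γ : ℂ) • basisVec n (fun i => α i ++ γ i) := by
  rw [multiOp, List.ofFn_eq_map, list_prod_wordOp_model_basisVec α γ (List.nodup_finRange k),
    modelCoeff, Fin.prod_univ_def]
  simp

theorem append_injective (α : Words n) {δ δ' : Words n}
    (h : (fun i => α i ++ δ i) = fun i => α i ++ δ' i) : δ = δ' :=
  funext fun i => List.append_cancel_left (congrFun h i)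

theorem star_multiOp_model_append (α δ : Words n) :
    star (multiOp (model n m) α) (basisVec n (fun i => α i ++ δ i)) =
      (modelCoeff m α δ : ℂ) • basisVec n δ := by
  classical
  refine ext_inner_basisVec fun ε => ?_
  rw [ContinuousLinearMap.star_eq_adjoint, ContinuousLinearMap.adjoint_inner_right,
    multiOp_model_basisVec, inner_smul_left, inner_smul_right, inner_basisVec, inner_basisVec,
    Complex.conj_ofReal]
  by_cases h : ε = δ
  · subst h; simp
  · rw [if_neg h, if_neg fun e => h (append_injective α e), mul_zero, mul_zero]

theorem star_multiOp_model_of_ne (α ω : Words n) (h : ∀ δ : Words n, ω ≠ fun i => α i ++ δ i) :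
    star (multiOp (model n m) α) (basisVec n ω) = 0 := by
  classical
  refine ext_inner_basisVec fun ε => ?_
  rw [ContinuousLinearMap.star_eq_adjoint, ContinuousLinearMap.adjoint_inner_right,
    multiOp_model_basisVec, inner_smul_left, inner_basisVec, if_neg fun e => h ε e.symm, mul_zero,
    inner_zero_right]

theorem rdiff_append_left {d : ℕ} (α δ : List (Fin d)) : rdiff (α ++ δ) δ = α := by
  simp [rdiff]

theorem rdiff_append_right {d : ℕ} (α δ : List (Fin d)) : rdiff δ (α ++ δ) = [] := by
  rw [rdiff]
  split_ifs
  · simp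
  · rfl

/-- The shorter of two comparable words is their common right end `δ`, and at least one of the two
remainders is empty. In this form `W_α W_β^*` can be evaluated directly. -/
theorem exists_of_comparable {d : ℕ} {ω γ : List (Fin d)} (h : γ <:+ ω ∨ ω <:+ γ) :
    ∃ δ, ω = rdiff ω γ ++ δ ∧ γ = rdiff γ ω ++ δ ∧ (rdiff ω γ = [] ∨ rdiff γ ω = []) := by
  rcases h with ⟨α, rfl⟩ | ⟨α, rfl⟩
  · exact ⟨γ, by rw [rdiff_append_left], by rw [rdiff_append_right]; rfl,
      Or.inr (rdiff_append_right _ _)⟩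
  · exact ⟨ω, by rw [rdiff_append_right]; rfl, by rw [rdiff_append_left],
      Or.inl (rdiff_append_right _ _)⟩

theorem rdiff_append_append {d : ℕ} {α β : List (Fin d)} (h : α = [] ∨ β = []) (δ : List (Fin d)) :
    rdiff (α ++ δ) (β ++ δ) = α ∧ rdiff (β ++ δ) (α ++ δ) = β ∧
      ((β ++ δ) <:+ (α ++ δ) ∨ (α ++ δ) <:+ (β ++ δ)) := by
  rcases h with rfl | rfl
  · exact ⟨rdiff_append_right _ _, rdiff_append_left _ _, Or.inr (List.suffix_append _ _)⟩
  · exact ⟨rdiff_append_left _ _, rdiff_append_right _ _, Or.inl (List.suffix_append _ _)⟩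

/-- As `α` or `β` is empty, one of the two factors on the left is `1`. If `α` is empty and `β δ` is
nevertheless a suffix of `δ`, then `β` is empty too and the two branches agree. -/
theorem tau_factor {d r : ℕ} {α β : List (Fin d)} (h : α = [] ∨ β = []) (δ : List (Fin d)) :
    Real.sqrt (weight r δ / weight r (α ++ δ)) * Real.sqrt (weight r δ / weight r (β ++ δ)) =
      Real.sqrt (weight r (if (β ++ δ) <:+ (α ++ δ) then β ++ δ else α ++ δ) /
        weight r (if (β ++ δ) <:+ (α ++ δ) then α ++ δ else β ++ δ)) := by
  have h1 : Real.sqrt (weight r δ / weight r δ) = 1 := by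
    rw [div_self (weight_pos r δ).ne', Real.sqrt_one]
  rcases h with rfl | rfl
  · rw [List.nil_append, h1, one_mul]
    split_ifs with hs
    · have : β = [] := by
        have := hs.length_le
        rw [List.length_append] at this
        exact List.eq_nil_of_length_eq_zero (by omega)
      subst this
      rfl
    · rfl
  · rw [List.nil_append, h1, mul_one, if_pos (List.suffix_append _ _),
      if_pos (List.suffix_append _ _)]

theorem modelCoeff_mul {α β : Words n} (h : ∀ i, α i = [] ∨ β i = []) (δ : Words n) :
    modelCoeff m α δ * modelCoeff m β δ =
      tau m (fun i => α i ++ δ i) (fun i => β i ++ δ i) := by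
  rw [modelCoeff, modelCoeff, ← Finset.prod_mul_distrib, tau]
  exact Finset.prod_congr rfl fun i _ => tau_factor (h i) (δ i)

open Classical in
-- `W_α W_β^*` sends `e_{βδ}` to a multiple of `e_{αδ}` and kills the other basis vectors. For a
-- reduced pair `(α, β)` the simplification of `(αδ, βδ)` is again `(α, β)`, so an entry is nonzero
-- only where the pair is the simplification of `(ω, γ)`.
theorem inner_multiOp_model {α β : Words n} (h : ∀ i, α i = [] ∨ β i = []) (ω γ : Words n) :
    ⟪basisVec n ω, (multiOp (model n m) α * star (multiOp (model n m) β)) (basisVec n γ)⟫_ℂ =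
      if Comparable ω γ ∧ (α = fun i => rdiff (ω i) (γ i)) ∧ (β = fun i => rdiff (γ i) (ω i))
      then (tau m ω γ : ℂ) else 0 := by
  rw [mul_apply_eq_comp, ← ContinuousLinearMap.adjoint_inner_left,
    ← ContinuousLinearMap.star_eq_adjoint]
  split_ifs with hc
  · obtain ⟨hc, hα, hβ⟩ := hc
    choose δ hω hγ _ using fun i => exists_of_comparable (hc i)
    have hω' : ω = fun i => α i ++ δ i := funext fun i => by
      rw [congrFun hα i]; exact hω i
    have hγ' : γ = fun i => β i ++ δ i := funext fun i => by
      rw [congrFun hβ i]; exact hγ i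
    clear hα hβ hω hγ
    subst hω' hγ'
    rw [star_multiOp_model_append, star_multiOp_model_append, inner_smul_left, inner_smul_right,
      inner_basisVec, if_pos rfl, ← modelCoeff_mul h, Complex.conj_ofReal]
    push_cast
    ring
  · by_cases h1 : ∃ δ : Words n, ω = fun i => α i ++ δ i
    · obtain ⟨δ, rfl⟩ := h1
      by_cases h2 : ∃ δ' : Words n, γ = fun i => β i ++ δ' i
      · obtain ⟨δ', rfl⟩ := h2
        rw [star_multiOp_model_append, star_multiOp_model_append, inner_smul_left,
          inner_smul_right, inner_basisVec, if_neg, mul_zero, mul_zero]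
        rintro rfl
        exact hc ⟨fun i => (rdiff_append_append (h i) _).2.2,
          funext fun i => (rdiff_append_append (h i) _).1.symm,
          funext fun i => (rdiff_append_append (h i) _).2.1.symm⟩
      · rw [star_multiOp_model_of_ne β γ fun δ' e => h2 ⟨δ', e⟩, inner_zero_right]
    · rw [star_multiOp_model_of_ne α ω fun δ e => h1 ⟨δ, e⟩, inner_zero_left]

/-- The difference `|ω| - |γ|` of the multi-lengths. -/
def lengthDiff (ω γ : Words n) (i : Fin k) : ℤ := (ω i).length - (γ i).length

theorem length_rdiff {d : ℕ} {ω γ : List (Fin d)} (h : γ <:+ ω ∨ ω <:+ γ) :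
    (rdiff ω γ).length = ((ω.length : ℤ) - γ.length).toNat := by
  rcases h with ⟨α, rfl⟩ | ⟨α, rfl⟩
  · rw [rdiff_append_left, List.length_append]; omega
  · rw [rdiff_append_right, List.length_append]; simp

variable {K : Type*} [NormedAddCommGroup K] [InnerProductSpace ℂ K]

open Classical in
/-- The matrix entry of a weighted multi-Toeplitz operator with coefficients `A`. -/
def toeplitzEntry (m : Fin k → ℕ) (A : Words n → Words n → (K →L[ℂ] K)) (ω γ : Words n) (x y : K) :
    ℂ :=
  if Comparable ω γ then
    (tau m ω γ : ℂ) * ⟪y, A (fun i => rdiff (ω i) (γ i)) (fun i => rdiff (γ i) (ω i)) x⟫_ℂ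
  else 0

/-- For comparable `ω, γ` a single pair `(α, β)` can contribute, namely their simplification, and
its lengths force `s = |ω| - |γ|`. Thus `q_s(W, W^*)` carries the `s`-th diagonal of the Toeplitz
matrix with coefficients `A`. -/
theorem inner_homTerm_model (A : Words n → Words n → (K →L[ℂ] K))
    (s : Fin k → ℤ) (ω γ : Words n) (x y : K) :
    ⟪hTmul y (basisVec n ω), homTerm A (model n m) s (hTmul x (basisVec n γ))⟫_ℂ =
      if s = lengthDiff ω γ then toeplitzEntry m A ω γ x y else 0 := by
  classical
  have hterm : ∀ (α : ∀ i, List.Vector (Fin (n i)) (s i).toNat)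
      (β : ∀ i, List.Vector (Fin (n i)) (-s i).toNat),
      ⟪hTmul y (basisVec n ω), hMap (A (fun i => (α i).toList) (fun i => (β i).toList))
        (multiOp (model n m) (fun i => (α i).toList) *
          multiOpStar (model n m) (fun i => (β i).toList)) (hTmul x (basisVec n γ))⟫_ℂ =
      if Comparable ω γ ∧ ((fun i => (α i).toList) = fun i => rdiff (ω i) (γ i)) ∧
        ((fun i => (β i).toList) = fun i => rdiff (γ i) (ω i)) then
        toeplitzEntry m A ω γ x y else 0 := by
    intro α β
    -- One of `s_i^+`, `s_i^-` is zero, so every pair occurring in `homTerm` is reduced.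
    have hnil : ∀ i, (α i).toList = [] ∨ (β i).toList = [] := by
      intro i
      rcases le_total (s i) 0 with h | h
      · left; apply List.eq_nil_of_length_eq_zero; rw [List.Vector.toList_length]; omega
      · right; apply List.eq_nil_of_length_eq_zero; rw [List.Vector.toList_length]; omega
    rw [hMap_hTmul, hTensor_inner, multiOpStar_eq_star (fun p q hpq => model_commute hpq),
      inner_multiOp_model hnil]
    split_ifs with h
    · rw [toeplitzEntry, if_pos h.1, h.2.1, h.2.2, mul_comm]
    · rw [mul_zero]
  simp only [homTerm, sum_apply, inner_sum, hterm]
  by_cases hC : Comparable ω γ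
  swap
  · simp [hC, toeplitzEntry]
  by_cases hs : s = lengthDiff ω γ
  · rw [if_pos hs]
    have hα : ∀ i, (rdiff (ω i) (γ i)).length = (s i).toNat := fun i => by
      rw [length_rdiff (hC i), hs]; rfl
    have hβ : ∀ i, (rdiff (γ i) (ω i)).length = (-s i).toNat := fun i => by
      rw [length_rdiff (hC i).symm, hs]; congr 1; simp [lengthDiff]
    let α₀ : ∀ i, List.Vector (Fin (n i)) (s i).toNat := fun i => ⟨rdiff (ω i) (γ i), hα i⟩
    let β₀ : ∀ i, List.Vector (Fin (n i)) (-s i).toNat := fun i => ⟨rdiff (γ i) (ω i), hβ i⟩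
    rw [Fintype.sum_eq_single α₀, Fintype.sum_eq_single β₀]
    · rw [if_pos ⟨hC, rfl, rfl⟩]
    · intro β hne
      refine if_neg fun h => hne (funext fun i => Subtype.ext (congrFun h.2.2 i))
    · intro α hne
      refine Finset.sum_eq_zero fun β _ => if_neg fun h =>
        hne (funext fun i => Subtype.ext (congrFun h.2.1 i))
  · rw [if_neg hs]
    refine Finset.sum_eq_zero fun α _ => Finset.sum_eq_zero fun β _ => if_neg fun h => hs ?_
    funext i
    have h1 := congrArg List.length (congrFun h.2.1 i)
    have h2 := congrArg List.length (congrFun h.2.2 i)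
    rw [List.Vector.toList_length, length_rdiff (hC i)] at h1
    rw [List.Vector.toList_length, length_rdiff (hC i).symm] at h2
    rw [lengthDiff]
    omega

end Entries

/-! ### Multi-homogeneous expansion of the Berezin transform -/

section Blocks

variable {k : ℕ} {n m : Fin k → ℕ}
variable {E : Type*} [NormedAddCommGroup E] [InnerProductSpace ℂ E] [CompleteSpace E]

/-- The tuple of the lengths of the words. -/
def lengths (β : Words n) (i : Fin k) : ℕ := (β i).length

open Classical in
variable (n) in
/-- The projection on the span of the `e_β` with `|β_i| = a_i`. -/
def blockProj (a : Fin k → ℕ) : Fock n →L[ℂ] Fock n :=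
  diagOp n (fun β => if lengths β = a then 1 else 0) fun β => by split_ifs <;> simp

theorem blockProj_basisVec (a : Fin k → ℕ) (β : Words n) [Decidable (lengths β = a)] :
    blockProj n a (basisVec n β) = if lengths β = a then basisVec n β else 0 := by
  rw [blockProj, diagOp_basisVec]
  split_ifs <;> simp

theorem adjoint_blockProj (a : Fin k → ℕ) :
    ContinuousLinearMap.adjoint (blockProj n a) = blockProj n a := by
  classical
  refine clm_ext_basisVec fun γ => ext_inner_basisVec fun ω => ?_
  rw [ContinuousLinearMap.adjoint_inner_right, blockProj_basisVec, blockProj_basisVec]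
  by_cases h : ω = γ
  · subst h
    split_ifs
    · rfl
    · rw [inner_zero_left, inner_zero_right]
  · split_ifs <;> simp [inner_basisVec, h]

variable (m) in
/-- The part of the Berezin kernel in the block `a`. -/
def kernelBlock (X : OpTuple n E) (a : Fin k → ℕ) : E →L[ℂ] HTensor (Fock n) E :=
  (hMap (blockProj n a) (ContinuousLinearMap.id ℂ E)).comp (berezinKernel m X)

theorem inner_basisVec_kernelBlock (hm : ∀ i, 1 ≤ m i) {X : OpTuple n E} (hX : X ∈ radial n m E)
    (a : Fin k → ℕ) (γ : Words n) (y h : E) [Decidable (lengths γ = a)] :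
    ⟪hTmul (basisVec n γ) y, kernelBlock m X a h⟫_ℂ =
      if lengths γ = a then ⟪y, kernelCoeff m X h γ⟫_ℂ else 0 := by
  rw [kernelBlock, ContinuousLinearMap.comp_apply, ← ContinuousLinearMap.adjoint_inner_left,
    hMap_adjoint, adjoint_blockProj, hMap_hTmul, ContinuousLinearMap.adjoint_id, blockProj_basisVec]
  split_ifs with h1
  · exact inner_basisVec_berezinKernel hm hX γ y h
  · have : hTmul (0 : Fock n) (ContinuousLinearMap.id ℂ E y) = 0 := by
      rw [← hTmulRight_apply, map_zero]
    rw [this, inner_zero_left]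

theorem kernelBlock_apply (hm : ∀ i, 1 ≤ m i) {X : OpTuple n E} (hX : X ∈ radial n m E)
    (a : Fin k → ℕ) (h : E) : kernelBlock m X a h =
      ∑ v : ∀ i, List.Vector (Fin (n i)) (a i),
        basisTmul n E (wordsEquiv ⟨a, v⟩) (kernelCoeff m X h (wordsEquiv ⟨a, v⟩)) := by
  classical
  refine ext_inner_basisVec_left fun γ y => ?_
  rw [inner_basisVec_kernelBlock hm hX, inner_sum]
  simp only [basisTmul_apply, hTensor_inner, inner_basisVec]
  have hlen : ∀ v : ∀ i, List.Vector (Fin (n i)) (a i), lengths (wordsEquiv (n := n) ⟨a, v⟩) = a :=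
    fun v => funext fun i => (v i).toList_length
  split_ifs with h1
  · subst h1
    let v₀ : ∀ i, List.Vector (Fin (n i)) (lengths γ i) := fun i => ⟨γ i, rfl⟩
    rw [Fintype.sum_eq_single v₀]
    · have : wordsEquiv (n := n) ⟨lengths γ, v₀⟩ = γ := rfl
      rw [this, if_pos rfl, one_mul]
    · intro v hv
      rw [if_neg, zero_mul]
      intro e
      exact hv (funext fun i => Subtype.ext (congrFun e i).symm)
  · refine (Finset.sum_eq_zero fun v _ => ?_).symm
    rw [if_neg, zero_mul]
    rintro rfl
    exact h1 (hlen v)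

/-- Includes the exponent `0` and the zero space, where only `‖1‖ ≤ 1` holds. -/
theorem norm_clm_pow_le {V : Type*} [NormedAddCommGroup V] [NormedSpace ℂ V] (f : V →L[ℂ] V)
    (l : ℕ) : ‖f ^ l‖ ≤ ‖f‖ ^ l := by
  induction l with
  | zero => rw [pow_zero, pow_zero]; exact ContinuousLinearMap.norm_id_le
  | succ l ih =>
    rw [pow_succ, pow_succ]
    exact (norm_mul_le _ _).trans (mul_le_mul_of_nonneg_right ih (norm_nonneg _))

theorem norm_prod_ofFn_le {V : Type*} [NormedAddCommGroup V] [NormedSpace ℂ V] {k : ℕ}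
    {f : Fin k → (V →L[ℂ] V)} {c : Fin k → ℝ} (h : ∀ i, ‖f i‖ ≤ c i) :
    ‖(List.ofFn f).prod‖ ≤ ∏ i, c i := by
  induction k with
  | zero =>
    rw [List.ofFn_zero, List.prod_nil, Finset.univ_eq_empty, Finset.prod_empty]
    exact ContinuousLinearMap.norm_id_le
  | succ k ih =>
    rw [prod_ofFn_succ, Fin.prod_univ_succ]
    exact (norm_mul_le _ _).trans (mul_le_mul (h 0) (ih fun i => h i.succ) (norm_nonneg _)
      ((norm_nonneg _).trans (h 0)))

/-- By orthogonality `‖K_a h‖ ^ 2` is `b_a ⟪Φ^a(Δ) h, h⟫`, and `‖Φ^a‖ ≤ ∏ r^{2 a_i}`. The bound is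
not sharp in the weight; it only has to be summable over `a`. -/
theorem norm_kernelBlock_le (hm : ∀ i, 1 ≤ m i) {X : OpTuple n E} (hX : X ∈ radial n m E)
    {r : ℝ} (h0 : 0 ≤ r) (hr : ∀ i, ‖cpMapL X i‖ ≤ r ^ 2) (a : Fin k → ℕ) :
    ‖kernelBlock m X a‖ ≤
      Real.sqrt ‖defectMap X m 1‖ * (lengthWeight m a * ∏ i, r ^ a i) := by
  have hw := lengthWeight_nonneg (m := m) a
  have hp : 0 ≤ ∏ i, r ^ a i := Finset.prod_nonneg fun i _ => pow_nonneg h0 _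
  refine ContinuousLinearMap.opNorm_le_bound _ (by positivity) fun h => ?_
  have h1 : ‖kernelBlock m X a h‖ ^ 2 =
      ∑ v : ∀ i, List.Vector (Fin (n i)) (a i), ‖kernelCoeff m X h (wordsEquiv ⟨a, v⟩)‖ ^ 2 := by
    rw [kernelBlock_apply hm hX]
    have hJ := (orthogonalFamily_basisTmul (n := n) (E := E)).comp
      (f := fun v : ∀ i, List.Vector (Fin (n i)) (a i) => wordsEquiv (n := n) ⟨a, v⟩)
      (fun v v' e => by
        have := wordsEquiv.injective e
        simpa using this)
    exact hJ.norm_sum (fun v => kernelCoeff m X h (wordsEquiv ⟨a, v⟩)) Finset.univ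
  rw [sum_norm_kernelCoeff_sq m (radial_commute hX) (radial_isPositive_defectMap hX)] at h1
  have h2 : ‖(List.ofFn fun i => cpMap X i ^ a i).prod (defectMap X m 1)‖ ≤
      (∏ i, r ^ a i) ^ 2 * ‖defectMap X m 1‖ := by
    rw [← prod_cpMapL_pow_apply, ← Finset.prod_pow]
    refine (ContinuousLinearMap.le_opNorm _ _).trans
      (mul_le_mul_of_nonneg_right ?_ (norm_nonneg _))
    refine norm_prod_ofFn_le fun i => ?_
    rw [← pow_mul, mul_comm, pow_mul]
    exact (norm_clm_pow_le _ _).trans (pow_le_pow_left₀ (norm_nonneg _) (hr i) _)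
  have h3 : ‖kernelBlock m X a h‖ ^ 2 ≤
      (Real.sqrt ‖defectMap X m 1‖ * (lengthWeight m a * ∏ i, r ^ a i) * ‖h‖) ^ 2 := by
    rw [h1]
    refine (Complex.re_le_norm _).trans ((norm_inner_le_norm _ _).trans ?_)
    have h4 : ‖((lengthWeight m a : ℂ) • (List.ofFn fun i => cpMap X i ^ a i).prod
        (defectMap X m 1)) h‖ ≤
        lengthWeight m a * ((∏ i, r ^ a i) ^ 2 * ‖defectMap X m 1‖) * ‖h‖ := by
      refine (ContinuousLinearMap.le_opNorm _ _).trans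
        (mul_le_mul_of_nonneg_right ?_ (norm_nonneg _))
      rw [norm_smul, Complex.norm_real, Real.norm_eq_abs, abs_of_nonneg hw]
      exact mul_le_mul_of_nonneg_left h2 hw
    refine (mul_le_mul_of_nonneg_right h4 (norm_nonneg _)).trans ?_
    -- As the weight is at least `1`, its square root may be replaced by the weight itself in the
    -- final bound.
    have h5 : lengthWeight m a ≤ lengthWeight m a ^ 2 := by
      have := one_le_lengthWeight (m := m) a
      nlinarith
    calc lengthWeight m a * ((∏ i, r ^ a i) ^ 2 * ‖defectMap X m 1‖) * ‖h‖ * ‖h‖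
        = lengthWeight m a * ((∏ i, r ^ a i) ^ 2 * ‖defectMap X m 1‖ * ‖h‖ ^ 2) := by ring
      _ ≤ lengthWeight m a ^ 2 * ((∏ i, r ^ a i) ^ 2 * ‖defectMap X m 1‖ * ‖h‖ ^ 2) :=
        mul_le_mul_of_nonneg_right h5 (by positivity)
      _ = _ := by
        rw [mul_pow, mul_pow, mul_pow, Real.sq_sqrt (norm_nonneg _)]
        ring
  exact (sq_le_sq₀ (norm_nonneg _) (by positivity)).1 h3

theorem summable_lengthWeight (hm : ∀ i, 1 ≤ m i) {r : ℝ} (h0 : 0 ≤ r) (h1 : r < 1) :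
    Summable fun a : Fin k → ℕ => lengthWeight m a * ∏ i, r ^ a i := by
  have h : ∀ i, Summable fun l : ℕ => ((l + m i - 1).choose (m i - 1) : ℝ) * r ^ l := fun i => by
    have := (hasSum_choose_mul_geometric_of_norm_lt_one' (m i - 1)
      (r := r) (by rwa [Real.norm_eq_abs, abs_of_nonneg h0])).summable
    simpa only [Nat.add_sub_assoc (hm i)] using this
  have h2 := (hasSum_prod_ofFn (fun i => (h i).norm) (fun i => (h i).hasSum)).2.summable
  refine h2.congr fun a => ?_
  rw [List.prod_ofFn, lengthWeight, Finset.prod_mul_distrib]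

/-- Summing over words gives the kernel strongly only; collecting words of equal length and using
the radial margin `r < 1` gives absolute convergence in operator norm, as the norm-convergent
expansion requires. -/
theorem summable_norm_kernelBlock (hm : ∀ i, 1 ≤ m i) {X : OpTuple n E} (hX : X ∈ radial n m E) :
    Summable fun a : Fin k → ℕ => ‖kernelBlock m X a‖ := by
  obtain ⟨r, h0, h1, hr⟩ := radial_norm_cpMapL hm hX
  exact Summable.of_nonneg_of_le (fun _ => norm_nonneg _)
    (norm_kernelBlock_le hm hX h0 hr) ((summable_lengthWeight hm h0 h1).mul_left _)

theorem hasSum_kernelBlock (hm : ∀ i, 1 ≤ m i) {X : OpTuple n E} (hX : X ∈ radial n m E) :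
    HasSum (kernelBlock m X) (berezinKernel m X) := by
  classical
  have hs := (summable_norm_kernelBlock hm hX).of_norm.hasSum
  have : ∑' a, kernelBlock m X a = berezinKernel m X := by
    ext1 h
    refine ext_inner_basisVec_left fun γ y => ?_
    have h1 := (hs.mapL (ContinuousLinearMap.apply ℂ (HTensor (Fock n) E) h)).mapL
      (innerSL ℂ (hTmul (basisVec n γ) y))
    simp only [ContinuousLinearMap.apply_apply, innerSL_apply_apply,
      inner_basisVec_kernelBlock hm hX] at h1
    rw [inner_basisVec_berezinKernel hm hX]
    refine h1.unique ?_
    have h2 := hasSum_single (f := fun a => if lengths γ = a then ⟪y, kernelCoeff m X h γ⟫_ℂ else 0)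
      (lengths γ) fun a ha => if_neg ha.symm
    simpa using h2
  rw [← this]
  exact hs

variable {K : Type*} [NormedAddCommGroup K] [InnerProductSpace ℂ K]

variable (K) in
/-- The projection `I_K ⊗ P_a`. -/
def ampProj (a : Fin k → ℕ) : HTensor K (Fock n) →L[ℂ] HTensor K (Fock n) :=
  hMap (ContinuousLinearMap.id ℂ K) (blockProj n a)

theorem adjoint_hMap_ampProj [CompleteSpace K] (a : Fin k → ℕ) :
    ContinuousLinearMap.adjoint (hMap (ampProj (n := n) K a) (ContinuousLinearMap.id ℂ E)) =
      hMap (ampProj K a) (ContinuousLinearMap.id ℂ E) := by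
  rw [hMap_adjoint, ampProj, hMap_adjoint, adjoint_blockProj, ContinuousLinearMap.adjoint_id,
    ContinuousLinearMap.adjoint_id]

theorem ampL_kernelBlock (X : OpTuple n E) (a : Fin k → ℕ) :
    ampL K (kernelBlock m X a) = (hMap (ampProj K a) (ContinuousLinearMap.id ℂ E)).comp
      (ampL K (berezinKernel m X)) :=
  ampL_comp_left _ _

theorem adjoint_comp_sandwich {U V : Type*} [NormedAddCommGroup U] [InnerProductSpace ℂ U]
    [CompleteSpace U] [NormedAddCommGroup V] [InnerProductSpace ℂ V] [CompleteSpace V]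
    (R : U →L[ℂ] V) {P : V →L[ℂ] V} (hP : ContinuousLinearMap.adjoint P = P) (M Q : V →L[ℂ] V) :
    (ContinuousLinearMap.adjoint R).comp ((P.comp (M.comp Q)).comp R) =
      (ContinuousLinearMap.adjoint (P.comp R)).comp (M.comp (Q.comp R)) := by
  rw [ContinuousLinearMap.adjoint_comp, hP]
  rfl

theorem hMap_id_comp_three {G : Type*} [NormedAddCommGroup G] [InnerProductSpace ℂ G]
    (a b c : G →L[ℂ] G) :
    hMap (a.comp (b.comp c)) (ContinuousLinearMap.id ℂ E) =
      (hMap a (ContinuousLinearMap.id ℂ E)).comp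
        ((hMap b (ContinuousLinearMap.id ℂ E)).comp (hMap c (ContinuousLinearMap.id ℂ E))) := by
  rw [hMap_comp, hMap_comp]
  rfl

theorem berezin_block [CompleteSpace K] (X : OpTuple n E) (a b : Fin k → ℕ)
    (g : HTensor K (Fock n) →L[ℂ] HTensor K (Fock n)) :
    berezin m X ((ampProj K a).comp (g.comp (ampProj K b))) =
      (ContinuousLinearMap.adjoint (ampL K (kernelBlock m X a))).comp
        ((hMap g (ContinuousLinearMap.id ℂ E)).comp (ampL K (kernelBlock m X b))) := by
  rw [berezin_eq, hMap_id_comp_three, ampL_kernelBlock, ampL_kernelBlock]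
  exact adjoint_comp_sandwich _ (adjoint_hMap_ampProj a) _ _

/-- Absolute summability makes the double family summable; its value is then found by summing first
over the right index and next over the left one. -/
theorem hasSum_sandwich {U V ι : Type*} [NormedAddCommGroup U] [InnerProductSpace ℂ U]
    [CompleteSpace U] [NormedAddCommGroup V] [InnerProductSpace ℂ V] [CompleteSpace V]
    {R : ι → (U →L[ℂ] V)} {R₀ : U →L[ℂ] V} (hn : Summable fun a => ‖R a‖) (hR : HasSum R R₀)
    (g : V →L[ℂ] V) :
    HasSum (fun p : ι × ι => (ContinuousLinearMap.adjoint (R p.1)).comp (g.comp (R p.2)))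
      ((ContinuousLinearMap.adjoint R₀).comp (g.comp R₀)) := by
  have hs : Summable fun p : ι × ι =>
      (ContinuousLinearMap.adjoint (R p.1)).comp (g.comp (R p.2)) := by
    have h1 : Summable fun p : ι × ι => ‖R p.1‖ * (‖g‖ * ‖R p.2‖) :=
      hn.mul_of_nonneg (hn.mul_left _) (fun _ => norm_nonneg _) (fun _ => by positivity)
    refine Summable.of_norm_bounded h1 fun p => ?_
    refine (ContinuousLinearMap.opNorm_comp_le _ _).trans ?_
    rw [LinearIsometryEquiv.norm_map]
    exact mul_le_mul_of_nonneg_left (ContinuousLinearMap.opNorm_comp_le _ _) (norm_nonneg _)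
  have h1 : ∀ a, HasSum (fun b => (ContinuousLinearMap.adjoint (R a)).comp (g.comp (R b)))
      ((ContinuousLinearMap.adjoint (R a)).comp (g.comp R₀)) := fun a =>
    (hR.mapL (ContinuousLinearMap.compL ℂ U V V g)).mapL
      (ContinuousLinearMap.compL ℂ U V U (ContinuousLinearMap.adjoint (R a)))
  have h2 : HasSum (fun a => ContinuousLinearMap.adjoint (R a)) (ContinuousLinearMap.adjoint R₀) :=
    hR.map (ContinuousLinearMap.adjoint : (U →L[ℂ] V) ≃ₗᵢ⋆[ℂ] (V →L[ℂ] U))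
      (LinearIsometryEquiv.continuous _)
  have h3 : HasSum (fun a => (ContinuousLinearMap.adjoint (R a)).comp (g.comp R₀))
      ((ContinuousLinearMap.adjoint R₀).comp (g.comp R₀)) :=
    h2.mapL ((ContinuousLinearMap.compL ℂ U V U).flip (g.comp R₀))
  have h4 := hs.hasSum.prod_fiberwise h1
  rw [h3.unique h4]
  exact hs.hasSum

theorem hasSum_berezin_block [CompleteSpace K] (hm : ∀ i, 1 ≤ m i) {X : OpTuple n E}
    (hX : X ∈ radial n m E) (g : HTensor K (Fock n) →L[ℂ] HTensor K (Fock n)) :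
    HasSum (fun p : (Fin k → ℕ) × (Fin k → ℕ) =>
      berezin m X ((ampProj K p.1).comp (g.comp (ampProj K p.2)))) (berezin m X g) := by
  simp only [berezin_block]
  have hn : Summable fun a => ‖ampL K (kernelBlock m X a)‖ :=
    Summable.of_nonneg_of_le (fun _ => norm_nonneg _) (fun a => norm_ampL_le _)
      (summable_norm_kernelBlock hm hX)
  exact hasSum_sandwich hn ((hasSum_kernelBlock hm hX).mapL (ampL K)) _

end Blocks

/-! ### The Berezin transform of a Toeplitz operator as a sum of homogeneous terms -/

section Expansion

variable {k : ℕ} {n m : Fin k → ℕ}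
variable {E : Type*} [NormedAddCommGroup E] [InnerProductSpace ℂ E] [CompleteSpace E]
variable {K : Type*} [NormedAddCommGroup K] [InnerProductSpace ℂ K] [CompleteSpace K]

theorem homTerm_eq_berezin (hm : ∀ i, 1 ≤ m i) {X : OpTuple n E} (hX : X ∈ radial n m E)
    (A : Words n → Words n → (K →L[ℂ] K)) (s : Fin k → ℤ) :
    homTerm A X s = berezin m X (homTerm A (model n m) s) := by
  rw [← berezinL_apply, homTerm, homTerm]
  simp only [map_sum, berezinL_apply]
  refine Finset.sum_congr rfl fun α _ => Finset.sum_congr rfl fun β _ => ?_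
  rw [← berezin_hMap_multiOp hm hX, multiOpStar_eq_star (fun p q hpq => model_commute hpq)]

theorem inner_block (g : HTensor K (Fock n) →L[ℂ] HTensor K (Fock n)) (a b : Fin k → ℕ)
    (ω γ : Words n) (x y : K) [Decidable (lengths ω = a ∧ lengths γ = b)] :
    ⟪hTmul y (basisVec n ω), (ampProj K a).comp (g.comp (ampProj K b))
      (hTmul x (basisVec n γ))⟫_ℂ =
      if lengths ω = a ∧ lengths γ = b then
        ⟪hTmul y (basisVec n ω), g (hTmul x (basisVec n γ))⟫_ℂ else 0 := by
  classical
  have h0 : ∀ z : K, hTmul z (0 : Fock n) = 0 := fun z => by rw [← hTmulLeft_apply, map_zero]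
  rw [ContinuousLinearMap.comp_apply, ContinuousLinearMap.comp_apply,
    ← ContinuousLinearMap.adjoint_inner_left, ampProj, ampProj, hMap_adjoint, adjoint_blockProj,
    ContinuousLinearMap.adjoint_id, hMap_hTmul, hMap_hTmul, blockProj_basisVec, blockProj_basisVec]
  by_cases h1 : lengths ω = a <;> by_cases h2 : lengths γ = b <;> simp [h1, h2, h0]

/-- The Toeplitz operator `T` has the coefficients `A`. -/
def HasCoeffs (m : Fin k → ℕ) (T : HTensor K (Fock n) →L[ℂ] HTensor K (Fock n))
    (A : Words n → Words n → (K →L[ℂ] K)) : Prop :=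
  ∀ (ω γ : Words n) (x y : K),
    ⟪hTmul y (basisVec n ω), T (hTmul x (basisVec n γ))⟫_ℂ = toeplitzEntry m A ω γ x y

theorem mem_multiToeplitz_iff (T : HTensor K (Fock n) →L[ℂ] HTensor K (Fock n)) :
    T ∈ multiToeplitz n m K ↔ ∃ A, HasCoeffs m T A := Iff.rfl

/-- Block by block both operators have the same matrix entries, because `q_s(W, W^*)` is the part of
`T` on which the length difference equals `s`. -/
theorem block_homTerm {T : HTensor K (Fock n) →L[ℂ] HTensor K (Fock n)}
    {A : Words n → Words n → (K →L[ℂ] K)} (hT : HasCoeffs m T A) (s : Fin k → ℤ)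
    (a b : Fin k → ℕ) [Decidable ((fun i => (a i : ℤ) - b i) = s)] :
    (ampProj K a).comp ((homTerm A (model n m) s).comp (ampProj K b)) =
      if (fun i => (a i : ℤ) - b i) = s then (ampProj K a).comp (T.comp (ampProj K b)) else 0 := by
  classical
  refine clm_ext_entries fun ω γ x y => ?_
  have h0 : ∀ (c : Prop) [Decidable c] (g : HTensor K (Fock n) →L[ℂ] HTensor K (Fock n)),
      ⟪hTmul y (basisVec n ω), (if c then g else 0) (hTmul x (basisVec n γ))⟫_ℂ =
        if c then ⟪hTmul y (basisVec n ω), g (hTmul x (basisVec n γ))⟫_ℂ else 0 := by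
    intro c _ g
    split_ifs <;> simp
  rw [h0, inner_block, inner_block, inner_homTerm_model, hT]
  by_cases h1 : lengths ω = a ∧ lengths γ = b
  · obtain ⟨rfl, rfl⟩ := h1
    have h2 : ((fun i => (lengths ω i : ℤ) - lengths γ i) = s) ↔ s = lengthDiff ω γ :=
      ⟨fun h => h.symm, fun h => h.symm⟩
    simp only [and_self, if_true, h2]
  · simp only [if_neg h1, ite_self]

/-- The multi-homogeneous expansion of the Berezin transform of a Toeplitz operator. -/
theorem hasSum_homTerm (hm : ∀ i, 1 ≤ m i) {X : OpTuple n E} (hX : X ∈ radial n m E)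
    {T : HTensor K (Fock n) →L[ℂ] HTensor K (Fock n)}
    {A : Words n → Words n → (K →L[ℂ] K)} (hT : HasCoeffs m T A) :
    HasSum (homTerm A X) (berezin m X T) := by
  classical
  let π : (Fin k → ℕ) × (Fin k → ℕ) → Fin k → ℤ := fun p i => (p.1 i : ℤ) - p.2 i
  have h1 := hasSum_berezin_block (K := K) hm hX T
  -- The block pairs are grouped by their difference `s = a - b`; it remains to identify the sum
  -- over each fibre.
  rw [← (Equiv.sigmaFiberEquiv π).hasSum_iff] at h1
  refine h1.sigma fun s => ?_
  -- `q_s(W, W^*)` has the blocks of `T` on the fibre over `s` and zero blocks elsewhere, so its own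
  -- block expansion is the fibre sum; its Berezin transform is `q_s(X, X^*)`.
  have h2 := hasSum_berezin_block (K := K) hm hX (homTerm A (model n m) s)
  rw [← homTerm_eq_berezin hm hX] at h2
  have h3 := (hasSum_subtype_iff_indicator (s := {p | π p = s})
    (f := fun p : (Fin k → ℕ) × (Fin k → ℕ) =>
      berezin m X ((ampProj K p.1).comp (T.comp (ampProj K p.2)))) (a := homTerm A X s)).2 ?_
  · exact h3
  · convert h2 using 2 with p
    rw [block_homTerm hT]
    by_cases hp : π p = s
    · rw [if_pos hp, Set.indicator_of_mem (s := {p | π p = s}) hp]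
    · rw [if_neg hp, Set.indicator_of_notMem (s := {p | π p = s}) hp, ← berezinL_apply, map_zero]

end Expansion

/-! ### Iterated two-sided series -/

section IteratedSums

variable {V : Type*} [NormedAddCommGroup V]

/-- The intervals `[-N₁, N₂]` increase and absorb every finite set of integers, so they are cofinal
among the finite partial sums. -/
theorem twoSidedSum_of_hasSum {g : ℤ → V} {a : V} (h : HasSum g a) : TwoSidedSum g a := by
  have h' : Filter.Tendsto (fun s : Finset ℤ => ∑ b ∈ s, g b) Filter.atTop (𝓝 a) := by
    simpa [HasSum] using h
  refine h'.comp ?_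
  refine Filter.tendsto_atTop_finset_of_monotone (fun N N' hN => ?_) fun s => ?_
  · refine Finset.Icc_subset_Icc ?_ ?_
    · have : N.1 ≤ N'.1 := hN.1
      omega
    · exact_mod_cast hN.2
  · refine ⟨(s.natAbs, s.natAbs), ?_⟩
    rw [Finset.mem_Icc]
    dsimp only
    omega

theorem iteratedSum_of_hasSum [CompleteSpace V] {k : ℕ} {f : (Fin k → ℤ) → V} {a : V}
    (h : HasSum f a) : IteratedSum f a := by
  induction k generalizing a with
  | zero =>
    change f Fin.elim0 = a
    have h2 : f (Unique.instInhabited.default) = f Fin.elim0 := congrArg f (Subsingleton.elim _ _)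
    rw [← h2]
    exact (hasSum_unique f).unique h
  | succ k ih =>
    rw [← (Fin.consEquiv fun _ : Fin (k + 1) => ℤ).hasSum_iff] at h
    have h1 : ∀ s : ℤ, Summable fun t : Fin k → ℤ => f (Fin.cons s t) := fun s =>
      h.summable.prod_factor s
    exact ⟨fun s => ∑' t : Fin k → ℤ, f (Fin.cons s t), fun s => ih (h1 s).hasSum,
      twoSidedSum_of_hasSum (h.prod_fiberwise fun s => (h1 s).hasSum)⟩

/-- A family of coefficients therefore determines the function, which allows two functions to be
identified from their homogeneous terms. -/
theorem IteratedSum.unique {k : ℕ} {f : (Fin k → ℤ) → V} {a b : V} (ha : IteratedSum f a)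
    (hb : IteratedSum f b) : a = b := by
  induction k generalizing a b with
  | zero => exact ha.symm.trans hb
  | succ k ih =>
    obtain ⟨g, hg, hga⟩ := ha
    obtain ⟨g', hg', hgb⟩ := hb
    obtain rfl : g = g' := funext fun s => ih (hg s) (hg' s)
    exact tendsto_nhds_unique hga hgb

theorem IteratedSum.map {V' : Type*} [NormedAddCommGroup V'] [NormedSpace ℂ V] [NormedSpace ℂ V']
    {k : ℕ} {f : (Fin k → ℤ) → V} {a : V} (h : IteratedSum f a) (L : V →L[ℂ] V') :
    IteratedSum (fun s => L (f s)) (L a) := by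
  induction k generalizing a with
  | zero => exact congrArg L h
  | succ k ih =>
    obtain ⟨g, hg, hga⟩ := h
    refine ⟨fun s => L (g s), fun s => ih (hg s), ?_⟩
    have := (L.continuous.tendsto a).comp hga
    refine this.congr fun N => ?_
    simp

end IteratedSums

/-! ### Transport to another Hilbert space -/

section Transport

variable {k : ℕ} {n m : Fin k → ℕ}
variable {H : Type*} [NormedAddCommGroup H] [InnerProductSpace ℂ H] [CompleteSpace H]
variable {K : Type*} [NormedAddCommGroup K] [InnerProductSpace ℂ K]

theorem transport_apply (U : Fock n ≃ₗᵢ[ℂ] H) (X : OpTuple n (Fock n)) (i : Fin k) (j : Fin (n i)) :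
    transport U X i j = U.conjStarAlgEquiv (X i j) := rfl

theorem transport_smul (U : Fock n ≃ₗᵢ[ℂ] H) (c : ℂ) (X : OpTuple n (Fock n)) :
    transport U (c • X) = c • transport U X := by
  funext i j
  rw [transport_apply, Pi.smul_apply, Pi.smul_apply, Pi.smul_apply, Pi.smul_apply, map_smul,
    transport_apply]

theorem cpMap_transport (U : Fock n ≃ₗᵢ[ℂ] H) (X : OpTuple n (Fock n)) (i : Fin k)
    (Y : Fock n →L[ℂ] Fock n) :
    cpMap (transport U X) i (U.conjStarAlgEquiv Y) = U.conjStarAlgEquiv (cpMap X i Y) := by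
  rw [cpMap_apply, cpMap_apply, map_sum]
  refine Finset.sum_congr rfl fun j _ => ?_
  rw [map_mul, map_mul, map_star, transport_apply]

theorem defectMap_transport (U : Fock n ≃ₗᵢ[ℂ] H) (X : OpTuple n (Fock n)) (p : Fin k → ℕ)
    (Y : Fock n →L[ℂ] Fock n) :
    defectMap (transport U X) p (U.conjStarAlgEquiv Y) =
      U.conjStarAlgEquiv (defectMap X p Y) := by
  have h1 : ∀ (i : Fin k) (l : ℕ) (Y : Fock n →L[ℂ] Fock n),
      (((1 : Module.End ℂ (H →L[ℂ] H)) - cpMap (transport U X) i) ^ l) (U.conjStarAlgEquiv Y) =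
        U.conjStarAlgEquiv ((((1 : Module.End ℂ (Fock n →L[ℂ] Fock n)) - cpMap X i) ^ l) Y) := by
    intro i l
    induction l with
    | zero => intro Y; rw [pow_zero, pow_zero]; rfl
    | succ l ih =>
      intro Y
      rw [pow_succ, pow_succ, Module.End.mul_apply, Module.End.mul_apply, LinearMap.sub_apply,
        LinearMap.sub_apply, cpMap_transport, Module.End.one_apply, Module.End.one_apply,
        ← map_sub, ih]
  rw [defectMap, defectMap, List.ofFn_eq_map, List.ofFn_eq_map]
  induction List.finRange k with
  | nil => rfl
  | cons i l ih =>
    rw [List.map_cons, List.map_cons, List.prod_cons, List.prod_cons, Module.End.mul_apply,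
      Module.End.mul_apply, ih, h1]

/-- Conjugation by a unitary is a `*`-isomorphism, so it respects commutation, defect maps and
positivity. It is needed because functions are evaluated on Hilbert spaces in the universe of `H`,
while the Fock space lives in `Type`. -/
theorem transport_mem_polyHyperball (U : Fock n ≃ₗᵢ[ℂ] H) {X : OpTuple n (Fock n)}
    (hX : X ∈ polyHyperball n m (Fock n)) : transport U X ∈ polyHyperball n m H := by
  refine ⟨fun p q hpq i j => ?_, fun p hp => ?_⟩
  · rw [transport_apply, transport_apply]
    exact (hX.1 p q hpq i j).map U.conjStarAlgEquiv
  · have h1 : (1 : H →L[ℂ] H) = U.conjStarAlgEquiv 1 := (map_one _).symm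
    rw [h1, defectMap_transport]
    have h2 := (hX.2 p hp).conj_adjoint (U : Fock n →L[ℂ] H)
    rwa [LinearIsometryEquiv.adjoint_eq_symm] at h2

theorem transport_smul_model_mem_radial (hm : ∀ i, 1 ≤ m i) (U : Fock n ≃ₗᵢ[ℂ] H) {r : ℝ}
    (h0 : 0 ≤ r) (h1 : r < 1) : transport U ((r : ℂ) • model n m) ∈ radial n m H :=
  ⟨r, h0, h1, _, transport_mem_polyHyperball U (model_mem_polyHyperball hm), transport_smul U _ _⟩

theorem wordOp_transport (U : Fock n ≃ₗᵢ[ℂ] H) (X : OpTuple n (Fock n)) (i : Fin k)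
    (α : List (Fin (n i))) :
    wordOp (transport U X i) α = U.conjStarAlgEquiv (wordOp (X i) α) := by
  rw [wordOp, wordOp, map_list_prod, List.map_map]
  rfl

theorem multiOp_transport (U : Fock n ≃ₗᵢ[ℂ] H) (X : OpTuple n (Fock n)) (α : Words n) :
    multiOp (transport U X) α = U.conjStarAlgEquiv (multiOp X α) := by
  rw [multiOp, multiOp, map_prod_ofFn]
  simp only [wordOp_transport]

theorem multiOpStar_transport (U : Fock n ≃ₗᵢ[ℂ] H) (X : OpTuple n (Fock n)) (α : Words n) :
    multiOpStar (transport U X) α = U.conjStarAlgEquiv (multiOpStar X α) := by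
  rw [multiOpStar, multiOpStar, map_prod_ofFn]
  simp only [wordOp_transport, map_star]

variable (K) in
/-- `S ↦ (I ⊗ U^*) S (I ⊗ U)`. -/
def unitaryPullback (U : Fock n ≃ₗᵢ[ℂ] H) : (HTensor K H →L[ℂ] HTensor K H) →L[ℂ]
    (HTensor K (Fock n) →L[ℂ] HTensor K (Fock n)) :=
  (ContinuousLinearMap.compL ℂ _ _ _
      (hMap (ContinuousLinearMap.id ℂ K) (U.symm : H →L[ℂ] Fock n))).comp
    ((ContinuousLinearMap.compL ℂ _ _ _).flip
      (hMap (ContinuousLinearMap.id ℂ K) (U : Fock n →L[ℂ] H)))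

theorem unitaryPullback_apply (U : Fock n ≃ₗᵢ[ℂ] H) (S : HTensor K H →L[ℂ] HTensor K H) :
    unitaryPullback K U S =
      (hMap (ContinuousLinearMap.id ℂ K) (U.symm : H →L[ℂ] Fock n)).comp
        (S.comp (hMap (ContinuousLinearMap.id ℂ K) (U : Fock n →L[ℂ] H))) := rfl

theorem unitaryPullback_hMap (U : Fock n ≃ₗᵢ[ℂ] H) (A : K →L[ℂ] K) (w : Fock n →L[ℂ] Fock n) :
    unitaryPullback K U (hMap A (U.conjStarAlgEquiv w)) = hMap A w := by
  rw [unitaryPullback_apply, hMap_comp, hMap_comp, ContinuousLinearMap.comp_id,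
    ContinuousLinearMap.id_comp]
  congr 1
  ext1 z
  simp

theorem unitaryPullback_homTerm (U : Fock n ≃ₗᵢ[ℂ] H) (A : Words n → Words n → (K →L[ℂ] K))
    (X : OpTuple n (Fock n)) (s : Fin k → ℤ) :
    unitaryPullback K U (homTerm A (transport U X) s) = homTerm A X s := by
  rw [homTerm, homTerm]
  simp only [map_sum, multiOp_transport, multiOpStar_transport, ← map_mul, unitaryPullback_hMap]

theorem norm_coe_linearIsometryEquiv_le {V V' : Type*} [NormedAddCommGroup V]
    [InnerProductSpace ℂ V] [NormedAddCommGroup V'] [InnerProductSpace ℂ V'] (U : V ≃ₗᵢ[ℂ] V') :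
    ‖(U : V →L[ℂ] V')‖ ≤ 1 :=
  ContinuousLinearMap.opNorm_le_bound _ zero_le_one fun x => by simp

theorem norm_unitaryPullback_le (U : Fock n ≃ₗᵢ[ℂ] H) (S : HTensor K H →L[ℂ] HTensor K H) :
    ‖unitaryPullback K U S‖ ≤ ‖S‖ := by
  rw [unitaryPullback_apply]
  refine (ContinuousLinearMap.opNorm_comp_le _ _).trans ?_
  refine (mul_le_of_le_one_left (norm_nonneg _)
    ((norm_hMap_id_left_le _).trans (norm_coe_linearIsometryEquiv_le U.symm))).trans ?_
  refine (ContinuousLinearMap.opNorm_comp_le _ _).trans ?_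
  exact mul_le_of_le_one_right (norm_nonneg _)
    ((norm_hMap_id_left_le _).trans (norm_coe_linearIsometryEquiv_le U))

/-! ### Dilations -/

theorem wordOp_smul {E : Type*} [NormedAddCommGroup E] [InnerProductSpace ℂ E]
    {d : ℕ} (c : ℂ) (x : Fin d → (E →L[ℂ] E)) (α : List (Fin d)) :
    wordOp (c • x) α = c ^ α.length • wordOp x α := by
  induction α with
  | nil => simp [wordOp]
  | cons j α ih =>
    have h : ∀ y : Fin d → (E →L[ℂ] E), wordOp y (j :: α) = y j * wordOp y α := fun y => by
      simp [wordOp]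
    rw [h, h, ih, Pi.smul_apply, smul_mul_smul_comm, List.length_cons, pow_succ']

theorem multiOp_smul (c : ℂ) (X : OpTuple n H) (α : Words n) :
    multiOp (c • X) α = (∏ i, c ^ (α i).length) • multiOp X α := by
  rw [multiOp, multiOp, ← prod_ofFn_smul]
  simp only [← wordOp_smul]
  rfl

theorem multiOpStar_smul (c : ℂ) (X : OpTuple n H) (α : Words n) :
    multiOpStar (c • X) α = (∏ i, star c ^ (α i).length) • multiOpStar X α := by
  rw [multiOpStar, multiOpStar, ← prod_ofFn_smul]
  simp only [← star_pow, ← star_smul, ← wordOp_smul]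
  rfl

/-- `α_i` contributes `r^{s_i^+}`, `β_i` contributes `r^{s_i^-}`, and `s_i^+ + s_i^- = |s_i|`. -/
theorem homTerm_smul (r : ℝ) (A : Words n → Words n → (K →L[ℂ] K)) (X : OpTuple n H)
    (s : Fin k → ℤ) :
    homTerm A ((r : ℂ) • X) s = ((∏ i, r ^ (s i).natAbs : ℝ) : ℂ) • homTerm A X s := by
  have key : (∏ i, (r : ℂ) ^ (s i).toNat) * ∏ i, star (r : ℂ) ^ (-s i).toNat =
      ((∏ i, r ^ (s i).natAbs : ℝ) : ℂ) := by
    rw [← Finset.prod_mul_distrib, Complex.ofReal_prod]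
    refine Finset.prod_congr rfl fun i _ => ?_
    rw [Complex.star_def, Complex.conj_ofReal, ← pow_add, Complex.ofReal_pow]
    congr 1
    omega
  rw [homTerm, homTerm, Finset.smul_sum]
  refine Finset.sum_congr rfl fun α _ => ?_
  rw [Finset.smul_sum]
  refine Finset.sum_congr rfl fun β _ => ?_
  rw [multiOp_smul, multiOpStar_smul, smul_mul_smul_comm, hMap_smul_right]
  simp only [List.Vector.toList_length, key]

/-! ### Values at the dilated universal model -/

theorem valueAtModel_eq (hm : ∀ i, 1 ≤ m i) (F : radial n m H → minTensor K H)
    (U : Fock n ≃ₗᵢ[ℂ] H) {r : ℝ} (h0 : 0 ≤ r) (h1 : r < 1) :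
    valueAtModel F U r = unitaryPullback K U
      (F ⟨_, transport_smul_model_mem_radial hm U h0 h1⟩ : HTensor K H →L[ℂ] HTensor K H) := by
  rw [valueAtModel, valueAt, dif_pos (transport_smul_model_mem_radial hm U h0 h1),
    unitaryPullback_apply]

/-- The factor `∏ r^{| |ω_i| - |γ_i| |}` of a matrix entry. -/
def dilationFactor (r : ℝ) (ω γ : Words n) : ℝ := ∏ i, r ^ (lengthDiff ω γ i).natAbs

theorem abs_dilationFactor_le {r : ℝ} (h0 : 0 ≤ r) (h1 : r ≤ 1) (ω γ : Words n) :
    |dilationFactor r ω γ| ≤ 1 := by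
  rw [dilationFactor, abs_of_nonneg (Finset.prod_nonneg fun i _ => pow_nonneg h0 _)]
  exact Finset.prod_le_one (fun i _ => pow_nonneg h0 _) fun i _ => pow_le_one₀ h0 h1

theorem tendsto_dilationFactor (ω γ : Words n) :
    Filter.Tendsto (fun r : ℝ => dilationFactor r ω γ) (𝓝[<] 1) (𝓝 1) := by
  have h : Continuous fun r : ℝ => dilationFactor r ω γ := by
    unfold dilationFactor
    fun_prop
  have h1 : dilationFactor 1 ω γ = 1 := by simp [dilationFactor]
  have h2 := (h.tendsto 1).mono_left (nhdsWithin_le_nhds (s := Set.Iio 1))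
  rwa [h1] at h2

/-- A matrix entry is a continuous functional, so it may be taken term by term; only `s = |ω| - |γ|`
survives. -/
theorem inner_unitaryPullback (U : Fock n ≃ₗᵢ[ℂ] H) {A : Words n → Words n → (K →L[ℂ] K)} {r : ℝ}
    {S : HTensor K H →L[ℂ] HTensor K H}
    (hS : IteratedSum (homTerm A (transport U ((r : ℂ) • model n m))) S) (ω γ : Words n) (x y : K) :
    ⟪hTmul y (basisVec n ω), unitaryPullback K U S (hTmul x (basisVec n γ))⟫_ℂ =
      (dilationFactor r ω γ : ℂ) * toeplitzEntry m A ω γ x y := by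
  have h1 := ((hS.map (unitaryPullback K U)).map
    (ContinuousLinearMap.apply ℂ (HTensor K (Fock n)) (hTmul x (basisVec n γ)))).map
      (innerSL ℂ (hTmul y (basisVec n ω)))
  refine h1.unique (iteratedSum_of_hasSum ?_)
  have h2 : (fun s => innerSL ℂ (hTmul y (basisVec n ω))
      (ContinuousLinearMap.apply ℂ (HTensor K (Fock n)) (hTmul x (basisVec n γ))
        (unitaryPullback K U (homTerm A (transport U ((r : ℂ) • model n m)) s)))) =
      fun s => if s = lengthDiff ω γ then
        (dilationFactor r ω γ : ℂ) * toeplitzEntry m A ω γ x y else 0 := by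
    funext s
    rw [unitaryPullback_homTerm, homTerm_smul, ContinuousLinearMap.apply_apply, smul_apply,
      innerSL_apply_apply, inner_smul_right, inner_homTerm_model]
    split_ifs with h
    · rw [h]; rfl
    · rw [mul_zero]
  rw [h2]
  simpa using hasSum_single (f := fun s => if s = lengthDiff ω γ then
        (dilationFactor r ω γ : ℂ) * toeplitzEntry m A ω γ x y else 0) (lengthDiff ω γ)
    fun s hs => if_neg hs

theorem norm_diagOp_le (d : Words n → ℝ) (hd : ∀ α, |d α| ≤ 1) : ‖diagOp n d hd‖ ≤ 1 := by
  refine ContinuousLinearMap.opNorm_le_bound _ zero_le_one fun f => ?_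
  rw [one_mul]
  have key : ∀ α, ‖diagOp n d hd f α‖ ^ (2 : ENNReal).toReal ≤ ‖f α‖ ^ (2 : ENNReal).toReal := by
    intro α
    refine Real.rpow_le_rpow (norm_nonneg _) ?_ (by simp)
    change ‖(d α : ℂ) * f α‖ ≤ ‖f α‖
    rw [norm_mul, Complex.norm_real, Real.norm_eq_abs]
    exact mul_le_of_le_one_left (norm_nonneg _) (hd α)
  refine lp.norm_le_of_tsum_le (by simp) (norm_nonneg _) ?_
  rw [lp.norm_rpow_eq_tsum (by simp) f]
  exact Summable.tsum_le_tsum key ((lp.memℓp _).summable (by simp))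
    ((lp.memℓp f).summable (by simp))

/-- `e_ω ↦ ∏ r^{| |ω_i| - |γ_i| |} e_ω`, for `0 ≤ r ≤ 1`. -/
def dilationOp (γ : Words n) (r : ℝ) : Fock n →L[ℂ] Fock n :=
  -- `diagOp` requires entries of modulus at most `1`; the value `0` elsewhere plays no role as `r →
  -- 1` from below.
  if h : 0 ≤ r ∧ r ≤ 1 then
    diagOp n (fun ω => dilationFactor r ω γ) fun ω => abs_dilationFactor_le h.1 h.2 ω γ
  else 0

theorem norm_dilationOp_le (γ : Words n) (r : ℝ) : ‖dilationOp γ r‖ ≤ 1 := by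
  rw [dilationOp]
  split_ifs
  · exact norm_diagOp_le _ _
  · rw [norm_zero]; exact zero_le_one

theorem dilationOp_basisVec (γ : Words n) {r : ℝ} (h0 : 0 ≤ r) (h1 : r ≤ 1) (ω : Words n) :
    dilationOp γ r (basisVec n ω) = (dilationFactor r ω γ : ℂ) • basisVec n ω := by
  rw [dilationOp, dif_pos ⟨h0, h1⟩, diagOp_basisVec]

theorem eventually_mem_Ico : ∀ᶠ r : ℝ in 𝓝[<] 1, 0 ≤ r ∧ r < 1 :=
  Ico_mem_nhdsLT zero_lt_one

theorem tendsto_dilationOp (γ : Words n) (z : Fock n) :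
    Filter.Tendsto (fun r => dilationOp γ r z) (𝓝[<] 1) (𝓝 z) := by
  refine tendsto_clm_apply_of_total (f₀ := ContinuousLinearMap.id ℂ (Fock n)) (C := 1)
    (Filter.Eventually.of_forall fun r => norm_dilationOp_le γ r) dense_span_basisVec ?_ z
  rintro _ ⟨ω, rfl⟩
  have h1 : Filter.Tendsto (fun r : ℝ => (dilationFactor r ω γ : ℂ) • basisVec n ω) (𝓝[<] 1)
      (𝓝 (((1 : ℝ) : ℂ) • basisVec n ω)) :=
    ((Complex.continuous_ofReal.tendsto _).comp (tendsto_dilationFactor ω γ)).smul_const _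
  rw [Complex.ofReal_one, one_smul] at h1
  refine h1.congr' ?_
  filter_upwards [eventually_mem_Ico] with r hr
  rw [dilationOp_basisVec γ hr.1 hr.2.le]

theorem inner_dilationOp [CompleteSpace K] (γ : Words n) {r : ℝ} (h0 : 0 ≤ r) (h1 : r ≤ 1)
    (y : K) (ω : Words n) (z : HTensor K (Fock n)) :
    ⟪hTmul y (basisVec n ω), hMap (ContinuousLinearMap.id ℂ K) (dilationOp γ r) z⟫_ℂ =
      (dilationFactor r ω γ : ℂ) * ⟪hTmul y (basisVec n ω), z⟫_ℂ := by
  classical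
  have hadj : ContinuousLinearMap.adjoint (dilationOp γ r) = dilationOp (n := n) γ r := by
    refine clm_ext_basisVec fun δ => ext_inner_basisVec fun ε => ?_
    rw [ContinuousLinearMap.adjoint_inner_right, dilationOp_basisVec γ h0 h1,
      dilationOp_basisVec γ h0 h1, inner_smul_left, inner_smul_right, Complex.conj_ofReal,
      inner_basisVec]
    split_ifs with h
    · rw [h]
    · rw [mul_zero, mul_zero]
  rw [← ContinuousLinearMap.adjoint_inner_left, hMap_adjoint, hadj,
    ContinuousLinearMap.adjoint_id, hMap_hTmul, dilationOp_basisVec γ h0 h1, hTmul_smul_right,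
    inner_smul_left, Complex.conj_ofReal]
  rfl

variable [CompleteSpace K]

/-- The dilation factors in the column of `γ` form a diagonal contraction of the Fock space, so `F(r
W)` on `x ⊗ e_γ` is `I ⊗ dilationOp γ r` applied to the fixed vector `T (x ⊗ e_γ)`. This yields
strong rather than just weak convergence; uniform boundedness extends it from these vectors to all.
-/
theorem isRadialSOTLimit_of_eq_berezin (hm : ∀ i, 1 ≤ m i) {F : radial n m H → minTensor K H}
    {T : HTensor K (Fock n) →L[ℂ] HTensor K (Fock n)} (hT : T ∈ multiToeplitz n m K)
    (hF : ∀ X : radial n m H, (F X : HTensor K H →L[ℂ] HTensor K H) = berezin m X.1 T) :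
    IsRadialSOTLimit F T := by
  obtain ⟨A, hA⟩ := (mem_multiToeplitz_iff T).1 hT
  intro U ξ
  refine tendsto_clm_apply_of_total (C := ‖T‖) ?_
    (dense_span_hTmul (dense_span_basisVec (n := n))) ?_ ξ
  · filter_upwards [eventually_mem_Ico] with r hr
    rw [valueAtModel_eq hm F U hr.1 hr.2, hF]
    exact (norm_unitaryPullback_le U _).trans
      (norm_berezin_le hm (transport_smul_model_mem_radial hm U hr.1 hr.2) T)
  · rintro _ ⟨x, _, ⟨γ, rfl⟩, rfl⟩
    have h1 := tendsto_hMap_id_apply (E := K) (C := 1)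
      (Filter.Eventually.of_forall fun r => norm_dilationOp_le γ r)
      (g₀ := ContinuousLinearMap.id ℂ (Fock n)) (tendsto_dilationOp γ)
      (T (hTmul x (basisVec n γ)))
    rw [hMap_id] at h1
    refine h1.congr' ?_
    filter_upwards [eventually_mem_Ico] with r hr
    refine ext_inner_basisVec_right fun y ω => ?_
    have hX := transport_smul_model_mem_radial (m := m) hm U hr.1 hr.2
    rw [inner_dilationOp γ hr.1 hr.2.le, hA, valueAtModel_eq hm F U hr.1 hr.2, hF,
      inner_unitaryPullback U (iteratedSum_of_hasSum (hasSum_homTerm hm hX hA))]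

end Transport

/-! ### Weak limits -/

section Weak

variable {V : Type*} [NormedAddCommGroup V] [InnerProductSpace ℂ V] [CompleteSpace V]

/-- A bounded family of operators has a limit in the weak operator topology along every
ultrafilter. -/
theorem exists_weak_limit {ι : Type*} (l : Ultrafilter ι) {f : ι → (V →L[ℂ] V)} {C : ℝ}
    (hC : ∀ᶠ t in (l : Filter ι), ‖f t‖ ≤ C) :
    ∃ T : V →L[ℂ] V, ∀ x y : V,
      Filter.Tendsto (fun t => ⟪f t x, y⟫_ℂ) l (𝓝 ⟪T x, y⟫_ℂ) := by
  have hb : ∀ x y : V, ∀ᶠ t in (l : Filter ι), ‖⟪f t x, y⟫_ℂ‖ ≤ C * ‖x‖ * ‖y‖ := fun x y => by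
    filter_upwards [hC] with t ht
    refine (norm_inner_le_norm _ _).trans (mul_le_mul_of_nonneg_right ?_ (norm_nonneg _))
    exact ((f t).le_opNorm x).trans (mul_le_mul_of_nonneg_right ht (norm_nonneg _))
  have hlim : ∀ x y : V, ∃ c : ℂ, Filter.Tendsto (fun t => ⟪f t x, y⟫_ℂ) l (𝓝 c) := by
    intro x y
    -- The scalars eventually lie in a compact disc, so the ultrafilter has a limit there.
    have h := (isCompact_closedBall (0 : ℂ) (C * ‖x‖ * ‖y‖)).ultrafilter_le_nhds
      (l.map fun t => ⟪f t x, y⟫_ℂ) (by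
        rw [Filter.le_principal_iff, Ultrafilter.mem_coe, Ultrafilter.mem_map]
        filter_upwards [hb x y] with t ht
        simpa using ht)
    obtain ⟨c, -, hc⟩ := h
    exact ⟨c, hc⟩
  choose L hL using hlim
  -- Uniqueness of limits makes the limit form sesquilinear; being bounded, it is represented by an
  -- operator.
  let B : V →ₗ⋆[ℂ] V →ₗ[ℂ] ℂ := LinearMap.mk₂'ₛₗ (starRingEnd ℂ) (RingHom.id ℂ) L
    (fun x x' y => tendsto_nhds_unique (hL _ _) (by
      simpa only [map_add, inner_add_left] using (hL x y).add (hL x' y)))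
    (fun c x y => tendsto_nhds_unique (hL _ _) (by
      simpa only [map_smul, inner_smul_left, smul_eq_mul] using
        (hL x y).const_mul (starRingEnd ℂ c)))
    (fun x y y' => tendsto_nhds_unique (hL _ _) (by
      simpa only [inner_add_right] using (hL x y).add (hL x y')))
    (fun c x y => tendsto_nhds_unique (hL _ _) (by
      simpa only [inner_smul_right, smul_eq_mul, RingHom.id_apply] using (hL x y).const_mul c))
  have hB : ∀ x y, ‖B x y‖ ≤ C * ‖x‖ * ‖y‖ := fun x y =>
    le_of_tendsto (hL x y).norm (hb x y)
  refine ⟨InnerProductSpace.continuousLinearMapOfBilin (B.mkContinuous₂ C hB), fun x y => ?_⟩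
  rw [InnerProductSpace.continuousLinearMapOfBilin_apply]
  exact hL x y

end Weak

/-! ### Identification of a separable infinite dimensional Hilbert space with the Fock space -/

section Separable

variable {k : ℕ} {n : Fin k → ℕ}

theorem infinite_words (hk : 0 < k) (hn : ∀ i, 1 ≤ n i) : Infinite (Words n) := by
  refine Infinite.of_injective (fun (l : ℕ) (i : Fin k) => List.replicate l (⟨0, hn i⟩ : Fin (n i)))
    fun l l' h => ?_
  simpa using congrArg List.length (congrFun h ⟨0, hk⟩)

/-- Orthonormal vectors are `√2` apart, so the balls of radius `1/2` around them are disjoint, and a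
separable space holds only countably many disjoint nonempty open sets. -/
theorem countable_of_orthonormal {H : Type*} [NormedAddCommGroup H] [InnerProductSpace ℂ H]
    [TopologicalSpace.SeparableSpace H] {ι : Type*} {e : ι → H} (he : Orthonormal ℂ e) :
    Countable ι := by
  have hd : ∀ i j, i ≠ j → Disjoint (Metric.ball (e i) (1 / 2)) (Metric.ball (e j) (1 / 2)) := by
    intro i j hij
    refine Metric.ball_disjoint_ball ?_
    have h1 : ‖e i - e j‖ ^ 2 = 2 := by
      rw [@norm_sub_sq ℂ, he.1, he.1, he.2 hij]
      norm_num
    rw [dist_eq_norm]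
    nlinarith [norm_nonneg (e i - e j)]
  have := Set.PairwiseDisjoint.countable_of_isOpen (s := fun i => Metric.ball (e i) (1 / 2))
    (a := Set.univ) (fun i _ j _ hij => hd i j hij) (fun i _ => Metric.isOpen_ball)
    (fun i _ => ⟨e i, Metric.mem_ball_self (by norm_num)⟩)
  exact Set.countable_univ_iff.1 this

/-- Both spaces have countably infinite Hilbert bases; the words do because `k` and the `n_i` are
positive. -/
theorem exists_unitary_fock (hk : 0 < k) (hn : ∀ i, 1 ≤ n i)
    (H : Type*) [NormedAddCommGroup H] [InnerProductSpace ℂ H] [CompleteSpace H]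
    [TopologicalSpace.SeparableSpace H] (hH : ¬ FiniteDimensional ℂ H) :
    Nonempty (Fock n ≃ₗᵢ[ℂ] H) := by
  obtain ⟨s, b, -⟩ := exists_hilbertBasis ℂ H
  have := infinite_words hk hn
  have : Countable s := countable_of_orthonormal b.orthonormal
  have : Infinite s := by
    by_contra h
    have : Finite s := not_infinite_iff_finite.1 h
    have := Fintype.ofFinite s
    exact hH (b.toOrthonormalBasis.toBasis.finiteDimensional_of_finite)
  obtain ⟨e⟩ := nonempty_equiv_of_countable (α := Words n) (β := s)
  have hsp : (⊤ : Submodule ℂ H) ≤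
      (Submodule.span ℂ (Set.range (b ∘ e))).topologicalClosure := by
    rw [e.surjective.range_comp, b.dense_span]
  exact ⟨(HilbertBasis.mk (b.orthonormal.comp e e.injective) hsp).repr.symm⟩

end Separable

/-! ### Toeplitz operators and bounded pluriharmonic functions -/

section Correspondence

variable {k : ℕ} {n m : Fin k → ℕ}
variable {E : Type*} [NormedAddCommGroup E] [InnerProductSpace ℂ E] [CompleteSpace E]
variable {K : Type*} [NormedAddCommGroup K] [InnerProductSpace ℂ K] [CompleteSpace K]

theorem homTerm_mem_minTensor (A : Words n → Words n → (K →L[ℂ] K)) (X : OpTuple n E)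
    (s : Fin k → ℤ) : homTerm A X s ∈ minTensor K E :=
  Submodule.le_topologicalClosure _ <| Submodule.sum_mem _ fun _ _ => Submodule.sum_mem _ fun _ _ =>
    Submodule.subset_span ⟨_, _, rfl⟩

/-- The homogeneous terms lie in the span of elementary operators, and their sum converges in norm.
-/
theorem berezin_mem_minTensor (hm : ∀ i, 1 ≤ m i) {X : OpTuple n E} (hX : X ∈ radial n m E)
    {T : HTensor K (Fock n) →L[ℂ] HTensor K (Fock n)} (hT : T ∈ multiToeplitz n m K) :
    berezin m X T ∈ minTensor K E := by
  obtain ⟨A, hA⟩ := (mem_multiToeplitz_iff T).1 hT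
  refine (Submodule.isClosed_topologicalClosure _).mem_of_tendsto (hasSum_homTerm hm hX hA)
    (Filter.Eventually.of_forall fun s => ?_)
  exact Submodule.sum_mem _ fun t _ => homTerm_mem_minTensor A X t

variable (n K) in
/-- The bounded free pluriharmonic function `X ↦ B_X[T]` of a Toeplitz operator `T`. -/
def toeplitzTransform (hm : ∀ i, 1 ≤ m i) :
    multiToeplitz n m K →ₗ[ℂ] boundedPluriharmonic.{w} n m K where
  toFun T := ⟨fun E X => ⟨berezin m X.1 T.1, berezin_mem_minTensor hm X.2 T.2⟩, by
    obtain ⟨A, hA⟩ := (mem_multiToeplitz_iff T.1).1 T.2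
    exact ⟨⟨A, fun E X => iteratedSum_of_hasSum (hasSum_homTerm hm X.2 hA)⟩,
      ⟨‖T.1‖, fun E X => norm_berezin_le hm X.2 T.1⟩⟩⟩
  map_add' S T := Subtype.ext <| funext fun E => funext fun X => Subtype.ext <|
    map_add (berezinL m K X.1) S.1 T.1
  map_smul' c T := Subtype.ext <| funext fun E => funext fun X => Subtype.ext <|
    map_smul (berezinL m K X.1) c T.1

theorem toeplitzTransform_apply (hm : ∀ i, 1 ≤ m i) (T : multiToeplitz n m K) (E : HilbertSp.{w})
    (X : radial n m E) :
    ((toeplitzTransform.{w} n K hm T).1 E X : HTensor K E →L[ℂ] HTensor K E) =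
      berezin m X.1 T.1 := rfl

variable {H : Type w} [NormedAddCommGroup H] [InnerProductSpace ℂ H] [CompleteSpace H]

theorem isRadialSOTLimit_toeplitzTransform (hm : ∀ i, 1 ≤ m i) (T : multiToeplitz n m K) :
    IsRadialSOTLimit ((toeplitzTransform.{w} n K hm T).1 ⟨H⟩) T.1 :=
  isRadialSOTLimit_of_eq_berezin hm T.2 fun X => toeplitzTransform_apply hm T ⟨H⟩ X

theorem toeplitzTransform_injective (hm : ∀ i, 1 ≤ m i) (U : Fock n ≃ₗᵢ[ℂ] H) :
    Function.Injective (toeplitzTransform.{w} n K hm) := by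
  intro S T h
  refine Subtype.ext (ContinuousLinearMap.ext fun ξ => ?_)
  have h1 := isRadialSOTLimit_toeplitzTransform (H := H) hm S U ξ
  rw [h] at h1
  exact tendsto_nhds_unique h1 (isRadialSOTLimit_toeplitzTransform (H := H) hm T U ξ)

/-- An ultrafilter finer than `r → 1` replaces the choice of a convergent subnet, so `K` may be
non-separable. The dilation factors tend to `1`, which fixes every entry of the limit. -/
theorem exists_hasCoeffs_of_entries {f : ℝ → (HTensor K (Fock n) →L[ℂ] HTensor K (Fock n))}
    {A : Words n → Words n → (K →L[ℂ] K)} {C : ℝ} (hC : ∀ᶠ r in 𝓝[<] (1 : ℝ), ‖f r‖ ≤ C)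
    (hf : ∀ᶠ r in 𝓝[<] (1 : ℝ), ∀ (ω γ : Words n) (x y : K),
      ⟪hTmul y (basisVec n ω), f r (hTmul x (basisVec n γ))⟫_ℂ =
        (dilationFactor r ω γ : ℂ) * toeplitzEntry m A ω γ x y) :
    ∃ T : HTensor K (Fock n) →L[ℂ] HTensor K (Fock n), HasCoeffs m T A := by
  have hl : ((Ultrafilter.of (𝓝[<] (1 : ℝ)) : Ultrafilter ℝ) : Filter ℝ) ≤ 𝓝[<] 1 :=
    Ultrafilter.of_le _
  obtain ⟨T, hT⟩ := exists_weak_limit (Ultrafilter.of (𝓝[<] (1 : ℝ))) (hl hC)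
  refine ⟨T, fun ω γ x y => ?_⟩
  -- The weak limit controls `⟪T ξ, η⟫`, whereas Toeplitz entries are `⟪η, T ξ⟫`; hence the
  -- conjugation.
  have h1 := (hT (hTmul x (basisVec n γ)) (hTmul y (basisVec n ω))).star
  simp only [← starRingEnd_apply, inner_conj_symm] at h1
  have h2 : Filter.Tendsto (fun r : ℝ => (dilationFactor r ω γ : ℂ)) (𝓝[<] 1) (𝓝 ((1 : ℝ) : ℂ)) :=
    (Complex.continuous_ofReal.tendsto _).comp (tendsto_dilationFactor ω γ)
  have h3 := h2.mul_const (toeplitzEntry m A ω γ x y)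
  rw [Complex.ofReal_one, one_mul] at h3
  refine tendsto_nhds_unique h1 ((h3.mono_left hl).congr' (hl ?_))
  filter_upwards [hf] with r hr
  exact (hr ω γ x y).symm

/-- The values of a bounded pluriharmonic function at the dilated models accumulate, in the weak
operator topology, at a Toeplitz operator with the same coefficients. -/
theorem exists_hasCoeffs (hm : ∀ i, 1 ≤ m i) (U : Fock n ≃ₗᵢ[ℂ] H)
    {F : radial n m H → minTensor K H} {A : Words n → Words n → (K →L[ℂ] K)} {C : ℝ}
    (hA : ∀ X : radial n m H, IteratedSum (homTerm A X.1) (F X : HTensor K H →L[ℂ] HTensor K H))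
    (hC : ∀ X : radial n m H, ‖(F X : HTensor K H →L[ℂ] HTensor K H)‖ ≤ C) :
    ∃ T : HTensor K (Fock n) →L[ℂ] HTensor K (Fock n), HasCoeffs m T A := by
  refine exists_hasCoeffs_of_entries (f := valueAtModel F U) (C := C) ?_ ?_
  · filter_upwards [eventually_mem_Ico] with r hr
    rw [valueAtModel_eq hm F U hr.1 hr.2]
    exact (norm_unitaryPullback_le U _).trans
      (hC ⟨_, transport_smul_model_mem_radial hm U hr.1 hr.2⟩)
  · filter_upwards [eventually_mem_Ico] with r hr ω γ x y
    rw [valueAtModel_eq hm F U hr.1 hr.2]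
    exact inner_unitaryPullback U (hA ⟨_, transport_smul_model_mem_radial hm U hr.1 hr.2⟩) ω γ x y

/-- The operator `T` is built from the representation on `H` alone. Since one family of coefficients
serves all Hilbert spaces, uniqueness of the series carries the identity `B_X[T] = G(X)` over to
each of them. -/
theorem toeplitzTransform_surjective (hm : ∀ i, 1 ≤ m i) (U : Fock n ≃ₗᵢ[ℂ] H) :
    Function.Surjective (toeplitzTransform.{w} n K hm) := by
  rintro ⟨G, ⟨A, hA⟩, C, hC⟩
  obtain ⟨T, hT⟩ := exists_hasCoeffs hm U (hA ⟨H⟩) (hC ⟨H⟩)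
  refine ⟨⟨T, A, hT⟩, Subtype.ext <| funext fun E => funext fun X => Subtype.ext ?_⟩
  exact (iteratedSum_of_hasSum (hasSum_homTerm hm X.2 hT)).unique (hA E X)

theorem tendsto_blockOp {V ι : Type*} [NormedAddCommGroup V] [InnerProductSpace ℂ V] {q : ℕ}
    {l : Filter ι} {M : ι → Matrix (Fin q) (Fin q) (V →L[ℂ] V)}
    {M₀ : Matrix (Fin q) (Fin q) (V →L[ℂ] V)}
    (h : ∀ i j x, Filter.Tendsto (fun t => M t i j x) l (𝓝 (M₀ i j x)))
    (ξ : PiLp 2 (fun _ : Fin q => V)) :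
    Filter.Tendsto (fun t => blockOp (M t) ξ) l (𝓝 (blockOp M₀ ξ)) := by
  have h1 : Filter.Tendsto (fun t i => blockOp (M t) ξ i) l (𝓝 fun i => blockOp M₀ ξ i) := by
    refine tendsto_pi_nhds.2 fun i => ?_
    simp only [blockOp_apply]
    exact tendsto_finsetSum _ fun j _ => h i j (ξ j)
  exact ((PiLp.continuousLinearEquiv 2 ℂ (fun _ : Fin q => V)).symm.continuous.tendsto _).comp h1

theorem norm_blockOp_unitaryPullback_le {q : ℕ} (U : Fock n ≃ₗᵢ[ℂ] H)
    (M : Matrix (Fin q) (Fin q) (HTensor K H →L[ℂ] HTensor K H)) :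
    ‖blockOp (fun i j => unitaryPullback K U (M i j))‖ ≤ ‖blockOp M‖ :=
  norm_blockOp_conj_le M _ _
    ((norm_hMap_id_left_le _).trans (norm_coe_linearIsometryEquiv_le U.symm))
    ((norm_hMap_id_left_le _).trans (norm_coe_linearIsometryEquiv_le U))

/-- The upper bound is the complete contractivity of `B_X`. For leastness the points `r W`,
transported to `H`, suffice: the matrices of values there converge strongly to `[T_{ij}]`, and a
bound on norms survives strong limits. -/
theorem isLUB_matrixNormValues (hm : ∀ i, 1 ≤ m i) (U : Fock n ≃ₗᵢ[ℂ] H) {q : ℕ}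
    (M : Matrix (Fin q) (Fin q) (multiToeplitz n m K)) :
    IsLUB (matrixNormValues fun i j => toeplitzTransform.{w} n K hm (M i j))
      ‖blockOp (fun i j => (M i j : HTensor K (Fock n) →L[ℂ] HTensor K (Fock n)))‖ := by
  constructor
  · rintro _ ⟨E, X, rfl⟩
    exact norm_blockOp_berezin_le hm X.2
      fun i j => (M i j : HTensor K (Fock n) →L[ℂ] HTensor K (Fock n))
  · intro c hc
    have hr : ∀ r : ℝ, 0 ≤ r ∧ r < 1 → ‖blockOp (fun i j => valueAtModel
        ((toeplitzTransform.{w} n K hm (M i j)).1 ⟨H⟩) U r)‖ ≤ c := by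
      intro r hr
      simp only [valueAtModel_eq hm _ U hr.1 hr.2]
      exact (norm_blockOp_unitaryPullback_le U _).trans (hc ⟨⟨H⟩, _, rfl⟩)
    -- The point `r = 0` shows that there are values at all, so an upper bound is nonnegative even
    -- for `q = 0`.
    have hc0 : 0 ≤ c := (norm_nonneg _).trans (hr 0 ⟨le_rfl, zero_lt_one⟩)
    refine ContinuousLinearMap.opNorm_le_bound _ hc0 fun ξ => ?_
    have h1 := tendsto_blockOp (fun i j x =>
      isRadialSOTLimit_toeplitzTransform (H := H) hm (M i j) U x) ξ
    refine le_of_tendsto h1.norm ?_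
    filter_upwards [eventually_mem_Ico] with r h
    exact (ContinuousLinearMap.le_opNorm _ _).trans
      (mul_le_mul_of_nonneg_right (hr r h) (norm_nonneg _))

end Correspondence

end PolyHyperball

end

/-! ### The correspondence theorem -/

theorem mainTheorem3 {k : ℕ} (hk : 0 < k) (n m : Fin k → ℕ)
    (hn : ∀ i, 1 ≤ n i) (hm : ∀ i, 1 ≤ m i)
    (K : Type v) [NormedAddCommGroup K] [InnerProductSpace ℂ K] [CompleteSpace K]
    (H : Type w) [NormedAddCommGroup H] [InnerProductSpace ℂ H] [CompleteSpace H]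
    [TopologicalSpace.SeparableSpace H] (hH : ¬ FiniteDimensional ℂ H) :
    (∀ F : radial n m H → minTensor K H,
      ((∃ G ∈ boundedPluriharmonic.{w} n m K, G ⟨H⟩ = F) ↔
        ∃ T ∈ multiToeplitz n m K, ∀ X : radial n m H,
          (F X : HTensor K H →L[ℂ] HTensor K H) = berezin m X.1 T) ∧
      ∀ T ∈ multiToeplitz n m K,
        (∀ X : radial n m H, (F X : HTensor K H →L[ℂ] HTensor K H) = berezin m X.1 T) →
          IsRadialSOTLimit F T) ∧
    ∃ Φ : boundedPluriharmonic.{w} n m K ≃ₗ[ℂ] multiToeplitz n m K,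
      (∀ G : boundedPluriharmonic.{w} n m K,
        (∀ X : radial n m H, (G.1 ⟨H⟩ X : HTensor K H →L[ℂ] HTensor K H) =
          berezin m X.1 (Φ G : HTensor K (Fock n) →L[ℂ] HTensor K (Fock n))) ∧
        IsRadialSOTLimit (G.1 ⟨H⟩) (Φ G : HTensor K (Fock n) →L[ℂ] HTensor K (Fock n))) ∧
      ∀ (q : ℕ) (M : Matrix (Fin q) (Fin q) (boundedPluriharmonic.{w} n m K)),
        IsLUB (matrixNormValues M)
          ‖blockOp (fun i j =>
            (Φ (M i j) : HTensor K (Fock n) →L[ℂ] HTensor K (Fock n)))‖ := by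
  obtain ⟨U⟩ := exists_unitary_fock hk hn H hH
  have hinj := toeplitzTransform_injective.{w} (K := K) hm U
  have hsurj := toeplitzTransform_surjective.{w} (K := K) hm U
  -- `Φ` is the inverse of `toeplitzTransform`. Keeping only its left-inverse property is enough, as
  -- every bounded function is the transform of some `T`.
  obtain ⟨Φ, hΦ⟩ : ∃ Φ : boundedPluriharmonic.{w} n m K ≃ₗ[ℂ] multiToeplitz n m K,
      ∀ T, Φ (toeplitzTransform.{w} n K hm T) = T :=
    have hbij : Function.Bijective (toeplitzTransform.{w} n K hm) := ⟨hinj, hsurj⟩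
    ⟨(LinearEquiv.ofBijective _ hbij).symm, fun T =>
      (LinearEquiv.ofBijective _ hbij).symm_apply_apply T⟩
  refine ⟨fun F => ⟨⟨?_, ?_⟩, fun T hT hF => isRadialSOTLimit_of_eq_berezin hm hT hF⟩,
    Φ, fun G => ?_, fun q M => ?_⟩
  · rintro ⟨G, hG, rfl⟩
    obtain ⟨T, hT⟩ := hsurj ⟨G, hG⟩
    obtain rfl : (toeplitzTransform.{w} n K hm T).1 = G := congrArg Subtype.val hT
    exact ⟨T.1, T.2, fun X => toeplitzTransform_apply hm T ⟨H⟩ X⟩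
  · rintro ⟨T, hT, hF⟩
    refine ⟨_, (toeplitzTransform.{w} n K hm ⟨T, hT⟩).2, funext fun X => Subtype.ext ?_⟩
    rw [hF]
    exact toeplitzTransform_apply hm ⟨T, hT⟩ ⟨H⟩ X
  · obtain ⟨T, rfl⟩ := hsurj G
    rw [hΦ]
    exact ⟨fun X => toeplitzTransform_apply hm T ⟨H⟩ X, isRadialSOTLimit_toeplitzTransform hm T⟩
  · choose T hT using fun i j => hsurj (M i j)
    obtain rfl : (fun i j => toeplitzTransform.{w} n K hm (T i j)) = M := funext₂ hT
    simp only [hΦ]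
    exact isLUB_matrixNormValues hm U T
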